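/- All graphs are finite and simple. A graphon is a Borel measurable symmetric function $W\colon[0,1]^2\to[0,1]$. For a graph $H$ with $\|H\|$ edges and a bounded symmetric measurable $W\colon[0,1]^2\to\mathbb{R}$ let $$t(H,W)=\int_{[0,1]^{V(H)}}\prod_{uv\in E(H)}W(x_u,x_v)\,dx .$$ For a partition $\mathcal P$ of $[0,1]$ into finitely many non-null measurable sets, let $W^{\mathcal P}(x,y)=\frac{1}{|J||J'|}\int_{J\times J'}W$, where $J,J'\in\mathcal P$ are the parts containing $x$ and $y$. The graph $H$ has the step Sidorenko property if $t(H,W^{\mathcal P})\le t(H,W)$ for every graphon $W$ and every such partition $\mathcal P$. The graph $H$ is weakly norming if $\|W\|_H=t(H,W)^{1/\|H\|}$ is a norm on the space of graphons, i.e. for every graphon $W$, $\|W\|_H=0$ if and only if $W=0$ almost everywhere, and $\|W_1+W_2\|_H\le\|W_1\|_H+\|W_2\|_H$ for all graphons $W_1,W_2$. A graph is edge-transitive if each of its edges can be mapped to any other by an automorphism. $C_\ell$ denotes the cycle of length $\ell\ge3$, $\square$ denotes the Cartesian product, and the $d$-dimensional hypercube is the Cartesian product of $d$ copies of $K_2$.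 1. Let $k\ge2$ and $\ell_1,\dots,\ell_k\ge3$, and let $H=C_{\ell_1}\square\cdots\square C_{\ell_k}$. Then $H$ has the step Sidorenko property if and only if $\ell_1=\cdots=\ell_k=4$. The condition $\ell_1=\cdots=\ell_k=4$ holds if and only if $H$ is isomorphic to a hypercube, and if and only if $H$ is weakly norming. 2. For every $k\ge2$ and every even $n\ge4$, the product of $k$ copies of $C_n$ is connected, bipartite and edge-transitive, and it is weakly norming if and only if $n=4$. 3. In particular, there is a connected, bipartite, edge-transitive graph with at least one edge that is not weakly norming, so the answer to Hatami's question whether all bipartite edge-transitive graphs are weakly norming is negative. -/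

import Mathlib

open MeasureTheory
open scoped unitInterval

noncomputable section

/-! ### Graphs -/

namespace SimpleGraph

/-- The Cartesian product of a family of graphs: two vertices are adjacent when they are adjacent
in exactly one coordinate and agree in all the others. -/
def cartesianProduct {ι : Type*} {V : ι → Type*} (G : ∀ i, SimpleGraph (V i)) :
    SimpleGraph (∀ i, V i) where
  Adj u v := ∃ i, (G i).Adj (u i) (v i) ∧ ∀ j, j ≠ i → u j = v j
  symm := ⟨fun _ _ ⟨i, h, h'⟩ => ⟨i, h.symm, fun j hj => (h' j hj).symm⟩⟩
  loopless := ⟨fun _ ⟨_, h, _⟩ => h.ne rfl⟩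

/-- The toroidal grid: the Cartesian product of the cycles of lengths `ℓ 0, …, ℓ (k - 1)`. -/
def toroidalGrid {k : ℕ} (ℓ : Fin k → ℕ) : SimpleGraph (∀ i, Fin (ℓ i)) :=
  cartesianProduct fun i => cycleGraph (ℓ i)

/-- The `d`-dimensional hypercube graph: the Cartesian product of `d` copies of `K₂`. -/
def hypercube (d : ℕ) : SimpleGraph (Fin d → Bool) :=
  cartesianProduct fun _ => (⊤ : SimpleGraph Bool)

/-- Any edge can be mapped to any other edge by an automorphism of the graph. -/
def IsEdgeTransitive {V : Type*} (H : SimpleGraph V) : Prop :=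
  ∀ e ∈ H.edgeSet, ∀ e' ∈ H.edgeSet, ∃ φ : H ≃g H, e.map φ = e'

end SimpleGraph

/-! ### Graphons -/

/-- A bounded symmetric Borel measurable function `[0,1]² → ℝ`. -/
structure SymKernel where
  toFun : I → I → ℝ
  measurable' : Measurable (Function.uncurry toFun)
  symm' : ∀ x y, toFun x y = toFun y x
  bounded' : ∃ C : ℝ, ∀ x y, |toFun x y| ≤ C

namespace SymKernel

instance : CoeFun SymKernel fun _ => I → I → ℝ := ⟨SymKernel.toFun⟩

/-- The pointwise sum. -/
instance : Add SymKernel where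
  add W₁ W₂ :=
    { toFun := fun x y => W₁ x y + W₂ x y
      measurable' := W₁.measurable'.add W₂.measurable'
      symm' := fun x y => by rw [W₁.symm' x y, W₂.symm' x y]
      bounded' := by
        obtain ⟨C₁, h₁⟩ := W₁.bounded'
        obtain ⟨C₂, h₂⟩ := W₂.bounded'
        exact ⟨C₁ + C₂, fun x y => (abs_add_le _ _).trans (add_le_add (h₁ x y) (h₂ x y))⟩ }

/-- A graphon is a symmetric measurable function `[0,1]² → [0,1]`. -/
def IsGraphon (W : SymKernel) : Prop := ∀ x y, W x y ∈ Set.Icc (0 : ℝ) 1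

/-- For a point `x` of `[0,1]^V`, the value `W (x u) (x v)` at the unordered pair `{u, v}`. -/
def onPair {V : Type*} (W : SymKernel) (x : V → I) : Sym2 V → ℝ :=
  Sym2.lift ⟨fun u v => W (x u) (x v), fun _ _ => W.symm' _ _⟩

end SymKernel

/-- A partition of `[0,1]` into finitely many non-null measurable sets, given by the map that sends
a point to the index of its part. -/
structure NonnullPartition where
  card : ℕ
  index : I → Fin card
  measurable_index : Measurable index
  nonnull : ∀ j, volume (index ⁻¹' {j}) ≠ 0

/-- The part with index `j`. -/
def NonnullPartition.part (P : NonnullPartition) (j : Fin P.card) : Set I := P.index ⁻¹' {j}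

namespace SymKernel

/-- The average of `W` over the product of the parts with indices `i` and `j`. -/
def blockAverage (W : SymKernel) (P : NonnullPartition) (i j : Fin P.card) : ℝ :=
  (∫ p in P.part i ×ˢ P.part j, W p.1 p.2) / (volume.real (P.part i) * volume.real (P.part j))

theorem blockAverage_comm (W : SymKernel) (P : NonnullPartition) (i j : Fin P.card) :
    W.blockAverage P i j = W.blockAverage P j i := by
  unfold blockAverage
  rw [mul_comm (volume.real (P.part i))]
  congr 1
  rw [Measure.volume_eq_prod, ← Measure.prod_restrict, ← Measure.prod_restrict,
    ← integral_prod_swap]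
  exact integral_congr_ae (Filter.Eventually.of_forall fun p => W.symm' _ _)

/-- The stepping operator `W ↦ W^P`. -/
def step (W : SymKernel) (P : NonnullPartition) : SymKernel where
  toFun x y := W.blockAverage P (P.index x) (P.index y)
  measurable' :=
    (measurable_of_finite fun q : Fin P.card × Fin P.card => W.blockAverage P q.1 q.2).comp
      ((P.measurable_index.comp measurable_fst).prodMk (P.measurable_index.comp measurable_snd))
  symm' _ _ := W.blockAverage_comm P _ _
  bounded' := by
    obtain ⟨C, hC⟩ := (Set.finite_range
      fun q : Fin P.card × Fin P.card => |W.blockAverage P q.1 q.2|).bddAbove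
    exact ⟨C, fun x y => hC ⟨(P.index x, P.index y), rfl⟩⟩

end SymKernel

/-! ### Densities, the step Sidorenko property and weakly norming graphs -/

namespace SimpleGraph

variable {V : Type*} [Fintype V]

open Classical in
/-- The homomorphism density `t(H, W)`, for a bounded symmetric measurable function `W`. -/
def homDensity (H : SimpleGraph V) (W : SymKernel) : ℝ :=
  ∫ x : V → I, ∏ e ∈ H.edgeFinset, W.onPair x e

/-- `t(H, W^P) ≤ t(H, W)` for every graphon `W` and every finite partition `P` of `[0,1]` into
non-null measurable sets. -/
def StepSidorenko (H : SimpleGraph V) : Prop :=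
  ∀ W : SymKernel, W.IsGraphon → ∀ P : NonnullPartition,
    H.homDensity (W.step P) ≤ H.homDensity W

/-- `‖W‖_H = t(H, W) ^ (1 / ‖H‖)`, where `‖H‖` is the number of edges of `H`. -/
def graphNorm (H : SimpleGraph V) (W : SymKernel) : ℝ :=
  H.homDensity W ^ (1 / (H.edgeSet.ncard : ℝ))

/-- `‖·‖_H` is a norm on the space of graphons: it vanishes exactly on the graphons that are zero
almost everywhere, and it satisfies the triangle inequality. -/
def IsWeaklyNorming (H : SimpleGraph V) : Prop :=
  (∀ W : SymKernel, W.IsGraphon →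
    (H.graphNorm W = 0 ↔ ∀ᵐ p : I × I, W p.1 p.2 = 0)) ∧
  ∀ W₁ W₂ : SymKernel, W₁.IsGraphon → W₂.IsGraphon →
    H.graphNorm (W₁ + W₂) ≤ H.graphNorm W₁ + H.graphNorm W₂

end SimpleGraph

end

noncomputable section

/-! ### Integration over finite powers of the unit interval -/

/-! Positive direction. A power of `C₄` is a hypercube, and a hypercube has many reflections whose
fixed vertices separate its two sides. Cauchy–Schwarz along such a reflection bounds the square of a
density with nonnegative kernels on the edges by the product of the densities obtained by copying
either side onto the other (`Fold.sq_decoratedDensity_le`). Suitable folds compose to a map onto a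
single edge. A decoration of maximal density stays maximal under each fold and ends up constant,
which gives a Hölder inequality (`FoldsToEdge.decoratedDensity_le_prod`). Expanding a product of
sums then yields the triangle inequality, and replacing `W^P` by `W` at one edge yields the step
Sidorenko property.

Negative direction. Odd lengths are excluded because both properties force bipartiteness. Let all
lengths be even, with some `ℓ i ≥ 6`, and let `a = e_i`, `b = e_j`. The test kernel lives on the
edges of the torus itself, with vertex weights `τ ^ p`, and the vertex `0` is split into two halves
whose weights towards `u` are multiplied by `1 ± f u`, where `f a = 1`, `f b = -η` and `f = 0`
elsewhere. Averaging the halves removes `f`, and so does averaging the kernels of `f` and `-f`,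
which have equal density. Hence either property would forbid that splitting decreases the density.

The change of density is a sum over endomorphisms `φ` of the torus, with powers of `τ` as
coefficients. A term is nonzero only if some vertex sent to `0` has two neighbours sent into `{a,
b}`. The potential `p` makes the surviving terms of least exponent those that hit `{0, a, b}`
exactly three times and have the largest total distance to `{0, a, b}`. The identity is among them
and contributes `f a * f b = -η`. A pair of neighbours sent to `b` contributes only `η ^ 2`, so the
sole danger is a pair sent to `a`, contributing `1`.

Rigidity excludes that danger (`Torus.not_both_of_sum_tripleDist_eq`). Homomorphisms are
1-Lipschitz, so an extremal one preserves distances to the corner and distances to `0`. If both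
neighbours went to `e_i`, coordinate squares could be followed through the torus to a vertex two
below the diameter whose image has `i`-th coordinate `0`. Such an image lies at least `ℓ i / 2 ≥ 3`
below the diameter, a contradiction. Letting `τ` tend to `0` finishes the proof. -/

theorem integral_unitInterval_sum {α β V : Type*} [Fintype α] [Fintype β] [Fintype V]
    (e : α ⊕ β ≃ V) (Φ : (V → I) → ℝ) :
    ∫ x, Φ x = ∫ p : (α → I) × (β → I), Φ fun v => Sum.elim p.1 p.2 (e.symm v) := by
  have h₁ := volume_measurePreserving_sumPiEquivProdPi_symm (fun _ : α ⊕ β => I)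
  have h₂ := volume_measurePreserving_piCongrLeft (fun _ : V => I) e
  have h := h₂.comp h₁
  have hemb : MeasurableEmbedding (⇑(MeasurableEquiv.piCongrLeft (fun _ : V => I) e) ∘
      ⇑(MeasurableEquiv.sumPiEquivProdPi (fun _ : α ⊕ β => I)).symm) :=
    (MeasurableEquiv.measurableEmbedding _).comp (MeasurableEquiv.measurableEmbedding _)
  rw [← h.integral_comp hemb]
  refine integral_congr_ae (Filter.Eventually.of_forall fun p => ?_)
  simp only [Function.comp_apply]
  congr 1
  funext v
  obtain ⟨s, rfl⟩ := e.surjective v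
  rw [Equiv.symm_apply_apply]
  rcases s with a | b
  · exact Equiv.piCongrLeft_apply_apply (fun _ : V => I) e _ (Sum.inl a)
  · exact Equiv.piCongrLeft_apply_apply (fun _ : V => I) e _ (Sum.inr b)

theorem integral_unitInterval_congr {V V' : Type*} [Fintype V] [Fintype V']
    (e : V' ≃ V) (Φ : (V → I) → ℝ) :
    ∫ x, Φ x = ∫ y : V' → I, Φ fun v => y (e.symm v) := by
  have h := volume_measurePreserving_piCongrLeft (fun _ : V => I) e
  rw [← h.integral_comp (MeasurableEquiv.measurableEmbedding _)]
  refine integral_congr_ae (Filter.Eventually.of_forall fun p => ?_)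
  dsimp only
  congr 1
  funext v
  obtain ⟨s, rfl⟩ := e.surjective v
  rw [Equiv.symm_apply_apply]
  exact Equiv.piCongrLeft_apply_apply (fun _ : V => I) e _ s

/-- Two distinct coordinates of a uniform point of the cube are independent of the others. -/
theorem exists_pair_split {V : Type*} [Fintype V] {u v : V} (huv : u ≠ v) :
    ∃ e : {w // w ≠ u ∧ w ≠ v} ⊕ Fin 2 ≃ V, e (Sum.inr 0) = u ∧ e (Sum.inr 1) = v ∧
      ∀ w, e (Sum.inl w) = w := by
  classical
  refine ⟨Equiv.ofBijective (Sum.elim (fun w => w.1) ![u, v]) ⟨?_, ?_⟩, rfl, rfl, fun _ => rfl⟩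
  · rintro (⟨a, ha⟩ | a) (⟨b, hb⟩ | b) h
    · simpa using h
    · fin_cases b
      · exact absurd h ha.1
      · exact absurd h ha.2
    · fin_cases a
      · exact absurd h.symm hb.1
      · exact absurd h.symm hb.2
    · fin_cases a <;> fin_cases b <;> simp_all
  · intro w
    by_cases h1 : w = u
    · exact ⟨Sum.inr 0, h1.symm⟩
    by_cases h2 : w = v
    · exact ⟨Sum.inr 1, h2.symm⟩
    exact ⟨Sum.inl ⟨w, h1, h2⟩, rfl⟩

theorem integral_fin_two (Ψ : I → I → ℝ) :
    ∫ q : Fin 2 → I, Ψ (q 0) (q 1) = ∫ p : I × I, Ψ p.1 p.2 := by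
  rw [← (volume_preserving_finTwoArrow I).integral_comp (MeasurableEquiv.measurableEmbedding _)]
  rfl

theorem integrable_of_measurable_bounded {X : Type*} [MeasurableSpace X] {μ : Measure X}
    [IsFiniteMeasure μ] {f : X → ℝ} (hf : Measurable f) {C : ℝ} (hC : ∀ x, |f x| ≤ C) :
    Integrable f μ :=
  Integrable.of_bound hf.aestronglyMeasurable C
    (Filter.Eventually.of_forall fun x => by simpa [Real.norm_eq_abs] using hC x)

/-! ### Kernels evaluated on edges, and decorated densities -/

namespace SymKernel

theorem ext' {W W' : SymKernel} (h : ∀ x y, W x y = W' x y) : W = W' := by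
  cases W; cases W'
  congr
  funext x y
  exact h x y

@[simp] theorem onPair_mk {V : Type*} (W : SymKernel) (x : V → I) (u v : V) :
    W.onPair x s(u, v) = W (x u) (x v) := rfl

theorem measurable_onPair {V : Type*} (W : SymKernel) (e : Sym2 V) :
    Measurable fun x : V → I => W.onPair x e := by
  induction e with
  | _ u v =>
    exact W.measurable'.comp (f := fun x : V → I => (x u, x v))
      ((measurable_pi_apply u).prodMk (measurable_pi_apply v))

theorem onPair_map {V V' : Type*} (W : SymKernel) (x : V' → I) (g : V → V') (e : Sym2 V) :
    W.onPair x (e.map g) = W.onPair (fun v => x (g v)) e := by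
  induction e with
  | _ u v => rfl

theorem onPair_add {V : Type*} (W₁ W₂ : SymKernel) (x : V → I) (e : Sym2 V) :
    (W₁ + W₂).onPair x e = W₁.onPair x e + W₂.onPair x e := by
  induction e with
  | _ u v => rfl

theorem abs_onPair_le {V : Type*} (W : SymKernel) {C : ℝ} (hC : ∀ x y, |W x y| ≤ C)
    (x : V → I) (e : Sym2 V) : |W.onPair x e| ≤ C := by
  induction e with
  | _ u v => exact hC _ _

theorem onPair_nonneg {V : Type*} (W : SymKernel) (hW : ∀ x y, 0 ≤ W x y)
    (x : V → I) (e : Sym2 V) : 0 ≤ W.onPair x e := by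
  induction e with
  | _ u v => exact hW _ _

end SymKernel

namespace SimpleGraph

variable {V : Type*} [Fintype V]

open Classical in
/-- The density of `H` with a kernel attached to every edge. -/
def decoratedDensity (H : SimpleGraph V) (c : Sym2 V → SymKernel) : ℝ :=
  ∫ x : V → I, ∏ e ∈ H.edgeFinset, (c e).onPair x e

theorem homDensity_eq_decoratedDensity (H : SimpleGraph V) (W : SymKernel) :
    H.homDensity W = H.decoratedDensity fun _ => W := rfl

theorem exists_bound_decorated (c : Sym2 V → SymKernel) :
    ∃ C : ℝ, 0 ≤ C ∧ ∀ e x, |(c e).onPair x e| ≤ C := by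
  classical
  choose B hB using fun e => (c e).bounded'
  have hB0 : ∀ e, 0 ≤ B e := fun e => (abs_nonneg _).trans (hB e 0 0)
  refine ⟨∑ e, B e, Finset.sum_nonneg fun e _ => hB0 e, fun e x => ?_⟩
  exact ((c e).abs_onPair_le (hB e) x e).trans
    (Finset.single_le_sum (fun e _ => hB0 e) (Finset.mem_univ e))

theorem measurable_prod_onPair {V : Type*} (s : Finset (Sym2 V)) (c : Sym2 V → SymKernel) :
    Measurable fun x : V → I => ∏ e ∈ s, (c e).onPair x e :=
  Finset.measurable_fun_prod _ fun e _ => (c e).measurable_onPair e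

theorem exists_bound_prod_onPair (s : Finset (Sym2 V)) (c : Sym2 V → SymKernel) :
    ∃ C : ℝ, ∀ x, |∏ e ∈ s, (c e).onPair x e| ≤ C := by
  obtain ⟨C, hC0, hC⟩ := exists_bound_decorated c
  refine ⟨∏ _e ∈ s, C, fun x => ?_⟩
  rw [Finset.abs_prod]
  exact Finset.prod_le_prod (fun _ _ => abs_nonneg _) fun e _ => hC e x

theorem integrable_prod_onPair (s : Finset (Sym2 V)) (c : Sym2 V → SymKernel) :
    Integrable fun x : V → I => ∏ e ∈ s, (c e).onPair x e := by
  obtain ⟨C, hC⟩ := exists_bound_prod_onPair s c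
  exact integrable_of_measurable_bounded (measurable_prod_onPair s c) hC

theorem decoratedDensity_nonneg (H : SimpleGraph V) (c : Sym2 V → SymKernel)
    (hc : ∀ e x y, 0 ≤ c e x y) : 0 ≤ H.decoratedDensity c :=
  integral_nonneg fun x => Finset.prod_nonneg fun e _ => (c e).onPair_nonneg (hc e) x e

/-! ### Invariance under isomorphisms -/

variable {V' : Type*} [Fintype V']

theorem sym2_map_map_symm {V V' : Type*} {H : SimpleGraph V} {H' : SimpleGraph V'}
    (φ : H ≃g H') (e : Sym2 V') : (e.map φ.symm).map φ = e := by
  induction e with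
  | _ u v => simp

theorem homDensity_congr {H : SimpleGraph V} {H' : SimpleGraph V'} (φ : H ≃g H')
    (W : SymKernel) : H.homDensity W = H'.homDensity W := by
  classical
  unfold homDensity
  rw [integral_unitInterval_congr φ.symm.toEquiv]
  refine integral_congr_ae (Filter.Eventually.of_forall fun x => ?_)
  dsimp only
  refine Finset.prod_bij (fun e _ => e.map φ) ?_ ?_ ?_ ?_
  · intro e he
    rw [mem_edgeFinset] at he ⊢
    exact φ.toHom.map_mem_edgeSet he
  · intro e _ e' _ h
    exact Sym2.map.injective φ.injective h
  · intro e he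
    rw [mem_edgeFinset] at he
    refine ⟨e.map φ.symm, ?_, ?_⟩
    · rw [mem_edgeFinset]
      exact φ.symm.toHom.map_mem_edgeSet he
    · exact sym2_map_map_symm φ e
  · intro e _
    rw [SymKernel.onPair_map]
    rfl

theorem ncard_edgeSet_congr {V V' : Type*} {H : SimpleGraph V} {H' : SimpleGraph V'} (φ : H ≃g H') :
    H.edgeSet.ncard = H'.edgeSet.ncard :=
  Nat.card_congr φ.mapEdgeSet

theorem graphNorm_congr {H : SimpleGraph V} {H' : SimpleGraph V'} (φ : H ≃g H')
    (W : SymKernel) : H.graphNorm W = H'.graphNorm W := by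
  unfold graphNorm
  rw [homDensity_congr φ, ncard_edgeSet_congr φ]

theorem isWeaklyNorming_congr {H : SimpleGraph V} {H' : SimpleGraph V'} (φ : H ≃g H') :
    H.IsWeaklyNorming ↔ H'.IsWeaklyNorming := by
  unfold IsWeaklyNorming
  simp only [graphNorm_congr φ]

theorem stepSidorenko_congr {H : SimpleGraph V} {H' : SimpleGraph V'} (φ : H ≃g H') :
    H.StepSidorenko ↔ H'.StepSidorenko := by
  unfold StepSidorenko
  simp only [homDensity_congr φ]

theorem isEdgeTransitive_congr {V V' : Type*} {H : SimpleGraph V} {H' : SimpleGraph V'}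
    (φ : H ≃g H') (h : H.IsEdgeTransitive) : H'.IsEdgeTransitive := by
  intro e he e' he'
  obtain ⟨ψ, hψ⟩ := h (e.map φ.symm) (φ.symm.toHom.map_mem_edgeSet he)
    (e'.map φ.symm) (φ.symm.toHom.map_mem_edgeSet he')
  refine ⟨(φ.symm.trans ψ).trans φ, ?_⟩
  rw [← sym2_map_map_symm φ e', ← hψ, Sym2.map_map, Sym2.map_map]
  rfl

end SimpleGraph

/-! ### Cauchy–Schwarz for folds -/

/-- Weighted Cauchy–Schwarz: the quadratic `t ↦ ∫ w (t g + f)²` is nonnegative, so its discriminant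
is at most `0`. -/
theorem sq_integral_mul_le_of_bounded {X : Type*} [MeasurableSpace X] {μ : Measure X}
    [IsFiniteMeasure μ] {w f g : X → ℝ} (hw : Measurable w) (hf : Measurable f)
    (hg : Measurable g) {C : ℝ} (hwC : ∀ x, |w x| ≤ C) (hfC : ∀ x, |f x| ≤ C)
    (hgC : ∀ x, |g x| ≤ C) (hw0 : ∀ x, 0 ≤ w x) :
    (∫ x, w x * (f x * g x) ∂μ) ^ 2 ≤
      (∫ x, w x * (f x * f x) ∂μ) * ∫ x, w x * (g x * g x) ∂μ := by
  have hint : ∀ {h k : X → ℝ}, Measurable h → Measurable k → (∀ x, |h x| ≤ C) →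
      (∀ x, |k x| ≤ C) → Integrable (fun x => w x * (h x * k x)) μ := by
    intro h k hh hk hhC hkC
    refine integrable_of_measurable_bounded (C := C * (C * C)) (hw.mul (hh.mul hk)) fun x => ?_
    have hC : 0 ≤ C := (abs_nonneg _).trans (hwC x)
    rw [abs_mul, abs_mul]
    exact mul_le_mul (hwC x) (mul_le_mul (hhC x) (hkC x) (abs_nonneg _) hC) (by positivity) hC
  have key : ∀ t : ℝ, 0 ≤ (∫ x, w x * (g x * g x) ∂μ) * (t * t) +
      (2 * ∫ x, w x * (f x * g x) ∂μ) * t + ∫ x, w x * (f x * f x) ∂μ := by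
    intro t
    have h : ∫ x, w x * ((t * g x + f x) * (t * g x + f x)) ∂μ =
        (∫ x, w x * (g x * g x) ∂μ) * (t * t) +
          (2 * ∫ x, w x * (f x * g x) ∂μ) * t + ∫ x, w x * (f x * f x) ∂μ := by
      rw [← integral_mul_const, ← integral_const_mul, ← integral_mul_const, ← integral_add,
        ← integral_add]
      · refine integral_congr_ae (Filter.Eventually.of_forall fun x => ?_)
        dsimp only
        ring
      · exact ((hint hg hg hgC hgC).mul_const _).add
          (((hint hf hg hfC hgC).const_mul _).mul_const _)
      · exact hint hf hf hfC hfC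
      · exact (hint hg hg hgC hgC).mul_const _
      · exact ((hint hf hg hfC hgC).const_mul _).mul_const _
    rw [← h]
    exact integral_nonneg fun x => mul_nonneg (hw0 x) (mul_self_nonneg _)
  have := discrim_le_zero key
  rw [discrim] at this
  nlinarith

namespace SimpleGraph

variable {V : Type*}

/-- A reflection of a graph whose set of fixed points separates `pos` from its mirror image. -/
structure Fold (H : SimpleGraph V) where
  refl : V → V
  pos : Set V
  involutive : Function.Involutive refl
  map_adj : ∀ {u v}, H.Adj u v → H.Adj (refl u) (refl v)
  refl_notMem : ∀ {v}, v ∈ pos → refl v ∉ pos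
  cover : ∀ v, refl v = v ∨ v ∈ pos ∨ refl v ∈ pos
  separated : ∀ {u v}, u ∈ pos → refl v ∈ pos → ¬ H.Adj u v

namespace Fold

variable {H : SimpleGraph V} (θ : Fold H)

theorem ne_of_mem {v : V} (hv : v ∈ θ.pos) : θ.refl v ≠ v := fun h =>
  θ.refl_notMem hv (h.symm ▸ hv)

/-- The fold that keeps the other side. -/
def opp : Fold H where
  refl := θ.refl
  pos := {v | θ.refl v ∈ θ.pos}
  involutive := θ.involutive
  map_adj := θ.map_adj
  refl_notMem := fun {v} hv hv' => θ.refl_notMem hv hv'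
  cover := fun v => by
    rcases θ.cover v with h | h | h
    · exact Or.inl h
    · exact Or.inr (Or.inr (by simpa [θ.involutive v] using h))
    · exact Or.inr (Or.inl h)
  separated := fun {u v} hu hv huv => by
    rw [Set.mem_ofPred_eq, θ.involutive v] at hv
    exact θ.separated hv hu huv.symm

open Classical in
/-- The folding map onto the fixed points and the positive side. -/
def toFun (v : V) : V := if θ.refl v ∈ θ.pos then θ.refl v else v

open Classical in
theorem opp_toFun (v : V) : θ.opp.toFun v = if v ∈ θ.pos then θ.refl v else v := by
  unfold toFun
  congr 1
  simp [opp, θ.involutive v]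

/-- The decomposition of the vertices into fixed points, positive vertices and their mirror
images. -/
def vertexEquiv : {v // θ.refl v = v} ⊕ (θ.pos ⊕ θ.pos) ≃ V :=
  Equiv.ofBijective
    (Sum.elim (fun v => v.1) (Sum.elim (fun v => v.1) fun v => θ.refl v.1)) <| by
    constructor
    · rintro (⟨a, ha⟩ | ⟨a, ha⟩ | ⟨a, ha⟩) (⟨b, hb⟩ | ⟨b, hb⟩ | ⟨b, hb⟩) h <;>
        simp only [Sum.elim_inl, Sum.elim_inr] at h
      · simpa using h
      · exact absurd (h ▸ ha) (θ.ne_of_mem hb)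
      · subst h
        exact absurd (ha.symm.trans (θ.involutive b)) (θ.ne_of_mem hb)
      · exact absurd (h ▸ hb) (θ.ne_of_mem ha)
      · simpa using h
      · exact absurd (h ▸ ha) (θ.refl_notMem hb)
      · subst h
        exact absurd (hb.symm.trans (θ.involutive a)) (θ.ne_of_mem ha)
      · exact absurd (h ▸ hb) (θ.refl_notMem ha)
      · simpa using θ.involutive.injective h
    · intro v
      rcases θ.cover v with h | h | h
      · exact ⟨Sum.inl ⟨v, h⟩, rfl⟩
      · exact ⟨Sum.inr (Sum.inl ⟨v, h⟩), rfl⟩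
      · exact ⟨Sum.inr (Sum.inr ⟨_, h⟩), θ.involutive v⟩

open Classical in
/-- The symmetric extension of a point given on the fixed and the positive vertices. -/
def extend (p : {v // θ.refl v = v} → I) (q : θ.pos → I) (v : V) : I :=
  if h : θ.refl v = v then p ⟨v, h⟩ else if h : v ∈ θ.pos then q ⟨v, h⟩ else
    if h : θ.refl v ∈ θ.pos then q ⟨_, h⟩ else 0

theorem measurable_extend :
    Measurable fun z : ({v // θ.refl v = v} → I) × (θ.pos → I) => θ.extend z.1 z.2 := by
  refine measurable_pi_lambda _ fun v => ?_
  unfold extend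
  split_ifs
  · exact (measurable_pi_apply _).comp measurable_fst
  · exact (measurable_pi_apply _).comp measurable_snd
  · exact (measurable_pi_apply _).comp measurable_snd
  · exact measurable_const

theorem extend_fixed {v : V} (h : θ.refl v = v) (p q) : θ.extend p q v = p ⟨v, h⟩ := by
  simp [extend, h]

theorem extend_pos {v : V} (h : v ∈ θ.pos) (p q) : θ.extend p q v = q ⟨v, h⟩ := by
  simp [extend, h, θ.ne_of_mem h]

variable [Fintype V]

-- Given the fixed coordinates, the positive and the mirrored coordinates are independent with the
-- same distribution, so the inner integral factors. The `0` in `extend p 0` is a dummy, since `P`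
-- depends on the fixed coordinates only.
open Classical in
theorem integral_split {P G₁ G₂ : (V → I) → ℝ} (hP : Measurable P) (h₁ : Measurable G₁)
    (h₂ : Measurable G₂) {C : ℝ} (hPC : ∀ x, |P x| ≤ C) (h₁C : ∀ x, |G₁ x| ≤ C)
    (h₂C : ∀ x, |G₂ x| ≤ C)
    (hPd : ∀ x y, (∀ v, θ.refl v = v → x v = y v) → P x = P y)
    (h₁d : ∀ x y, (∀ v, θ.refl v = v ∨ v ∈ θ.pos → x v = y v) → G₁ x = G₁ y)
    (h₂d : ∀ x y, (∀ v, θ.refl v = v ∨ v ∈ θ.pos → x v = y v) → G₂ x = G₂ y) :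
    ∫ x : V → I, P x * (G₁ x * G₂ fun v => x (θ.refl v)) =
      ∫ p : {v // θ.refl v = v} → I, P (θ.extend p 0) *
        ((∫ q : θ.pos → I, G₁ (θ.extend p q)) * ∫ q : θ.pos → I, G₂ (θ.extend p q)) := by
  rw [integral_unitInterval_sum θ.vertexEquiv, Measure.volume_eq_prod, integral_prod]
  · refine integral_congr_ae (Filter.Eventually.of_forall fun p => ?_)
    dsimp only
    rw [integral_unitInterval_sum (Equiv.refl (θ.pos ⊕ θ.pos)), Measure.volume_eq_prod,
      ← integral_prod_mul, ← integral_const_mul]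
    refine integral_congr_ae (Filter.Eventually.of_forall fun z => ?_)
    dsimp only
    have hF : ∀ (v : V) (h : θ.refl v = v), θ.vertexEquiv.symm v = Sum.inl ⟨v, h⟩ := fun v h =>
      (Equiv.symm_apply_eq _).2 rfl
    have hA : ∀ (v : V) (h : v ∈ θ.pos), θ.vertexEquiv.symm v = Sum.inr (Sum.inl ⟨v, h⟩) :=
      fun v h => (Equiv.symm_apply_eq _).2 rfl
    have hB : ∀ (v : V) (h : v ∈ θ.pos),
        θ.vertexEquiv.symm (θ.refl v) = Sum.inr (Sum.inr ⟨v, h⟩) :=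
      fun v h => (Equiv.symm_apply_eq _).2 rfl
    congr 1
    · refine hPd _ _ fun v hv => ?_
      rw [hF v hv, θ.extend_fixed hv]
      rfl
    · congr 1
      · refine h₁d _ _ ?_
        rintro v (hv | hv)
        · rw [hF v hv, θ.extend_fixed hv]
          rfl
        · rw [hA v hv, θ.extend_pos hv]
          rfl
      · refine h₂d _ _ ?_
        rintro v (hv | hv)
        · rw [hv, hF v hv, θ.extend_fixed hv]
          rfl
        · rw [hB v hv, θ.extend_pos hv]
          rfl
  · have hm : Measurable fun p : ({v // θ.refl v = v} → I) × (θ.pos ⊕ θ.pos → I) =>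
        fun v => Sum.elim p.1 p.2 (θ.vertexEquiv.symm v) := by
      refine measurable_pi_lambda _ fun v => ?_
      rcases θ.vertexEquiv.symm v with s | s
      · exact (measurable_pi_apply _).comp measurable_fst
      · exact (measurable_pi_apply _).comp measurable_snd
    have hr : Measurable fun x : V → I => fun v => x (θ.refl v) :=
      measurable_pi_lambda _ fun v => measurable_pi_apply _
    refine integrable_of_measurable_bounded (C := C * (C * C))
      ((hP.mul (h₁.mul (h₂.comp hr))).comp hm) fun z => ?_
    have hC : 0 ≤ C := (abs_nonneg _).trans (hPC 0)
    rw [abs_mul, abs_mul]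
    exact mul_le_mul (hPC _) (mul_le_mul (h₁C _) (h₂C _) (abs_nonneg _) hC) (by positivity) hC

-- Cauchy–Schwarz over the fixed coordinates, with weight `P`, for the two inner integrals of
-- `integral_split`.
open Classical in
theorem sq_integral_le {P G₁ G₂ : (V → I) → ℝ} (hP : Measurable P) (h₁ : Measurable G₁)
    (h₂ : Measurable G₂) {C : ℝ} (hPC : ∀ x, |P x| ≤ C) (h₁C : ∀ x, |G₁ x| ≤ C)
    (h₂C : ∀ x, |G₂ x| ≤ C) (hP0 : ∀ x, 0 ≤ P x)
    (hPd : ∀ x y, (∀ v, θ.refl v = v → x v = y v) → P x = P y)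
    (h₁d : ∀ x y, (∀ v, θ.refl v = v ∨ v ∈ θ.pos → x v = y v) → G₁ x = G₁ y)
    (h₂d : ∀ x y, (∀ v, θ.refl v = v ∨ v ∈ θ.pos → x v = y v) → G₂ x = G₂ y) :
    (∫ x : V → I, P x * (G₁ x * G₂ fun v => x (θ.refl v))) ^ 2 ≤
      (∫ x : V → I, P x * (G₁ x * G₁ fun v => x (θ.refl v))) *
        ∫ x : V → I, P x * (G₂ x * G₂ fun v => x (θ.refl v)) := by
  rw [θ.integral_split hP h₁ h₂ hPC h₁C h₂C hPd h₁d h₂d,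
    θ.integral_split hP h₁ h₁ hPC h₁C h₁C hPd h₁d h₁d,
    θ.integral_split hP h₂ h₂ hPC h₂C h₂C hPd h₂d h₂d]
  have hmeas : ∀ {G : (V → I) → ℝ}, Measurable G →
      Measurable fun p => ∫ q : θ.pos → I, G (θ.extend p q) := fun hG =>
    (StronglyMeasurable.integral_prod_right'
      (hG.comp θ.measurable_extend).stronglyMeasurable).measurable
  have hbd : ∀ {G : (V → I) → ℝ}, (∀ x, |G x| ≤ C) → ∀ p : {v // θ.refl v = v} → I,
      |∫ q : θ.pos → I, G (θ.extend p q)| ≤ C := by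
    intro G hG p
    have := norm_integral_le_of_norm_le_const (μ := (volume : Measure (θ.pos → I)))
      (f := fun q => G (θ.extend p q)) (Filter.Eventually.of_forall fun q => hG _)
    simpa using this
  refine sq_integral_mul_le_of_bounded (C := C) ?_ (hmeas h₁) (hmeas h₂) (fun p => hPC _)
    (hbd h₁C) (hbd h₂C) fun p => hP0 _
  exact hP.comp (θ.measurable_extend.comp (measurable_id.prodMk measurable_const))

end Fold

end SimpleGraph

/-! ### The Hölder property of graphs that fold to an edge -/

namespace SimpleGraph

variable {V : Type*}

namespace Fold

variable {H : SimpleGraph V} (θ : Fold H)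

theorem toFun_of_notMem {v : V} (h : θ.refl v ∉ θ.pos) : θ.toFun v = v := by
  simp [toFun, h]

theorem toFun_of_mem {v : V} (h : θ.refl v ∈ θ.pos) : θ.toFun v = θ.refl v := by
  simp [toFun, h]

/-- No edge joins the two sides, so an edge leaving the mirrored side ends at a fixed vertex, which
the reflection keeps in place. -/
theorem toFun_adj {u v : V} (h : H.Adj u v) : H.Adj (θ.toFun u) (θ.toFun v) := by
  have key : ∀ {u v : V}, H.Adj u v → θ.refl u ∈ θ.pos → θ.refl v ∉ θ.pos →
      H.Adj (θ.refl u) v := by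
    intro u v h hu hv
    rcases θ.cover v with h' | h' | h'
    · have := θ.map_adj h
      rwa [h'] at this
    · exact absurd h.symm (θ.separated h' hu)
    · exact absurd h' hv
  by_cases hu : θ.refl u ∈ θ.pos <;> by_cases hv : θ.refl v ∈ θ.pos
  · rw [θ.toFun_of_mem hu, θ.toFun_of_mem hv]
    exact θ.map_adj h
  · rw [θ.toFun_of_mem hu, θ.toFun_of_notMem hv]
    exact key h hu hv
  · rw [θ.toFun_of_notMem hu, θ.toFun_of_mem hv]
    exact (key h.symm hv hu).symm
  · rwa [θ.toFun_of_notMem hu, θ.toFun_of_notMem hv]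

/-- The composition of a list of folding maps; the last one is applied first. -/
def comp (L : List (Fold H)) : V → V := L.foldr (fun θ g => θ.toFun ∘ g) id

theorem fixed_or_pos {e : Sym2 V} (he : e ∈ H.edgeSet) (h : ∃ v ∈ e, v ∈ θ.pos) {w : V}
    (hw : w ∈ e) : θ.refl w = w ∨ w ∈ θ.pos := by
  rcases θ.cover w with h' | h' | h'
  · exact Or.inl h'
  · exact Or.inr h'
  · obtain ⟨v, hv, hvp⟩ := h
    by_cases hvw : v = w
    · exact Or.inr (hvw ▸ hvp)
    · rw [(Sym2.mem_and_mem_iff hvw).1 ⟨hv, hw⟩] at he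
      exact absurd he (θ.separated hvp h')

variable [Fintype V]

-- An edge either has both ends fixed or meets exactly one of the two sides, and the reflection
-- exchanges the latter two classes.
open Classical in
theorem prod_edgeFinset_split (f : Sym2 V → ℝ) :
    ∏ e ∈ H.edgeFinset, f e =
      (∏ e ∈ H.edgeFinset with (∀ v ∈ e, θ.refl v = v), f e) *
        ((∏ e ∈ H.edgeFinset with (∃ v ∈ e, v ∈ θ.pos), f e) *
          ∏ e ∈ H.edgeFinset with (∃ v ∈ e, v ∈ θ.pos), f (e.map θ.refl)) := by
  have hB : ∏ e ∈ H.edgeFinset with (∃ v ∈ e, v ∈ θ.pos), f (e.map θ.refl) =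
      ∏ e ∈ H.edgeFinset with (∃ v ∈ e, θ.refl v ∈ θ.pos), f e := by
    have hinv : ∀ e : Sym2 V, (e.map θ.refl).map θ.refl = e := by
      intro e
      induction e with
      | _ u v => simp [θ.involutive u, θ.involutive v]
    have hedge : ∀ e ∈ H.edgeSet, e.map θ.refl ∈ H.edgeSet := by
      intro e he
      induction e with
      | _ u v => exact θ.map_adj he
    refine Finset.prod_bij (fun e _ => e.map θ.refl) ?_ ?_ ?_ ?_
    · intro e he
      simp only [Finset.mem_filter, mem_edgeFinset] at he ⊢
      refine ⟨hedge e he.1, ?_⟩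
      obtain ⟨v, hv, hvp⟩ := he.2
      exact ⟨θ.refl v, Sym2.mem_map.2 ⟨v, hv, rfl⟩, by rwa [θ.involutive v]⟩
    · intro e _ e' _ h
      rw [← hinv e, h, hinv e']
    · intro e he
      simp only [Finset.mem_filter, mem_edgeFinset] at he
      refine ⟨e.map θ.refl, ?_, hinv e⟩
      simp only [Finset.mem_filter, mem_edgeFinset]
      refine ⟨hedge e he.1, ?_⟩
      obtain ⟨v, hv, hvp⟩ := he.2
      exact ⟨θ.refl v, Sym2.mem_map.2 ⟨v, hv, rfl⟩, hvp⟩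
    · intro e _
      rfl
  rw [hB, ← Finset.prod_union, ← Finset.prod_union]
  · refine Finset.prod_congr ?_ fun _ _ => rfl
    ext e
    simp only [Finset.mem_union, Finset.mem_filter, ← and_or_left]
    refine (and_iff_left_of_imp fun _ => ?_).symm
    by_cases h : ∀ v ∈ e, θ.refl v = v
    · exact Or.inl h
    · push Not at h
      obtain ⟨v, hv, hne⟩ := h
      rcases θ.cover v with h | h | h
      · exact absurd h hne
      · exact Or.inr (Or.inl ⟨v, hv, h⟩)
      · exact Or.inr (Or.inr ⟨v, hv, h⟩)
  · rw [Finset.disjoint_left]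
    intro e he he'
    simp only [Finset.mem_union, Finset.mem_filter] at he he'
    rcases he' with ⟨-, v, hv, h⟩ | ⟨-, v, hv, h⟩
    · exact θ.ne_of_mem h (he.2 v hv)
    · exact θ.opp.ne_of_mem h (he.2 v hv)
  · rw [Finset.disjoint_left]
    intro e he he'
    simp only [Finset.mem_filter, mem_edgeFinset] at he he'
    obtain ⟨he1, v, hv, hvp⟩ := he
    obtain ⟨-, w, hw, hwp⟩ := he'
    by_cases hvw : v = w
    · subst hvw
      exact θ.refl_notMem hvp hwp
    · rw [(Sym2.mem_and_mem_iff hvw).1 ⟨hv, hw⟩] at he1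
      exact θ.separated hvp hwp he1

/-- `sq_integral_le` with `P` the product over the fixed edges, `G₁` over the edges meeting the
positive side, and `G₂` the decoration of the mirrored side pulled back by the reflection.
Nonnegativity of the kernels makes `P` a legitimate weight. -/
theorem sq_decoratedDensity_le (c : Sym2 V → SymKernel) (hc : ∀ e x y, 0 ≤ c e x y) :
    H.decoratedDensity c ^ 2 ≤
      H.decoratedDensity (fun e => c (e.map θ.toFun)) *
        H.decoratedDensity fun e => c (e.map θ.opp.toFun) := by
  classical
  set E₀ : Finset (Sym2 V) := {e ∈ H.edgeFinset | ∀ v ∈ e, θ.refl v = v} with hE₀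
  set E₁ : Finset (Sym2 V) := {e ∈ H.edgeFinset | ∃ v ∈ e, v ∈ θ.pos} with hE₁
  have hsplit : ∀ (d : Sym2 V → SymKernel) (x : V → I),
      ∏ e ∈ H.edgeFinset, (d e).onPair x e =
        (∏ e ∈ E₀, (d e).onPair x e) * ((∏ e ∈ E₁, (d e).onPair x e) *
          ∏ e ∈ E₁, (d (e.map θ.refl)).onPair (fun v => x (θ.refl v)) e) := by
    intro d x
    rw [θ.prod_edgeFinset_split]
    congr 2
    exact Finset.prod_congr rfl fun e _ => SymKernel.onPair_map _ _ _ _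
  have hmap : ∀ (e : Sym2 V) (f g : V → V), (∀ v ∈ e, f v = g v) → e.map f = e.map g :=
    fun e f g h => Sym2.map_congr h
  have hmem₁ : ∀ e ∈ E₁, ∀ v ∈ e, θ.refl v = v ∨ v ∈ θ.pos := by
    intro e he v hv
    rw [hE₁, Finset.mem_filter, mem_edgeFinset] at he
    exact θ.fixed_or_pos he.1 he.2 hv
  have hfix : ∀ {v}, θ.refl v = v → v ∉ θ.pos := fun h hv => θ.ne_of_mem hv h
  -- The six identities describe the two folding maps on fixed edges (`hr0`), on edges meeting the
  -- positive side (`hr1`) and on mirror images of the latter (`hr2`); primes refer to the opposite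
  -- fold.
  have hr0 : ∀ e ∈ E₀, e.map θ.toFun = e := by
    intro e he
    rw [hE₀, Finset.mem_filter] at he
    rw [hmap e θ.toFun id fun v hv => θ.toFun_of_notMem (by
      rw [he.2 v hv]; exact hfix (he.2 v hv)), Sym2.map_id, id]
  have hr0' : ∀ e ∈ E₀, e.map θ.opp.toFun = e := by
    intro e he
    rw [hE₀, Finset.mem_filter] at he
    rw [hmap e θ.opp.toFun id fun v hv => by
      rw [opp_toFun, if_neg (hfix (he.2 v hv)), id], Sym2.map_id, id]
  have hr1 : ∀ e ∈ E₁, e.map θ.toFun = e := by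
    intro e he
    rw [hmap e θ.toFun id fun v hv => θ.toFun_of_notMem (by
      rcases hmem₁ e he v hv with h | h
      · rw [h]; exact hfix h
      · exact θ.refl_notMem h), Sym2.map_id, id]
  have hr1' : ∀ e ∈ E₁, e.map θ.opp.toFun = e.map θ.refl := by
    intro e he
    refine hmap e _ _ fun v hv => ?_
    rw [opp_toFun]
    rcases hmem₁ e he v hv with h | h
    · rw [if_neg (hfix h), h]
    · rw [if_pos h]
  have hr2 : ∀ e ∈ E₁, (e.map θ.refl).map θ.toFun = e := by
    intro e he
    rw [Sym2.map_map, hmap e _ id, Sym2.map_id, id]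
    intro v hv
    rw [Function.comp_apply, id]
    rcases hmem₁ e he v hv with h | h
    · rw [θ.toFun_of_notMem, h]
      rw [h, h]; exact hfix h
    · rw [θ.toFun_of_mem, θ.involutive v]
      rwa [θ.involutive v]
  have hr2' : ∀ e ∈ E₁, (e.map θ.refl).map θ.opp.toFun = e.map θ.refl := by
    intro e he
    rw [Sym2.map_map]
    refine hmap e _ _ fun v hv => ?_
    rw [Function.comp_apply, opp_toFun, if_neg]
    rcases hmem₁ e he v hv with h | h
    · rw [h]; exact hfix h
    · exact θ.refl_notMem h
  obtain ⟨C₀, hC₀⟩ := exists_bound_prod_onPair E₀ c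
  obtain ⟨C₁, hC₁⟩ := exists_bound_prod_onPair E₁ c
  obtain ⟨C₂, hC₂⟩ := exists_bound_prod_onPair E₁ fun e => c (e.map θ.refl)
  have hdep : ∀ (d : Sym2 V → SymKernel) (s : Finset (Sym2 V)) (x y : V → I),
      (∀ e ∈ s, ∀ v ∈ e, x v = y v) →
      ∏ e ∈ s, (d e).onPair x e = ∏ e ∈ s, (d e).onPair y e := by
    intro d s x y h
    refine Finset.prod_congr rfl fun e he => ?_
    have := h e he
    induction e with
    | _ u v =>
      rw [SymKernel.onPair_mk, SymKernel.onPair_mk, this u (Sym2.mem_mk_left u v),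
        this v (Sym2.mem_mk_right u v)]
  have key := θ.sq_integral_le (measurable_prod_onPair E₀ c) (measurable_prod_onPair E₁ c)
    (measurable_prod_onPair E₁ fun e => c (e.map θ.refl))
    (C := max C₀ (max C₁ C₂)) (fun x => (hC₀ x).trans (le_max_left _ _))
    (fun x => (hC₁ x).trans ((le_max_left _ _).trans (le_max_right _ _)))
    (fun x => (hC₂ x).trans ((le_max_right _ _).trans (le_max_right _ _)))
    (fun x => Finset.prod_nonneg fun e _ => (c e).onPair_nonneg (hc e) x e)
    (fun x y h => hdep c E₀ x y fun e he v hv => h v (by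
      rw [hE₀, Finset.mem_filter] at he
      exact he.2 v hv))
    (fun x y h => hdep c E₁ x y fun e he v hv => h v (hmem₁ e he v hv))
    (fun x y h => hdep _ E₁ x y fun e he v hv => h v (hmem₁ e he v hv))
  unfold decoratedDensity
  convert key using 2
  · congr 1
    funext x
    exact hsplit c x
  · congr 1
    funext x
    rw [hsplit]
    congr 1
    · exact Finset.prod_congr rfl fun e he => by rw [hr0 e he]
    · congr 1
      · exact Finset.prod_congr rfl fun e he => by rw [hr1 e he]
      · exact Finset.prod_congr rfl fun e he => by rw [hr2 e he]
  · congr 1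
    funext x
    rw [hsplit]
    congr 1
    · exact Finset.prod_congr rfl fun e he => by rw [hr0' e he]
    · congr 1
      · exact Finset.prod_congr rfl fun e he => by rw [hr1' e he]
      · exact Finset.prod_congr rfl fun e he => by rw [hr2' e he]

end Fold

end SimpleGraph

/-! ### Homogeneity of densities and the Hölder inequality -/

namespace SymKernel

/-- Scalar multiples of kernels. -/
def scale (r : ℝ) (W : SymKernel) : SymKernel where
  toFun x y := r * W x y
  measurable' := W.measurable'.const_mul r
  symm' x y := by rw [W.symm' x y]
  bounded' := by
    obtain ⟨C, hC⟩ := W.bounded'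
    exact ⟨|r| * C, fun x y => by
      rw [abs_mul]
      exact mul_le_mul_of_nonneg_left (hC x y) (abs_nonneg r)⟩

theorem onPair_scale {V : Type*} (r : ℝ) (W : SymKernel) (x : V → I) (e : Sym2 V) :
    (W.scale r).onPair x e = r * W.onPair x e := by
  induction e with
  | _ u v => rfl

end SymKernel

namespace SimpleGraph

variable {V : Type*} [Fintype V] (H : SimpleGraph V)

open Classical in
theorem decoratedDensity_scale (r : Sym2 V → ℝ) (c : Sym2 V → SymKernel) :
    H.decoratedDensity (fun e => (c e).scale (r e)) =
      (∏ e ∈ H.edgeFinset, r e) * H.decoratedDensity c := by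
  unfold decoratedDensity
  rw [← integral_const_mul]
  simp only [SymKernel.onPair_scale, Finset.prod_mul_distrib]

open Classical in
theorem ncard_edgeSet_eq : H.edgeSet.ncard = H.edgeFinset.card := by
  rw [Set.ncard_eq_toFinset_card', edgeFinset]

theorem homDensity_scale (r : ℝ) (W : SymKernel) :
    H.homDensity (W.scale r) = r ^ H.edgeSet.ncard * H.homDensity W := by
  classical
  rw [homDensity_eq_decoratedDensity, homDensity_eq_decoratedDensity,
    H.decoratedDensity_scale (fun _ => r) (fun _ => W), Finset.prod_const, ncard_edgeSet_eq]

open Classical in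
theorem decoratedDensity_congr {c c' : Sym2 V → SymKernel} (h : ∀ e ∈ H.edgeSet, c e = c' e) :
    H.decoratedDensity c = H.decoratedDensity c' := by
  unfold decoratedDensity
  congr 1
  funext x
  exact Finset.prod_congr rfl fun e he => by rw [h e (mem_edgeFinset.1 he)]

theorem homDensity_nonneg {W : SymKernel} (hW : ∀ x y, 0 ≤ W x y) : 0 ≤ H.homDensity W :=
  H.decoratedDensity_nonneg _ fun _ => hW

/-- The edges of `H` can be folded onto a single edge. -/
def FoldsToEdge : Prop :=
  ∃ (L : List (Fold H)) (e₀ : Sym2 V), ∀ e ∈ H.edgeSet, e.map (Fold.comp L) = e₀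

variable {H}

/-- Let `M` be the largest density of a decoration by the kernels `W j`. Folding a maximiser gives
two densities at most `M` whose product is at least `M ^ 2`, so a fold of a maximiser is again a
maximiser. After all folds every edge carries the kernel assigned to `e₀`, and `M` is an ordinary
density. -/
theorem FoldsToEdge.decoratedDensity_le_one (hH : H.FoldsToEdge) {J : Type*} [Finite J]
    (W : J → SymKernel) (hW : ∀ j x y, 0 ≤ W j x y) (h : ∀ j, H.homDensity (W j) ≤ 1)
    (c : Sym2 V → J) : H.decoratedDensity (fun e => W (c e)) ≤ 1 := by
  obtain ⟨L, e₀, hL⟩ := hH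
  have : Nonempty (Sym2 V → J) := ⟨c⟩
  obtain ⟨c₀, hc₀⟩ := Finite.exists_max fun c : Sym2 V → J => H.decoratedDensity fun e => W (c e)
  refine (hc₀ c).trans ?_
  set M := H.decoratedDensity fun e => W (c₀ e) with hM
  by_contra! hM1
  have step : ∀ (L : List (Fold H)) (c : Sym2 V → J), H.decoratedDensity (fun e => W (c e)) = M →
      H.decoratedDensity (fun e => W (c (e.map (Fold.comp L)))) = M := by
    intro L
    induction L with
    | nil =>
      intro c hc
      rw [← hc]
      simp [Fold.comp]
    | cons θ L ih =>
      intro c hc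
      have h1 := θ.sq_decoratedDensity_le (fun e => W (c e)) fun e => hW _
      rw [hc] at h1
      have h2 := hc₀ fun e => c (e.map θ.opp.toFun)
      have h3 := hc₀ fun e => c (e.map θ.toFun)
      have h4 := H.decoratedDensity_nonneg (fun e => W (c (e.map θ.toFun))) fun e => hW _
      have h5 : H.decoratedDensity (fun e => W (c (e.map θ.toFun))) = M := by
        refine le_antisymm h3 ?_
        have : M ^ 2 ≤ H.decoratedDensity (fun e => W (c (e.map θ.toFun))) * M :=
          h1.trans (mul_le_mul_of_nonneg_left h2 h4)
        nlinarith
      have h6 := ih (fun e => c (e.map θ.toFun)) h5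
      rw [← h6]
      simp only [Fold.comp, List.foldr_cons, Sym2.map_map]
  have h7 := step L c₀ rfl
  rw [H.decoratedDensity_congr (c' := fun _ => W (c₀ e₀)) fun e he => by rw [hL e he]] at h7
  exact absurd (h (c₀ e₀)) (by rw [homDensity_eq_decoratedDensity, h7]; exact not_le.2 hM1)

open Classical in
/-- The Hölder property of graphs that fold to an edge. -/
theorem FoldsToEdge.decoratedDensity_le_prod (hH : H.FoldsToEdge) {J : Type*} [Finite J]
    (W : J → SymKernel) (hW : ∀ j x y, 0 ≤ W j x y) (a : J → ℝ) (ha : ∀ j, 0 < a j)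
    (h : ∀ j, H.homDensity (W j) ≤ a j ^ H.edgeSet.ncard) (c : Sym2 V → J) :
    H.decoratedDensity (fun e => W (c e)) ≤ ∏ e ∈ H.edgeFinset, a (c e) := by
  have key := hH.decoratedDensity_le_one (fun j => (W j).scale (a j)⁻¹)
    (fun j x y => mul_nonneg (inv_nonneg.2 (ha j).le) (hW j x y)) (fun j => by
      rw [homDensity_scale, inv_pow]
      exact inv_mul_le_one_of_le₀ (h j) (pow_nonneg (ha j).le _)) c
  rw [H.decoratedDensity_scale (fun e => (a (c e))⁻¹) fun e => W (c e), Finset.prod_inv_distrib]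
    at key
  rwa [inv_mul_le_iff₀ (Finset.prod_pos fun e _ => ha _), mul_one] at key

end SimpleGraph

/-! ### Graphs that fold to an edge are weakly norming and step Sidorenko -/

namespace SymKernel

theorem IsGraphon.nonneg {W : SymKernel} (hW : W.IsGraphon) (x y : I) : 0 ≤ W x y := (hW x y).1

theorem integrable (W : SymKernel) : Integrable fun p : I × I => W p.1 p.2 := by
  obtain ⟨C, hC⟩ := W.bounded'
  exact integrable_of_measurable_bounded W.measurable' fun p => hC p.1 p.2

theorem blockAverage_nonneg {W : SymKernel} (hW : ∀ x y, 0 ≤ W x y) (P : NonnullPartition)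
    (i j : Fin P.card) : 0 ≤ W.blockAverage P i j :=
  div_nonneg (integral_nonneg fun _ => hW _ _) (mul_nonneg measureReal_nonneg measureReal_nonneg)

end SymKernel

namespace NonnullPartition

variable (P : NonnullPartition)

theorem measurableSet_part (j : Fin P.card) : MeasurableSet (P.part j) :=
  P.measurable_index (measurableSet_singleton j)

theorem measureReal_part_pos (j : Fin P.card) : 0 < volume.real (P.part j) :=
  ENNReal.toReal_pos (P.nonnull j) (measure_ne_top _ _)

theorem setIntegral_part (W : SymKernel) (i j : Fin P.card) :
    ∫ p in P.part i ×ˢ P.part j, W p.1 p.2 = ∫ p in P.part i ×ˢ P.part j, W.step P p.1 p.2 := by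
  have h : ∫ p in P.part i ×ˢ P.part j, W.step P p.1 p.2 =
      ∫ p in P.part i ×ˢ P.part j, W.blockAverage P i j := by
    refine setIntegral_congr_fun ((P.measurableSet_part i).prod (P.measurableSet_part j)) ?_
    rintro ⟨x, y⟩ ⟨hx, hy⟩
    change W.blockAverage P (P.index x) (P.index y) = _
    rw [show P.index x = i from hx, show P.index y = j from hy]
  rw [h, setIntegral_const, smul_eq_mul, SymKernel.blockAverage, Measure.volume_eq_prod,
    measureReal_prod_prod, mul_div_cancel₀]
  exact (mul_pos (P.measureReal_part_pos i) (P.measureReal_part_pos j)).ne'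

/-- Replacing a kernel by its block averages does not affect integrals against functions that are
constant on the blocks. -/
theorem integral_mul_step (W : SymKernel) (q : Fin P.card → Fin P.card → ℝ) :
    ∫ p : I × I, W p.1 p.2 * q (P.index p.1) (P.index p.2) =
      ∫ p : I × I, W.step P p.1 p.2 * q (P.index p.1) (P.index p.2) := by
  have hU : (⋃ k : Fin P.card × Fin P.card, P.part k.1 ×ˢ P.part k.2) = Set.univ := by
    refine Set.eq_univ_of_forall fun p => Set.mem_iUnion.2 ⟨(P.index p.1, P.index p.2), rfl, rfl⟩
  have hd : Pairwise (Function.onFun Disjoint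
      fun k : Fin P.card × Fin P.card => P.part k.1 ×ˢ P.part k.2) := by
    rintro k k' hk
    refine Set.disjoint_left.2 fun p hp hp' => hk ?_
    exact Prod.ext ((show P.index p.1 = k.1 from hp.1).symm.trans hp'.1)
      ((show P.index p.2 = k.2 from hp.2).symm.trans hp'.2)
  have hm : ∀ k : Fin P.card × Fin P.card, MeasurableSet (P.part k.1 ×ˢ P.part k.2) :=
    fun k => (P.measurableSet_part _).prod (P.measurableSet_part _)
  have hq : Measurable fun p : I × I => q (P.index p.1) (P.index p.2) :=
    (measurable_of_finite fun k : Fin P.card × Fin P.card => q k.1 k.2).comp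
      ((P.measurable_index.comp measurable_fst).prodMk (P.measurable_index.comp measurable_snd))
  have hint : ∀ W' : SymKernel,
      Integrable fun p : I × I => W' p.1 p.2 * q (P.index p.1) (P.index p.2) := by
    intro W'
    obtain ⟨C, hC⟩ := W'.bounded'
    obtain ⟨D, hD⟩ := (Set.finite_range
      fun k : Fin P.card × Fin P.card => |q k.1 k.2|).bddAbove
    refine integrable_of_measurable_bounded (C := C * D) (W'.measurable'.mul hq) fun p => ?_
    rw [abs_mul]
    exact mul_le_mul (hC _ _) (hD ⟨(P.index p.1, P.index p.2), rfl⟩) (abs_nonneg _)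
      ((abs_nonneg _).trans (hC p.1 p.2))
  have hsum : ∀ W' : SymKernel, ∫ p : I × I, W' p.1 p.2 * q (P.index p.1) (P.index p.2) =
      ∑ k : Fin P.card × Fin P.card, (∫ p in P.part k.1 ×ˢ P.part k.2, W' p.1 p.2) * q k.1 k.2 := by
    intro W'
    rw [← setIntegral_univ, ← hU, integral_iUnion_fintype hm hd fun k => (hint W').integrableOn]
    refine Finset.sum_congr rfl fun k _ => ?_
    rw [← integral_mul_const]
    refine setIntegral_congr_fun (hm k) ?_
    rintro p ⟨hx, hy⟩
    dsimp only
    rw [show P.index p.1 = k.1 from hx, show P.index p.2 = k.2 from hy]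
  rw [hsum, hsum]
  exact Finset.sum_congr rfl fun k _ => by rw [P.setIntegral_part]

/-- The partition with a single part. -/
def trivial : NonnullPartition where
  card := 1
  index _ := 0
  measurable_index := measurable_const
  nonnull j := by
    have : (fun _ : I => (0 : Fin 1)) ⁻¹' {j} = Set.univ :=
      Set.eq_univ_of_forall fun _ => Subsingleton.elim _ _
    rw [this]
    simp

theorem step_trivial (W : SymKernel) (x y : I) :
    W.step trivial x y = ∫ p : I × I, W p.1 p.2 := by
  change W.blockAverage trivial _ _ = _
  have : ∀ j, trivial.part j = Set.univ := fun j =>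
    Set.eq_univ_of_forall fun x => Subsingleton.elim (α := Fin 1) _ _
  rw [SymKernel.blockAverage, this, this]
  simp

end NonnullPartition

namespace SimpleGraph

variable {V : Type*} [Fintype V] {H : SimpleGraph V}

open Classical in
theorem integral_unitInterval_pair {u v : V} (huv : u ≠ v) :
    ∃ e : {w // w ≠ u ∧ w ≠ v} ⊕ Fin 2 ≃ V, e (Sum.inr 0) = u ∧ e (Sum.inr 1) = v ∧
      ∀ (Φ : (V → I) → ℝ) (C : ℝ), Measurable Φ → (∀ x, |Φ x| ≤ C) →
      ∫ x, Φ x = ∫ y : {w // w ≠ u ∧ w ≠ v} → I, ∫ p : I × I,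
        Φ fun w => Sum.elim y ![p.1, p.2] (e.symm w) := by
  obtain ⟨e, h0, h1, -⟩ := exists_pair_split huv
  refine ⟨e, h0, h1, fun Φ C hΦ hC => ?_⟩
  rw [integral_unitInterval_sum e, Measure.volume_eq_prod, integral_prod]
  · refine integral_congr_ae (Filter.Eventually.of_forall fun y => ?_)
    dsimp only
    rw [← integral_fin_two fun a b => Φ fun w => Sum.elim y ![a, b] (e.symm w)]
    refine integral_congr_ae (Filter.Eventually.of_forall fun q => ?_)
    dsimp only
    congr 1
    funext w
    congr 1
    funext t
    fin_cases t <;> rfl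
  · refine integrable_of_measurable_bounded (C := C) (hΦ.comp ?_) fun z => hC _
    refine measurable_pi_lambda _ fun v => ?_
    rcases e.symm v with s | s
    · exact (measurable_pi_apply _).comp measurable_fst
    · exact (measurable_pi_apply _).comp measurable_snd

theorem integral_kernel_pair {u v : V} (huv : u ≠ v) (W : SymKernel) :
    ∫ x : V → I, W (x u) (x v) = ∫ p : I × I, W p.1 p.2 := by
  obtain ⟨C, hC⟩ := W.bounded'
  obtain ⟨e, h0, h1, h⟩ := integral_unitInterval_pair huv
  replace h := h _ C (W.measurable_onPair s(u, v)) fun x => W.abs_onPair_le hC x s(u, v)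
  simp only [SymKernel.onPair_mk, ← h0, ← h1, Equiv.symm_apply_apply, Sum.elim_inr,
    Matrix.cons_val_zero, Matrix.cons_val_one, integral_const, probReal_univ, one_smul] at h ⊢
  exact h

/-- Replacing the kernel at a single edge by its block averages. -/
theorem integral_mul_prod_step {u v : V} (huv : u ≠ v) (W W' : SymKernel) (P : NonnullPartition)
    (s : Finset (Sym2 V)) :
    ∫ x : V → I, W (x u) (x v) * ∏ e ∈ s, (W'.step P).onPair x e =
      ∫ x : V → I, W.step P (x u) (x v) * ∏ e ∈ s, (W'.step P).onPair x e := by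
  classical
  let Q : (V → Fin P.card) → ℝ := fun φ =>
    ∏ e ∈ s, Sym2.lift ⟨W'.blockAverage P, W'.blockAverage_comm P⟩ (e.map φ)
  have hQ : ∀ x : V → I, ∏ e ∈ s, (W'.step P).onPair x e = Q fun w => P.index (x w) := by
    intro x
    refine Finset.prod_congr rfl fun e _ => ?_
    induction e with
    | _ a b => rfl
  obtain ⟨D, hD⟩ := exists_bound_prod_onPair s fun _ => W'.step P
  obtain ⟨e, h0, h1, h⟩ := integral_unitInterval_pair huv
  have key : ∀ U : SymKernel, ∫ x : V → I, U (x u) (x v) * ∏ e ∈ s, (W'.step P).onPair x e =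
        ∫ y : {w // w ≠ u ∧ w ≠ v} → I, ∫ p : I × I, U p.1 p.2 *
          Q fun w => Sum.elim (fun t => P.index (y t)) ![P.index p.1, P.index p.2] (e.symm w) := by
    intro U
    obtain ⟨C, hC⟩ := U.bounded'
    rw [h (fun x => U (x u) (x v) * ∏ e ∈ s, (W'.step P).onPair x e) (C * D)
      ((U.measurable_onPair s(u, v)).mul (measurable_prod_onPair s _))]
    · refine integral_congr_ae (Filter.Eventually.of_forall fun y => ?_)
      refine integral_congr_ae (Filter.Eventually.of_forall fun p => ?_)
      dsimp only
      rw [hQ]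
      simp only [e.symm_apply_eq.2 h0.symm, e.symm_apply_eq.2 h1.symm, Sum.elim_inr, Matrix.cons_val_zero, Matrix.cons_val_one]
      congr 2
      funext w
      rcases e.symm w with t | t
      · rfl
      · fin_cases t <;> rfl
    · intro x
      rw [abs_mul]
      exact mul_le_mul (U.abs_onPair_le hC x s(u, v)) (hD x) (abs_nonneg _)
        ((abs_nonneg _).trans (hC 0 0))
  rw [key, key]
  congr 1
  funext y
  exact P.integral_mul_step W fun i j =>
    Q fun w => Sum.elim (fun t => P.index (y t)) ![i, j] (e.symm w)

/-- All edges but one carry functions constant on the blocks, so the remaining edge may carry `W`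
instead of its average. Hölder then bounds `b = t(H, W^P)` by `t(H, W)^(1/m) * b^((m-1)/m)`, which
is impossible if `t(H, W) < b`. -/
theorem FoldsToEdge.homDensity_step_le (hH : H.FoldsToEdge) (hne : H.edgeSet.Nonempty)
    {W : SymKernel} (hW : ∀ x y, 0 ≤ W x y) (P : NonnullPartition) :
    H.homDensity (W.step P) ≤ H.homDensity W := by
  classical
  obtain ⟨e₀, he₀⟩ := hne
  have hW' : ∀ x y, 0 ≤ W.step P x y := fun x y => SymKernel.blockAverage_nonneg hW P _ _
  set m := H.edgeSet.ncard with hm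
  have hcard : m = H.edgeFinset.card := H.ncard_edgeSet_eq
  have he₀' : e₀ ∈ H.edgeFinset := mem_edgeFinset.2 he₀
  have hm0 : m ≠ 0 := by
    rw [hcard]
    exact Finset.card_ne_zero_of_mem he₀'
  have hmix : H.homDensity (W.step P) =
      H.decoratedDensity fun e => if e = e₀ then W else W.step P := by
    have h1 : ∀ (U : SymKernel) (x : V → I),
        ∏ e ∈ H.edgeFinset, (if e = e₀ then U else W.step P).onPair x e =
          U.onPair x e₀ * ∏ e ∈ H.edgeFinset.erase e₀, (W.step P).onPair x e := by
      intro U x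
      rw [← Finset.mul_prod_erase _ _ he₀', if_pos rfl]
      congr 1
      exact Finset.prod_congr rfl fun e he => by rw [if_neg (Finset.ne_of_mem_erase he)]
    have h2 : H.homDensity (W.step P) =
        H.decoratedDensity fun e => if e = e₀ then W.step P else W.step P := by
      simp [homDensity_eq_decoratedDensity]
    rw [h2]
    unfold decoratedDensity
    simp only [h1]
    induction e₀ with
    | _ u v =>
      exact (integral_mul_prod_step (H.ne_of_adj he₀) W W P _).symm
  by_contra! hlt
  set b := H.homDensity (W.step P) with hb
  have ht0 : 0 ≤ H.homDensity W := H.homDensity_nonneg hW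
  have hb0 : 0 < b := ht0.trans_lt hlt
  -- The Hölder inequality wants positive constants; `t` stands in for `t(H, W)`, which may vanish.
  obtain ⟨t, ht1, ht2⟩ := exists_between hlt
  have ht : 0 < t := ht0.trans_lt ht1
  have key := hH.decoratedDensity_le_prod (J := Bool) (fun j => bif j then W else W.step P)
    (by rintro (_ | _) <;> assumption)
    (fun j => bif j then t ^ (1 / (m : ℝ)) else b ^ (1 / (m : ℝ)))
    (by rintro (_ | _) <;> exact Real.rpow_pos_of_pos (by assumption) _)
    (by
      rintro (_ | _)
      · simp only [cond_false, one_div]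
        rw [Real.rpow_inv_natCast_pow hb0.le hm0]
      · simp only [cond_true, one_div]
        rw [Real.rpow_inv_natCast_pow ht.le hm0]
        exact ht1.le)
    (fun e => decide (e = e₀))
  have h3 : (fun e => bif decide (e = e₀) then W else W.step P) =
      fun e => if e = e₀ then W else W.step P := by
    funext e
    by_cases h : e = e₀ <;> simp [h]
  rw [h3, ← hmix] at key
  have h4 : ∏ e ∈ H.edgeFinset,
      (bif decide (e = e₀) then t ^ (1 / (m : ℝ)) else b ^ (1 / (m : ℝ))) <
      ∏ _e ∈ H.edgeFinset, b ^ (1 / (m : ℝ)) := by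
    have hpow : t ^ (1 / (m : ℝ)) < b ^ (1 / (m : ℝ)) :=
      Real.rpow_lt_rpow ht.le ht2 (by positivity)
    refine Finset.prod_lt_prod (fun e _ => ?_) (fun e _ => ?_) ⟨e₀, he₀', by simpa using hpow⟩
    · by_cases h : e = e₀
      · simp only [h, decide_true, cond_true]
        exact Real.rpow_pos_of_pos ht _
      · simp only [h, decide_false, cond_false]
        exact Real.rpow_pos_of_pos hb0 _
    · by_cases h : e = e₀
      · simp only [h, decide_true, cond_true]
        exact hpow.le
      · simp [h]
  rw [Finset.prod_const, ← hcard, one_div, Real.rpow_inv_natCast_pow hb0.le hm0] at h4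
  exact absurd (key.trans_lt (by simpa using h4)) (lt_irrefl _)

theorem FoldsToEdge.stepSidorenko (hH : H.FoldsToEdge) (hne : H.edgeSet.Nonempty) :
    H.StepSidorenko := fun _ hW P => hH.homDensity_step_le hne hW.nonneg P

theorem homDensity_const {W : SymKernel} {r : ℝ} (h : ∀ x y, W x y = r) :
    H.homDensity W = r ^ H.edgeSet.ncard := by
  classical
  have : ∀ (x : V → I) e, W.onPair x e = r := by
    intro x e
    induction e with
    | _ u v => exact h _ _
  unfold homDensity
  simp only [this, Finset.prod_const, integral_const, probReal_univ, one_smul]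
  rw [ncard_edgeSet_eq]

/-- Expand the product over the edges according to the set `s` of edges carrying `W₁`, bound each
term by Hölder, and reassemble the bounds into the expansion of the power of `a₁ + a₂`. -/
theorem homDensity_add_le_of_holder (hH : H.FoldsToEdge) {W₁ W₂ : SymKernel}
    (h₁ : ∀ x y, 0 ≤ W₁ x y) (h₂ : ∀ x y, 0 ≤ W₂ x y) {a₁ a₂ : ℝ} (ha₁ : 0 < a₁) (ha₂ : 0 < a₂)
    (hb₁ : H.homDensity W₁ ≤ a₁ ^ H.edgeSet.ncard) (hb₂ : H.homDensity W₂ ≤ a₂ ^ H.edgeSet.ncard) :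
    H.homDensity (W₁ + W₂) ≤ (a₁ + a₂) ^ H.edgeSet.ncard := by
  classical
  have hexp : H.homDensity (W₁ + W₂) = ∑ s ∈ H.edgeFinset.powerset,
      H.decoratedDensity fun e => bif decide (e ∈ s) then W₁ else W₂ := by
    unfold homDensity decoratedDensity
    rw [← integral_finsetSum _ fun s _ => integrable_prod_onPair _ _]
    refine integral_congr_ae (Filter.Eventually.of_forall fun x => ?_)
    dsimp only
    simp only [SymKernel.onPair_add]
    rw [Finset.prod_add]
    refine Finset.sum_congr rfl fun s hs => ?_
    rw [← Finset.prod_sdiff (Finset.mem_powerset.1 hs), mul_comm]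
    congr 1
    · exact Finset.prod_congr rfl fun e he => by simp [(Finset.mem_sdiff.1 he).2]
    · exact Finset.prod_congr rfl fun e he => by simp [he]
  rw [hexp, ncard_edgeSet_eq, ← Finset.prod_const, Finset.prod_add]
  refine Finset.sum_le_sum fun s hs => ?_
  have key := hH.decoratedDensity_le_prod (J := Bool) (fun j => bif j then W₁ else W₂)
    (by rintro (_ | _) <;> assumption) (fun j => bif j then a₁ else a₂)
    (by rintro (_ | _) <;> assumption) (by rintro (_ | _) <;> assumption)
    (fun e => decide (e ∈ s))
  refine key.trans (le_of_eq ?_)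
  rw [← Finset.prod_sdiff (Finset.mem_powerset.1 hs), mul_comm]
  congr 1
  · exact Finset.prod_congr rfl fun e he => by simp [he]
  · exact Finset.prod_congr rfl fun e he => by simp [(Finset.mem_sdiff.1 he).2]

theorem FoldsToEdge.graphNorm_add_le (hH : H.FoldsToEdge) (hne : H.edgeSet.Nonempty)
    {W₁ W₂ : SymKernel} (h₁ : ∀ x y, 0 ≤ W₁ x y) (h₂ : ∀ x y, 0 ≤ W₂ x y) :
    H.graphNorm (W₁ + W₂) ≤ H.graphNorm W₁ + H.graphNorm W₂ := by
  classical
  have hm0 : H.edgeSet.ncard ≠ 0 := by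
    rw [ncard_edgeSet_eq]
    obtain ⟨e, he⟩ := hne
    exact Finset.card_ne_zero_of_mem (mem_edgeFinset.2 he)
  have hn : ∀ {W : SymKernel}, (∀ x y, 0 ≤ W x y) → 0 ≤ H.graphNorm W := fun h =>
    Real.rpow_nonneg (H.homDensity_nonneg h) _
  have hpow : ∀ {W : SymKernel}, (∀ x y, 0 ≤ W x y) → ∀ {η : ℝ}, 0 < η →
      H.homDensity W ≤ (H.graphNorm W + η) ^ H.edgeSet.ncard := by
    intro W h η hη
    calc H.homDensity W = H.graphNorm W ^ H.edgeSet.ncard := by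
          rw [graphNorm, one_div, Real.rpow_inv_natCast_pow (H.homDensity_nonneg h) hm0]
      _ ≤ _ := pow_le_pow_left₀ (hn h) (by linarith) _
  -- The slack `η` keeps the constants in Hölder positive even if one of the norms is `0`.
  refine le_of_forall_pos_le_add fun η hη => ?_
  have key := homDensity_add_le_of_holder hH h₁ h₂ (a₁ := H.graphNorm W₁ + η / 2)
    (a₂ := H.graphNorm W₂ + η / 2) (by linarith [hn h₁]) (by linarith [hn h₂])
    (hpow h₁ (by linarith)) (hpow h₂ (by linarith))
  have h0 : 0 ≤ H.homDensity (W₁ + W₂) :=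
    H.homDensity_nonneg fun x y => add_nonneg (h₁ x y) (h₂ x y)
  have hs : 0 ≤ H.graphNorm W₁ + η / 2 + (H.graphNorm W₂ + η / 2) := by linarith [hn h₁, hn h₂]
  calc H.graphNorm (W₁ + W₂)
      ≤ ((H.graphNorm W₁ + η / 2 + (H.graphNorm W₂ + η / 2)) ^ H.edgeSet.ncard) ^
          (1 / (H.edgeSet.ncard : ℝ)) := Real.rpow_le_rpow h0 key (by positivity)
    _ = H.graphNorm W₁ + η / 2 + (H.graphNorm W₂ + η / 2) := by
          rw [one_div, Real.pow_rpow_inv_natCast hs hm0]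
    _ = _ := by ring

/-- Definiteness comes from two comparisons with `∫ W`: stepping by the trivial partition gives `(∫
W)^m ≤ t(H, W)`, and dropping all factors but one gives `t(H, W) ≤ ∫ W`. -/
theorem FoldsToEdge.isWeaklyNorming (hH : H.FoldsToEdge) (hne : H.edgeSet.Nonempty) :
    H.IsWeaklyNorming := by
  classical
  have hm0 : H.edgeSet.ncard ≠ 0 := by
    rw [ncard_edgeSet_eq]
    obtain ⟨e, he⟩ := hne
    exact Finset.card_ne_zero_of_mem (mem_edgeFinset.2 he)
  refine ⟨fun W hW => ?_, fun W₁ W₂ h₁ h₂ => hH.graphNorm_add_le hne h₁.nonneg h₂.nonneg⟩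
  have hW0 : 0 ≤ fun p : I × I => W p.1 p.2 := fun p => hW.nonneg _ _
  have hiff := integral_eq_zero_iff_of_nonneg hW0 W.integrable
  rw [graphNorm, Real.rpow_eq_zero (H.homDensity_nonneg hW.nonneg)
    (one_div_ne_zero (Nat.cast_ne_zero.2 hm0))]
  have hiff' : (∀ᵐ p : I × I, W p.1 p.2 = 0) ↔ ∫ p : I × I, W p.1 p.2 = 0 := hiff.symm
  rw [hiff']
  constructor
  · intro h
    have h1 := hH.homDensity_step_le hne hW.nonneg NonnullPartition.trivial
    rw [homDensity_const (NonnullPartition.step_trivial W), h] at h1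
    exact pow_eq_zero_iff hm0 |>.1 (le_antisymm h1 (pow_nonneg (integral_nonneg hW0) _))
  · intro h
    refine le_antisymm ?_ (H.homDensity_nonneg hW.nonneg)
    obtain ⟨e₀, he₀⟩ := hne
    have hle : H.homDensity W ≤ ∫ x : V → I, W.onPair x e₀ := by
      obtain ⟨C, hC⟩ := W.bounded'
      refine integral_mono (integrable_prod_onPair _ _) (integrable_of_measurable_bounded
        (W.measurable_onPair e₀) fun x => W.abs_onPair_le hC x e₀) fun x => ?_
      dsimp only
      rw [← Finset.mul_prod_erase _ _ (mem_edgeFinset.2 he₀)]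
      refine mul_le_of_le_one_right (W.onPair_nonneg hW.nonneg x e₀) ?_
      refine Finset.prod_le_one (fun e _ => W.onPair_nonneg hW.nonneg x e) fun e _ => ?_
      induction e with
      | _ u v => exact (hW _ _).2
    refine hle.trans ?_
    induction e₀ with
    | _ u v =>
      simp only [SymKernel.onPair_mk]
      rw [integral_kernel_pair (H.ne_of_adj he₀), h]

end SimpleGraph

/-! ### Hypercubes -/

namespace SimpleGraph

theorem hypercube_adj {d : ℕ} {x y : Fin d → Bool} :
    (hypercube d).Adj x y ↔ ∃ i, x i ≠ y i ∧ ∀ j, j ≠ i → x j = y j := Iff.rfl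

theorem hypercube_adj_signedPerm {d : ℕ} (π : Equiv.Perm (Fin d)) (b : Fin d → Bool)
    {x y : Fin d → Bool} (h : (hypercube d).Adj x y) :
    (hypercube d).Adj (fun k => xor (b k) (x (π k))) fun k => xor (b k) (y (π k)) := by
  obtain ⟨i, hi, hj⟩ := hypercube_adj.1 h
  refine hypercube_adj.2 ⟨π.symm i, by simpa using hi, fun j hji => ?_⟩
  rw [hj (π j) fun h' => hji (by rw [← h', Equiv.symm_apply_apply])]

theorem hypercube_not_adj {d : ℕ} {x y : Fin d → Bool} {i j : Fin d} (hij : i ≠ j)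
    (hi : x i ≠ y i) (hj : x j ≠ y j) : ¬ (hypercube d).Adj x y := by
  rintro ⟨k, -, hk⟩
  by_cases h : i = k
  · exact hj (hk j (h ▸ hij.symm))
  · exact hi (hk i h)

/-- The reflection that exchanges the coordinates `i` and `j`, adding `b` to both of them. -/
def coordReflection {d : ℕ} (i j : Fin d) (b : Bool) (x : Fin d → Bool) (k : Fin d) : Bool :=
  if k = i then xor b (x j) else if k = j then xor b (x i) else x k

/-- The fold of the hypercube given by the reflection `coordReflection i j b`. -/
def hypercubeFold {d : ℕ} (i j : Fin d) (hij : i ≠ j) (b : Bool) : Fold (hypercube d) where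
  refl := coordReflection i j b
  pos := {x | x i = !b ∧ x j = false}
  involutive x := by
    funext k
    unfold coordReflection
    by_cases h1 : k = i
    · subst h1; simp [hij.symm]
    · by_cases h2 : k = j
      · subst h2; simp [h1]
      · simp [h1, h2]
  map_adj {x y} h := by
    have := hypercube_adj_signedPerm (Equiv.swap i j) (fun k => if k = i ∨ k = j then b else false) h
    convert this using 1 <;>
    · funext k
      unfold coordReflection
      by_cases h1 : k = i
      · subst h1; simp
      · by_cases h2 : k = j
        · subst h2; simp [h1]
        · simp [h1, h2, Equiv.swap_apply_of_ne_of_ne h1 h2]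
  refl_notMem {x} hx hx' := by
    simp only [Set.mem_ofPred_eq, coordReflection, if_true, hij.symm, if_false] at hx hx'
    rw [hx.1, hx.2] at hx'
    cases b <;> simp at hx'
  cover x := by
    simp only [Set.mem_ofPred_eq, coordReflection, if_true, hij.symm, if_false]
    by_cases h : x i = xor b (x j)
    · left
      funext k
      unfold coordReflection
      by_cases h1 : k = i
      · subst h1; simp [h]
      · by_cases h2 : k = j
        · subst h2; simp [h1, h]
        · simp [h1, h2]
    · right
      cases b <;> cases hxi : x i <;> cases hxj : x j <;> simp_all
  separated {x y} hx hy := by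
    simp only [Set.mem_ofPred_eq, coordReflection, if_true, hij.symm, if_false] at hx hy
    -- A positive vertex and a mirrored one differ in both coordinates `i` and `j`.
    refine hypercube_not_adj hij ?_ ?_
    · cases b <;> cases hxi : x i <;> cases hyi : y i <;> simp_all
    · cases b <;> cases hxj : x j <;> cases hyj : y j <;> simp_all

/-- This shows the two uses of the fold: for `b = true` it cancels ones at `i` and `j`, and for `b =
false` it moves a one from `j` to an empty position `i`. -/
theorem hypercubeFold_toFun_apply {d : ℕ} (i j : Fin d) (hij : i ≠ j) (b : Bool)
    (x : Fin d → Bool) (k : Fin d) : (hypercubeFold i j hij b).toFun x k =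
      if x j = true ∧ x i = b then (if k = i then !b else if k = j then false else x k)
        else x k := by
  have h : (hypercubeFold i j hij b).refl x ∈ (hypercubeFold i j hij b).pos ↔
      x j = true ∧ x i = b := by
    simp only [hypercubeFold, Set.mem_ofPred_eq, coordReflection, if_true, hij.symm, if_false]
    cases b <;> cases x i <;> cases x j <;> simp
  by_cases h' : x j = true ∧ x i = b
  · rw [Fold.toFun_of_mem _ (h.2 h'), if_pos h']
    simp only [hypercubeFold, coordReflection, h'.1, h'.2, Bool.xor_true, Bool.xor_self]
  · rw [Fold.toFun_of_notMem _ (mt h.1 h'), if_neg h']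

theorem Fold.comp_adj {V : Type*} {H : SimpleGraph V} (L : List (Fold H)) {u v : V}
    (h : H.Adj u v) : H.Adj (Fold.comp L u) (Fold.comp L v) := by
  induction L with
  | nil => exact h
  | cons θ L ih => exact θ.toFun_adj ih

theorem Fold.comp_append {V : Type*} {H : SimpleGraph V} (L L' : List (Fold H)) (v : V) :
    Fold.comp (L ++ L') v = Fold.comp L (Fold.comp L' v) := by
  induction L with
  | nil => rfl
  | cons θ L ih => exact congrArg θ.toFun ih

/-- A cancelling fold never creates a one. Hence a pair of positions that is no longer filled with
two ones stays that way under all later folds. -/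
theorem comp_cancelling_folds {d : ℕ} (P : List {p : Fin d × Fin d // p.1 ≠ p.2})
    (x : Fin d → Bool) :
    (∀ k, Fold.comp (P.map fun p => hypercubeFold p.1.1 p.1.2 p.2 true) x k = true →
      x k = true) ∧
    ∀ p ∈ P, ¬ (Fold.comp (P.map fun p => hypercubeFold p.1.1 p.1.2 p.2 true) x p.1.1 = true ∧
      Fold.comp (P.map fun p => hypercubeFold p.1.1 p.1.2 p.2 true) x p.1.2 = true) := by
  induction P with
  | nil => exact ⟨fun k h => h, by simp⟩
  | cons q P ih =>
    set y := Fold.comp (P.map fun p => hypercubeFold p.1.1 p.1.2 p.2 true) x with hy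
    have hstep : Fold.comp ((q :: P).map fun p => hypercubeFold p.1.1 p.1.2 p.2 true) x =
        (hypercubeFold q.1.1 q.1.2 q.2 true).toFun y := rfl
    have hle : ∀ k, (hypercubeFold q.1.1 q.1.2 q.2 true).toFun y k = true → y k = true := by
      intro k
      rw [hypercubeFold_toFun_apply]
      split_ifs <;> simp
    rw [hstep]
    refine ⟨fun k hk => ih.1 k (hle k hk), fun p hp => ?_⟩
    rcases List.mem_cons.1 hp with rfl | hp
    · rintro ⟨h1, h2⟩
      have h3 := hle _ h1
      rw [hypercubeFold_toFun_apply, if_pos ⟨hle _ h2, h3⟩, if_pos rfl] at h1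
      exact Bool.false_ne_true h1
    · exact fun h => ih.2 p hp ⟨hle _ h.1, hle _ h.2⟩

/-- With at most one coordinate equal to one, the fold for `j` moves a one at `j` to `i`, and no
later fold takes it away from `i`. -/
theorem comp_moving_folds {d : ℕ} (i : Fin d) (P : List {j : Fin d // i ≠ j})
    (x : Fin d → Bool) (hx : ∀ j k, x j = true → x k = true → j = k) :
    (∀ j k, Fold.comp (P.map fun j => hypercubeFold i j.1 j.2 false) x j = true →
      Fold.comp (P.map fun j => hypercubeFold i j.1 j.2 false) x k = true → j = k) ∧
    ∀ j ∈ P, Fold.comp (P.map fun j => hypercubeFold i j.1 j.2 false) x j.1 = false := by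
  induction P with
  | nil => exact ⟨hx, by simp⟩
  | cons q P ih =>
    set y := Fold.comp (P.map fun j => hypercubeFold i j.1 j.2 false) x with hy
    have hstep : Fold.comp ((q :: P).map fun j => hypercubeFold i j.1 j.2 false) x =
        (hypercubeFold i q.1 q.2 false).toFun y := rfl
    rw [hstep]
    obtain ⟨ih1, ih2⟩ := ih
    have hq := q.2
    clear_value y
    have hmove : (y q.1 = true ∧ y i = false) → ∀ j,
        (hypercubeFold i q.1 q.2 false).toFun y j = true → j = i := by
      intro h j hj
      rw [hypercubeFold_toFun_apply, if_pos h] at hj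
      by_contra hji
      rw [if_neg hji] at hj
      by_cases hjq : j = q.1
      · rw [if_pos hjq] at hj
        exact Bool.false_ne_true hj
      · rw [if_neg hjq] at hj
        exact hjq (ih1 _ _ hj h.1)
    have hstay : ¬ (y q.1 = true ∧ y i = false) →
        (hypercubeFold i q.1 q.2 false).toFun y = y := by
      intro h
      funext k
      rw [hypercubeFold_toFun_apply, if_neg h]
    by_cases h : y q.1 = true ∧ y i = false
    · refine ⟨fun j k hj hk => (hmove h j hj).trans (hmove h k hk).symm, fun j _ => ?_⟩
      by_contra h1
      exact j.2 (hmove h _ (Bool.not_eq_false _ ▸ h1)).symm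
    · rw [hstay h]
      refine ⟨ih1, fun j hj => ?_⟩
      rcases List.mem_cons.1 hj with rfl | hj
      · by_contra h1
        rw [Bool.not_eq_false] at h1
        refine h ⟨h1, ?_⟩
        by_contra h2
        rw [Bool.not_eq_false] at h2
        exact hq (ih1 _ _ h2 h1)
      · exact ih2 j hj

/-- The cancelling folds `L₂`, applied first, leave at most one coordinate equal to one, and the
moving folds `L₁` carry it to position `0`. Every vertex lands on one of two adjacent vertices, and
adjacency is preserved, so every edge lands on the edge between them. -/
theorem hypercube_foldsToEdge (d : ℕ) : (hypercube (d + 1)).FoldsToEdge := by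
  classical
  let L₁ : List (Fold (hypercube (d + 1))) :=
    (Finset.univ : Finset {j : Fin (d + 1) // 0 ≠ j}).toList.map
      fun j => hypercubeFold 0 j.1 j.2 false
  let L₂ : List (Fold (hypercube (d + 1))) :=
    (Finset.univ : Finset {p : Fin (d + 1) × Fin (d + 1) // p.1 ≠ p.2}).toList.map
      fun p => hypercubeFold p.1.1 p.1.2 p.2 true
  have hzero : ∀ x, ∀ j, j ≠ 0 → Fold.comp (L₁ ++ L₂) x j = false := by
    intro x j hj
    rw [Fold.comp_append]
    refine (comp_moving_folds 0 _ _ fun j k hj hk => ?_).2 ⟨j, hj.symm⟩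
      (Finset.mem_toList.2 (Finset.mem_univ _))
    by_contra hjk
    exact (comp_cancelling_folds _ x).2 ⟨(j, k), hjk⟩ (Finset.mem_toList.2 (Finset.mem_univ _))
      ⟨hj, hk⟩
  refine ⟨L₁ ++ L₂, s(fun _ => false, fun k => decide (k = 0)), fun e he => ?_⟩
  induction e with
  | _ x y =>
    have hadj := Fold.comp_adj (L₁ ++ L₂) he
    have hx := hzero x
    have hy := hzero y
    rw [Sym2.map_mk]
    generalize Fold.comp (L₁ ++ L₂) x = a at *
    generalize Fold.comp (L₁ ++ L₂) y = b at *
    have hform : ∀ a : Fin (d + 1) → Bool, (∀ j, j ≠ 0 → a j = false) →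
        a = (fun _ => false) ∨ a = fun k => decide (k = 0) := by
      intro a ha
      cases h : a 0
      · left
        funext k
        by_cases hk : k = 0
        · rw [hk, h]
        · exact ha k hk
      · right
        funext k
        by_cases hk : k = 0
        · rw [hk, h]; rfl
        · rw [ha k hk]; simp [hk]
    rcases hform a hx with rfl | rfl <;> rcases hform b hy with rfl | rfl
    · exact absurd rfl hadj.ne
    · rfl
    · exact Sym2.eq_swap
    · exact absurd rfl hadj.ne

theorem hypercube_edgeSet_nonempty (d : ℕ) : (hypercube (d + 1)).edgeSet.Nonempty := by
  refine ⟨s(fun _ => false, fun k => decide (k = 0)), hypercube_adj.2 ⟨0, by simp, ?_⟩⟩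
  intro j hj
  simp [hj]

theorem hypercube_isWeaklyNorming {d : ℕ} (hd : d ≠ 0) : (hypercube d).IsWeaklyNorming := by
  obtain ⟨d, rfl⟩ := Nat.exists_eq_succ_of_ne_zero hd
  exact (hypercube_foldsToEdge d).isWeaklyNorming (hypercube_edgeSet_nonempty d)

theorem hypercube_stepSidorenko {d : ℕ} (hd : d ≠ 0) : (hypercube d).StepSidorenko := by
  obtain ⟨d, rfl⟩ := Nat.exists_eq_succ_of_ne_zero hd
  exact (hypercube_foldsToEdge d).stepSidorenko (hypercube_edgeSet_nonempty d)

end SimpleGraph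

/-! ### Kernels given by symmetric matrices -/

/-- A map that splits `[0,1]` into measurable sets of equal measure indexed by `B`. -/
structure UniformLabelling (B : Type*) [Fintype B] where
  toFun : I → B
  measurableSet_fiber : ∀ b, MeasurableSet (toFun ⁻¹' {b})
  measureReal_fiber : ∀ b, volume.real (toFun ⁻¹' {b}) = (Fintype.card B : ℝ)⁻¹

/-- The fibre lies between the open and the closed interval from `k / N` to `(k + 1) / N`. The
minimum with `N - 1` puts the endpoint `1` into the last part. -/
theorem measureReal_floor_fiber {N : ℕ} {k : ℕ} (hk : k < N) :
    volume.real {x : I | min ⌊(N : ℝ) * x⌋₊ (N - 1) = k} = (N : ℝ)⁻¹ := by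
  have hN : (0 : ℝ) < N := by exact_mod_cast (Nat.zero_le k).trans_lt hk
  have hk' : (k : ℝ) + 1 ≤ N := by exact_mod_cast hk
  let a : I := ⟨k / N, by positivity, (div_le_one hN).2 (by linarith)⟩
  let b : I := ⟨(k + 1) / N, by positivity, (div_le_one hN).2 hk'⟩
  have hab : (b : ℝ) - a = (N : ℝ)⁻¹ := by
    simp only [a, b]
    field_simp
    ring
  have h1 : Set.Ioo a b ⊆ {x : I | min ⌊(N : ℝ) * x⌋₊ (N - 1) = k} := by
    rintro x ⟨hx1, hx2⟩
    have hx1' : (k : ℝ) / N < x := hx1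
    have hx2' : (x : ℝ) < (k + 1) / N := hx2
    rw [div_lt_iff₀ hN] at hx1'
    rw [lt_div_iff₀ hN] at hx2'
    have : ⌊(N : ℝ) * x⌋₊ = k := by
      rw [Nat.floor_eq_iff (mul_nonneg hN.le x.2.1)]
      constructor <;> linarith
    simp only [Set.mem_ofPred_eq, this]
    omega
  have h2 : {x : I | min ⌊(N : ℝ) * x⌋₊ (N - 1) = k} ⊆ Set.Icc a b := by
    intro x hx
    simp only [Set.mem_ofPred_eq] at hx
    have h3 : k ≤ ⌊(N : ℝ) * x⌋₊ := hx ▸ min_le_left _ _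
    have h3' : (k : ℝ) ≤ N * x := (Nat.le_floor_iff (mul_nonneg hN.le x.2.1)).1 h3
    have h4 : (N : ℝ) * x ≤ k + 1 := by
      by_cases h : ⌊(N : ℝ) * x⌋₊ = k
      · exact ((Nat.floor_eq_iff (mul_nonneg hN.le x.2.1)).1 h).2.le
      · have : k + 1 = N := by omega
        have h5 : (N : ℝ) = k + 1 := by exact_mod_cast this.symm
        nlinarith [x.2.2]
    refine ⟨?_, ?_⟩
    · change (k : ℝ) / N ≤ x
      rw [div_le_iff₀ hN]
      linarith
    · change (x : ℝ) ≤ (k + 1) / N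
      rw [le_div_iff₀ hN]
      linarith
  refine le_antisymm ?_ ?_
  · refine (measureReal_mono h2).trans ?_
    rw [Measure.real, unitInterval.volume_Icc, ENNReal.toReal_ofReal (by rw [hab]; positivity), hab]
  · refine le_trans ?_ (measureReal_mono h1)
    rw [Measure.real, unitInterval.volume_Ioo, ENNReal.toReal_ofReal (by rw [hab]; positivity), hab]

theorem measurable_floor_label (N : ℕ) :
    Measurable fun x : I => min ⌊(N : ℝ) * x⌋₊ (N - 1) :=
  (Nat.measurable_floor.comp (measurable_subtype_coe.const_mul _)).min measurable_const

namespace UniformLabelling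

variable {B : Type*} [Fintype B]

instance [Nonempty B] : Nonempty (UniformLabelling B) := by
  classical
  have hN : 0 < Fintype.card B := Fintype.card_pos
  let e := Fintype.equivFin B
  let g : I → B := fun x =>
    e.symm ⟨min ⌊(Fintype.card B : ℝ) * x⌋₊ (Fintype.card B - 1), by omega⟩
  have hg : ∀ b, g ⁻¹' {b} =
      {x : I | min ⌊(Fintype.card B : ℝ) * x⌋₊ (Fintype.card B - 1) = e b} := by
    intro b
    ext x
    simp only [g, Set.mem_preimage, Set.mem_singleton_iff, Set.mem_ofPred_eq,
      Equiv.symm_apply_eq, Fin.ext_iff]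
  refine ⟨⟨g, fun b => ?_, fun b => ?_⟩⟩
  · rw [hg]
    exact measurable_floor_label _ (measurableSet_singleton _)
  · rw [hg]
    exact measureReal_floor_fiber (e b).2

variable (L : UniformLabelling B)

theorem measurable_comp {X : Type*} [MeasurableSpace X] (f : B → X) :
    Measurable fun x => f (L.toFun x) := by
  classical
  let _ : MeasurableSpace B := ⊤
  have : Measurable L.toFun := measurable_to_countable' L.measurableSet_fiber
  exact (measurable_from_top (f := f)).comp this

theorem measurable_comp₂ {X : Type*} [MeasurableSpace X] (f : B → B → X) :
    Measurable fun p : I × I => f (L.toFun p.1) (L.toFun p.2) := by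
  classical
  let _ : MeasurableSpace B := ⊤
  have : Measurable L.toFun := measurable_to_countable' L.measurableSet_fiber
  exact (measurable_of_finite fun q : B × B => f q.1 q.2).comp
    ((this.comp measurable_fst).prodMk (this.comp measurable_snd))

open Classical in
theorem integral_ite (b : B) :
    ∫ x : I, (if L.toFun x = b then (1 : ℝ) else 0) = (Fintype.card B : ℝ)⁻¹ := by
  rw [← L.measureReal_fiber b, ← integral_indicator_one (L.measurableSet_fiber b)]
  refine integral_congr_ae (Filter.Eventually.of_forall fun x => ?_)
  simp [Set.indicator_apply]

open Classical in
theorem integral_pi {V : Type*} [Fintype V] (F : (V → B) → ℝ) :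
    ∫ x : V → I, F (fun v => L.toFun (x v)) =
      ((Fintype.card B : ℝ)⁻¹) ^ Fintype.card V * ∑ ψ, F ψ := by
  have h : ∀ x : V → I, F (fun v => L.toFun (x v)) =
      ∑ ψ, F ψ * ∏ v, if L.toFun (x v) = ψ v then (1 : ℝ) else 0 := by
    intro x
    rw [Finset.sum_eq_single fun v => L.toFun (x v)]
    · simp
    · intro ψ _ hψ
      have : ∃ v, L.toFun (x v) ≠ ψ v := by
        by_contra! h
        exact hψ (funext fun v => (h v).symm)
      obtain ⟨v, hv⟩ := this
      rw [Finset.prod_eq_zero (Finset.mem_univ v) (by simp [hv]), mul_zero]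
    · simp
  simp only [h]
  have hm : ∀ ψ : V → B, Measurable fun x : V → I =>
      ∏ v, if L.toFun (x v) = ψ v then (1 : ℝ) else 0 := fun ψ =>
    Finset.measurable_fun_prod _ fun v _ =>
      (L.measurable_comp fun b => if b = ψ v then (1 : ℝ) else 0).comp (measurable_pi_apply v)
  rw [integral_finsetSum]
  · rw [Finset.mul_sum]
    refine Finset.sum_congr rfl fun ψ _ => ?_
    rw [integral_const_mul, integral_fintype_prod_volume_eq_prod
      (fun v (y : I) => if L.toFun y = ψ v then (1 : ℝ) else 0), mul_comm]
    simp only [L.integral_ite, Finset.prod_const, Finset.card_univ]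
  · intro ψ _
    refine (integrable_of_measurable_bounded (C := 1) (hm ψ) fun x => ?_).const_mul _
    rw [Finset.abs_prod]
    refine Finset.prod_le_one (fun _ _ => abs_nonneg _) fun v _ => ?_
    split_ifs <;> simp

open Classical in
theorem integral_prod (F : B → B → ℝ) :
    ∫ p : I × I, F (L.toFun p.1) (L.toFun p.2) =
      ((Fintype.card B : ℝ)⁻¹) ^ 2 * ∑ b, ∑ b', F b b' := by
  rw [← integral_fin_two fun x y => F (L.toFun x) (L.toFun y),
    L.integral_pi (V := Fin 2) fun ψ => F (ψ 0) (ψ 1), Fintype.card_fin,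
    ← Fintype.sum_prod_type' F]
  have h := Fintype.sum_equiv (finTwoArrowEquiv B) (fun ψ : Fin 2 → B => F (ψ 0) (ψ 1))
    (fun q => F q.1 q.2) fun ψ => rfl
  exact congrArg (((Fintype.card B : ℝ)⁻¹) ^ 2 * ·) (by convert h)

/-- The kernel that is constant on the blocks, with values given by a symmetric matrix. -/
def kernel (m : B → B → ℝ) (hm : ∀ b b', m b b' = m b' b) : SymKernel where
  toFun x y := m (L.toFun x) (L.toFun y)
  measurable' := L.measurable_comp₂ m
  symm' _ _ := hm _ _
  bounded' := by
    obtain ⟨C, hC⟩ := (Set.finite_range fun q : B × B => |m q.1 q.2|).bddAbove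
    exact ⟨C, fun x y => hC ⟨(L.toFun x, L.toFun y), rfl⟩⟩

end UniformLabelling

/-! ### Partition functions and what the two properties imply for them -/

namespace SimpleGraph

variable {V : Type*} [Fintype V] (H : SimpleGraph V)

open Classical in
/-- The sum over all maps `ψ : V → B` of the products of the values of `m` along the edges. -/
def partitionFunction {B : Type*} [Fintype B] (m : B → B → ℝ) (hm : ∀ b b', m b b' = m b' b) : ℝ :=
  ∑ ψ : V → B, ∏ e ∈ H.edgeFinset, Sym2.lift ⟨m, hm⟩ (e.map ψ)

open Classical in
theorem homDensity_kernel {B : Type*} [Fintype B] (L : UniformLabelling B) (m : B → B → ℝ)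
    (hm : ∀ b b', m b b' = m b' b) : H.homDensity (L.kernel m hm) =
      ((Fintype.card B : ℝ)⁻¹) ^ Fintype.card V * H.partitionFunction m hm := by
  rw [partitionFunction, ← L.integral_pi]
  unfold homDensity
  refine integral_congr_ae (Filter.Eventually.of_forall fun x => ?_)
  dsimp only
  refine Finset.prod_congr rfl fun e _ => ?_
  induction e with
  | _ u v => rfl

variable {H}

/-- The kernel of `m₀` is the midpoint of two kernels of equal norm, so the triangle inequality
bounds its norm by theirs. -/
theorem IsWeaklyNorming.partitionFunction_le (h : H.IsWeaklyNorming) (hne : H.edgeSet.Nonempty)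
    {B : Type*} [Fintype B] [Nonempty B] {m m' m₀ : B → B → ℝ} (hm : ∀ b b', m b b' = m b' b)
    (hm' : ∀ b b', m' b b' = m' b' b) (hm₀ : ∀ b b', m₀ b b' = m₀ b' b)
    (hI : ∀ b b', m b b' ∈ Set.Icc (0 : ℝ) 1) (hI' : ∀ b b', m' b b' ∈ Set.Icc (0 : ℝ) 1)
    (hadd : ∀ b b', m b b' + m' b b' = 2 * m₀ b b')
    (heq : H.partitionFunction m' hm' = H.partitionFunction m hm) :
    H.partitionFunction m₀ hm₀ ≤ H.partitionFunction m hm := by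
  classical
  obtain ⟨L⟩ := (inferInstance : Nonempty (UniformLabelling B))
  have hm0 : H.edgeSet.ncard ≠ 0 := by
    rw [ncard_edgeSet_eq]
    obtain ⟨e, he⟩ := hne
    exact Finset.card_ne_zero_of_mem (mem_edgeFinset.2 he)
  have h1 := h.2 (L.kernel m hm) (L.kernel m' hm') (fun _ _ => hI _ _) fun _ _ => hI' _ _
  have h2 : L.kernel m hm + L.kernel m' hm' = (L.kernel m₀ hm₀).scale 2 :=
    SymKernel.ext' fun x y => hadd _ _
  have h3 : H.homDensity (L.kernel m' hm') = H.homDensity (L.kernel m hm) := by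
    rw [homDensity_kernel, homDensity_kernel, heq]
  have ht : 0 ≤ H.homDensity (L.kernel m hm) := H.homDensity_nonneg fun _ _ => (hI _ _).1
  have ht₀ : 0 ≤ H.homDensity (L.kernel m₀ hm₀) := H.homDensity_nonneg fun x y => by
    have := hadd (L.toFun x) (L.toFun y)
    have := (hI (L.toFun x) (L.toFun y)).1
    have := (hI' (L.toFun x) (L.toFun y)).1
    change 0 ≤ m₀ (L.toFun x) (L.toFun y)
    linarith
  rw [h2, graphNorm, graphNorm, graphNorm, h3, homDensity_scale, ← two_mul] at h1
  have h4 := pow_le_pow_left₀ (Real.rpow_nonneg (by positivity) _) h1 H.edgeSet.ncard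
  rw [mul_pow, one_div, Real.rpow_inv_natCast_pow (by positivity) hm0,
    Real.rpow_inv_natCast_pow ht hm0] at h4
  have h5 := le_of_mul_le_mul_left h4 (by positivity)
  rw [homDensity_kernel, homDensity_kernel] at h5
  exact le_of_mul_le_mul_left h5 (by positivity)

/-- The partition used merges the two halves `(a, true)` and `(a, false)` of every label; the `4`
counts the pairs of halves in a block. -/
theorem StepSidorenko.partitionFunction_le (h : H.StepSidorenko) {A : Type*} [Fintype A]
    [Nonempty A] {m : A × Bool → A × Bool → ℝ} {m₀ : A × Bool → A × Bool → ℝ}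
    (hm : ∀ b b', m b b' = m b' b) (hm₀ : ∀ b b', m₀ b b' = m₀ b' b)
    (hI : ∀ b b', m b b' ∈ Set.Icc (0 : ℝ) 1)
    (havg : ∀ b b', ∑ s, ∑ s', m (b.1, s) (b'.1, s') = 4 * m₀ b b') :
    H.partitionFunction m₀ hm₀ ≤ H.partitionFunction m hm := by
  classical
  obtain ⟨L⟩ := (inferInstance : Nonempty (UniformLabelling (A × Bool)))
  let ε := Fintype.equivFin A
  have hfib : ∀ j, (fun x => ε (L.toFun x).1) ⁻¹' {j} =
      L.toFun ⁻¹' {(ε.symm j, true)} ∪ L.toFun ⁻¹' {(ε.symm j, false)} := by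
    intro j
    ext x
    simp only [Set.mem_preimage, Set.mem_singleton_iff, Set.mem_union, Prod.ext_iff,
      ← Equiv.eq_symm_apply]
    cases (L.toFun x).2 <;> simp
  have hpos : (0 : ℝ) < (Fintype.card (A × Bool) : ℝ)⁻¹ := by
    have : 0 < Fintype.card (A × Bool) := Fintype.card_pos
    positivity
  have hvol : ∀ j, volume.real ((fun x => ε (L.toFun x).1) ⁻¹' {j}) =
      2 * (Fintype.card (A × Bool) : ℝ)⁻¹ := by
    intro j
    rw [hfib, measureReal_union _ (L.measurableSet_fiber _), L.measureReal_fiber,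
      L.measureReal_fiber, two_mul]
    refine Set.disjoint_left.2 fun x hx hx' => ?_
    have h1 : L.toFun x = (ε.symm j, true) := hx
    have h2 : L.toFun x = (ε.symm j, false) := hx'
    simp [h1] at h2
  let P : NonnullPartition :=
    { card := Fintype.card A
      index := fun x => ε (L.toFun x).1
      measurable_index := L.measurable_comp fun b => ε b.1
      nonnull := fun j h0 => by
        have := hvol j
        rw [Measure.real, h0] at this
        simp only [ENNReal.toReal_zero] at this
        linarith }
  have hstep : (L.kernel m hm).step P = L.kernel m₀ hm₀ := by
    refine SymKernel.ext' fun x y => ?_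
    change (L.kernel m hm).blockAverage P (P.index x) (P.index y) = m₀ (L.toFun x) (L.toFun y)
    have hv : ∀ j, volume.real (P.part j) = 2 * (Fintype.card (A × Bool) : ℝ)⁻¹ := hvol
    rw [SymKernel.blockAverage, hv, hv, ← integral_indicator
      ((P.measurableSet_part _).prod (P.measurableSet_part _))]
    have hind : ∀ p : I × I, (P.part (P.index x) ×ˢ P.part (P.index y)).indicator
        (fun p => L.kernel m hm p.1 p.2) p =
        (fun b b' : A × Bool => if b.1 = (L.toFun x).1 ∧ b'.1 = (L.toFun y).1 then m b b' else 0)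
          (L.toFun p.1) (L.toFun p.2) := by
      intro p
      rw [Set.indicator_apply]
      refine if_congr ?_ rfl rfl
      change ε _ = ε _ ∧ ε _ = ε _ ↔ _
      rw [ε.apply_eq_iff_eq, ε.apply_eq_iff_eq]
    rw [integral_congr_ae (Filter.Eventually.of_forall hind), L.integral_prod fun b b' : A × Bool =>
      if b.1 = (L.toFun x).1 ∧ b'.1 = (L.toFun y).1 then m b b' else 0]
    have hsum : ∑ b : A × Bool, ∑ b' : A × Bool,
        (if b.1 = (L.toFun x).1 ∧ b'.1 = (L.toFun y).1 then m b b' else 0) =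
        4 * m₀ (L.toFun x) (L.toFun y) := by
      rw [← havg, Fintype.sum_prod_type, Finset.sum_eq_single (L.toFun x).1]
      · refine Finset.sum_congr rfl fun s _ => ?_
        rw [Fintype.sum_prod_type, Finset.sum_eq_single (L.toFun y).1]
        · simp
        · intro a _ ha
          simp [ha]
        · simp
      · intro a _ ha
        simp [ha]
      · simp
    rw [hsum]
    field_simp
    ring
  have h1 := h (L.kernel m hm) (fun _ _ => hI _ _) P
  rw [hstep, homDensity_kernel, homDensity_kernel] at h1
  exact le_of_mul_le_mul_left h1 (by positivity)

end SimpleGraph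

/-! ### Distances in cycles of even length -/

namespace ZMod

variable {N : ℕ}

/-- The distance from `0` to `a` in the cycle of length `N`. -/
def cycleNorm (a : ZMod N) : ℕ := a.valMinAbs.natAbs

@[simp] theorem cycleNorm_zero : cycleNorm (0 : ZMod N) = 0 := by simp [cycleNorm]

theorem cycleNorm_eq_zero {a : ZMod N} : cycleNorm a = 0 ↔ a = 0 := by simp [cycleNorm]

@[simp] theorem cycleNorm_neg (a : ZMod N) : cycleNorm (-a) = cycleNorm a :=
  natAbs_valMinAbs_neg a

theorem cycleNorm_le [NeZero N] (a : ZMod N) : cycleNorm a ≤ N / 2 := natAbs_valMinAbs_le a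

theorem cycleNorm_natCast {k : ℕ} (hk : k ≤ N / 2) : cycleNorm (k : ZMod N) = k := by
  rw [cycleNorm, valMinAbs_natCast_of_le_half hk, Int.natAbs_natCast]

theorem cycleNorm_one (hN : 2 ≤ N) : cycleNorm (1 : ZMod N) = 1 := by
  have := cycleNorm_natCast (N := N) (k := 1) (by omega)
  simpa using this

theorem cycleNorm_eq_min [NeZero N] (a : ZMod N) : cycleNorm a = min a.val (N - a.val) :=
  valMinAbs_natAbs_eq_min a

theorem val_add_one_eq_ite [NeZero N] (hN : 2 ≤ N) (a : ZMod N) :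
    (a + 1).val = if a.val + 1 = N then 0 else a.val + 1 := by
  have : Fact (1 < N) := ⟨hN⟩
  rw [val_add, val_one]
  have := a.val_lt
  split_ifs with h
  · rw [h, Nat.mod_self]
  · exact Nat.mod_eq_of_lt (by omega)

/-- Evenness is essential: in an odd cycle the two vertices farthest from `0` are adjacent and
equally far. -/
theorem cycleNorm_add_one [NeZero N] (hN : 2 ≤ N) (he : Even N) (a : ZMod N) :
    cycleNorm (a + 1) = cycleNorm a + 1 ∨ cycleNorm (a + 1) + 1 = cycleNorm a := by
  obtain ⟨h, rfl⟩ := he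
  rw [cycleNorm_eq_min, cycleNorm_eq_min, val_add_one_eq_ite hN]
  have := a.val_lt
  split_ifs <;> omega

theorem cycleNorm_add_sign [NeZero N] (hN : 2 ≤ N) (he : Even N) (a : ZMod N) {s : ZMod N}
    (hs : s = 1 ∨ s = -1) :
    cycleNorm (a + s) = cycleNorm a + 1 ∨ cycleNorm (a + s) + 1 = cycleNorm a := by
  rcases hs with rfl | rfl
  · exact cycleNorm_add_one hN he a
  · have h := cycleNorm_add_one hN he (a + -1)
    rw [neg_add_cancel_right] at h
    omega

theorem exists_cycleNorm_add_lt [NeZero N] (hN : 2 ≤ N) (he : Even N) {a : ZMod N} (ha : a ≠ 0) :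
    ∃ s : ZMod N, (s = 1 ∨ s = -1) ∧ cycleNorm (a + s) + 1 = cycleNorm a := by
  by_contra! h
  have h1 := h 1 (Or.inl rfl)
  have h2 := h (-1) (Or.inr rfl)
  have h3 := val_add_one_eq_ite hN a
  have h4 := val_add_one_eq_ite hN (a + -1)
  rw [neg_add_cancel_right] at h4
  rw [cycleNorm_eq_min, cycleNorm_eq_min] at h1 h2
  have h5 : a.val ≠ 0 := fun h => ha ((val_eq_zero a).1 h)
  have := a.val_lt
  have := (a + -1).val_lt
  obtain ⟨k, rfl⟩ := he
  split_ifs at h3 h4 <;> omega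

theorem natCast_ne_zero_of_lt {k : ℕ} (h0 : k ≠ 0) (hk : k < N) : (k : ZMod N) ≠ 0 := by
  rw [Ne, natCast_eq_zero_iff]
  exact fun h => absurd (Nat.le_of_dvd (Nat.pos_of_ne_zero h0) h) (by omega)

end ZMod

/-! ### Toroidal grids on cyclic groups -/

namespace Torus

open ZMod

variable {ι : Type*} {ℓ : ι → ℕ}

/-- The differences of adjacent vertices of a toroidal grid. -/
def steps [DecidableEq ι] (ℓ : ι → ℕ) : Set (∀ i, ZMod (ℓ i)) :=
  {c | ∃ (i : ι) (s : ZMod (ℓ i)), (s = 1 ∨ s = -1) ∧ c = Pi.single i s}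

theorem neg_mem_steps [DecidableEq ι] {c : ∀ i, ZMod (ℓ i)} (hc : c ∈ steps ℓ) : -c ∈ steps ℓ := by
  obtain ⟨i, s, hs, rfl⟩ := hc
  refine ⟨i, -s, ?_, by rw [Pi.single_neg]⟩
  rcases hs with rfl | rfl <;> simp

variable [Fintype ι]

/-- The distance from `0` in the toroidal grid. -/
def norm (x : ∀ i, ZMod (ℓ i)) : ℕ := ∑ i, cycleNorm (x i)

@[simp] theorem norm_zero : norm (0 : ∀ i, ZMod (ℓ i)) = 0 := by simp [norm]

theorem norm_eq_zero {x : ∀ i, ZMod (ℓ i)} : norm x = 0 ↔ x = 0 := by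
  simp [norm, cycleNorm_eq_zero, funext_iff]

variable [DecidableEq ι]

theorem norm_add_single (x : ∀ i, ZMod (ℓ i)) (i : ι) (s : ZMod (ℓ i)) :
    norm (x + Pi.single i s) + cycleNorm (x i) = norm x + cycleNorm (x i + s) := by
  unfold norm
  rw [← Finset.add_sum_erase _ _ (Finset.mem_univ i),
    ← Finset.add_sum_erase _ (fun k => cycleNorm (x k)) (Finset.mem_univ i)]
  have : ∑ k ∈ Finset.univ.erase i, cycleNorm ((x + (Pi.single i s : ∀ i, ZMod (ℓ i))) k) =
      ∑ k ∈ Finset.univ.erase i, cycleNorm (x k) :=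
    Finset.sum_congr rfl fun k hk => by
      rw [Pi.add_apply, Pi.single_eq_of_ne (Finset.ne_of_mem_erase hk), add_zero]
  rw [this, Pi.add_apply, Pi.single_eq_same]
  omega

theorem norm_single (i : ι) (s : ZMod (ℓ i)) : norm (Pi.single i s) = cycleNorm s := by
  simpa using norm_add_single 0 i s

theorem norm_sub_single (x : ∀ i, ZMod (ℓ i)) (i : ι) (s : ZMod (ℓ i)) :
    norm (x - Pi.single i s) + cycleNorm (x i) = norm x + cycleNorm (x i - s) := by
  simpa [sub_eq_add_neg, Pi.single_neg] using norm_add_single x i (-s)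

theorem norm_sub_single_eq_iff (x : ∀ i, ZMod (ℓ i)) (i : ι) (s : ZMod (ℓ i)) :
    norm (x - Pi.single i s) = norm x + 1 ↔ cycleNorm (x i - s) = cycleNorm (x i) + 1 := by
  have := norm_sub_single x i s
  omega

variable [∀ i, NeZero (ℓ i)]

/-- The sum of the `ℓ k / 2` is the diameter, and a vanishing coordinate forfeits its share. The
rigidity argument ends by contradicting this bound. -/
theorem norm_le_of_apply_eq_zero {x : ∀ i, ZMod (ℓ i)} {i : ι} (h : x i = 0) :
    norm x + ℓ i / 2 ≤ ∑ k, ℓ k / 2 := by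
  unfold norm
  rw [← Finset.add_sum_erase _ _ (Finset.mem_univ i),
    ← Finset.add_sum_erase _ (fun k => ℓ k / 2) (Finset.mem_univ i), h, cycleNorm_zero]
  have := Finset.sum_le_sum fun k (_ : k ∈ Finset.univ.erase i) => cycleNorm_le (x k)
  omega

section Even

variable (h4 : ∀ i, 4 ≤ ℓ i) (he : ∀ i, Even (ℓ i))
include h4 he

theorem norm_add_step (x : ∀ i, ZMod (ℓ i)) {c : ∀ i, ZMod (ℓ i)} (hc : c ∈ steps ℓ) :
    norm (x + c) = norm x + 1 ∨ norm (x + c) + 1 = norm x := by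
  obtain ⟨i, s, hs, rfl⟩ := hc
  have h1 := norm_add_single x i s
  have h2 := cycleNorm_add_sign (by linarith [h4 i]) (he i) (x i) hs
  omega

theorem norm_sub_step (x : ∀ i, ZMod (ℓ i)) {c : ∀ i, ZMod (ℓ i)} (hc : c ∈ steps ℓ) :
    norm (x - c) = norm x + 1 ∨ norm (x - c) + 1 = norm x := by
  rw [sub_eq_add_neg]
  exact norm_add_step h4 he x (neg_mem_steps hc)

theorem exists_norm_add_lt {x : ∀ i, ZMod (ℓ i)} (hx : x ≠ 0) :
    ∃ c ∈ steps ℓ, norm (x + c) + 1 = norm x := by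
  obtain ⟨i, hi⟩ := Function.ne_iff.1 hx
  obtain ⟨s, hs, h⟩ := exists_cycleNorm_add_lt (by linarith [h4 i]) (he i) hi
  refine ⟨Pi.single i s, ⟨i, s, hs, rfl⟩, ?_⟩
  have := norm_add_single x i s
  omega

/-- Induction along a shortest path from `x` to `y`: a homomorphism maps steps to steps, and a step
changes the distance by one. -/
theorem norm_sub_le_of_hom {φ : (∀ i, ZMod (ℓ i)) → ∀ i, ZMod (ℓ i)}
    (hφ : ∀ x, ∀ c ∈ steps ℓ, φ (x + c) - φ x ∈ steps ℓ) (x y : ∀ i, ZMod (ℓ i)) :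
    norm (φ x - φ y) ≤ norm (x - y) := by
  induction hn : norm (x - y) generalizing x with
  | zero =>
    rw [sub_eq_zero.1 (norm_eq_zero.1 hn), sub_self, norm_zero]
  | succ n ih =>
    have hne : x - y ≠ 0 := fun h => by rw [h, norm_zero] at hn; omega
    obtain ⟨c, hc, h⟩ := exists_norm_add_lt h4 he hne
    rw [sub_add_eq_add_sub] at h
    have h1 := ih (x + c) (by omega)
    have h2 := norm_sub_step h4 he (φ (x + c) - φ y) (hφ x c hc)
    rw [show φ (x + c) - φ y - (φ (x + c) - φ x) = φ x - φ y by abel] at h2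
    omega

theorem norm_mod_two_of_hom {φ : (∀ i, ZMod (ℓ i)) → ∀ i, ZMod (ℓ i)}
    (hφ : ∀ x, ∀ c ∈ steps ℓ, φ (x + c) - φ x ∈ steps ℓ) (h0 : φ 0 = 0)
    (x : ∀ i, ZMod (ℓ i)) : norm (φ x) % 2 = norm x % 2 := by
  induction hn : norm x generalizing x with
  | zero => rw [norm_eq_zero.1 hn, h0, norm_zero]
  | succ n ih =>
    have hne : x ≠ 0 := fun h => by rw [h, norm_zero] at hn; omega
    obtain ⟨c, hc, h⟩ := exists_norm_add_lt h4 he hne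
    have h1 := ih (x + c) (by omega)
    have h2 := norm_sub_step h4 he (φ (x + c)) (hφ x c hc)
    rw [sub_sub_cancel] at h2
    omega

end Even

end Torus

/-! ### Points far from a pair of steps -/

namespace Torus

open ZMod

variable {ι : Type*} [Fintype ι] {ℓ : ι → ℕ}

/-- The point `x` is farther from `c` than from `0`. -/
def Far (c x : ∀ i, ZMod (ℓ i)) : Prop := norm (x - c) = norm x + 1

/-- The distance from `x` to the set `{0, a, b}`. -/
def tripleDist (a b x : ∀ i, ZMod (ℓ i)) : ℕ := min (norm x) (min (norm (x - a)) (norm (x - b)))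

variable [DecidableEq ι]

theorem far_single_iff {i : ι} {s : ZMod (ℓ i)} {x : ∀ i, ZMod (ℓ i)} :
    Far (Pi.single i s) x ↔ cycleNorm (x i - s) = cycleNorm (x i) + 1 :=
  norm_sub_single_eq_iff x i s

variable [∀ i, NeZero (ℓ i)]

section Even

variable (h4 : ∀ i, 4 ≤ ℓ i) (he : ∀ i, Even (ℓ i))
include h4 he

-- The norms of `x - a` and `x - b` differ from that of `x` by exactly one, so the minimum lies
-- below `norm x` unless both are larger. Comparing total distances thereby reduces to counting
-- points far from both `a` and `b`.
open Classical in
theorem tripleDist_add_one {a b : ∀ i, ZMod (ℓ i)} (ha : a ∈ steps ℓ) (hb : b ∈ steps ℓ)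
    (x : ∀ i, ZMod (ℓ i)) :
    tripleDist a b x + 1 = norm x + if Far a x ∧ Far b x then 1 else 0 := by
  have h1 := norm_sub_step h4 he x ha
  have h2 := norm_sub_step h4 he x hb
  unfold tripleDist Far
  split_ifs with h <;> omega

open Classical in
theorem sum_tripleDist {a b : ∀ i, ZMod (ℓ i)} (ha : a ∈ steps ℓ) (hb : b ∈ steps ℓ) :
    ∑ x, tripleDist a b x + Fintype.card (∀ i, ZMod (ℓ i)) =
      ∑ x : ∀ i, ZMod (ℓ i), norm x +
        (Finset.univ.filter fun x : ∀ i, ZMod (ℓ i) => Far a x ∧ Far b x).card := by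
  rw [Finset.card_filter, ← Finset.sum_add_distrib, ← Finset.card_univ, Finset.card_eq_sum_ones,
    ← Finset.sum_add_distrib]
  exact Finset.sum_congr rfl fun x _ => tripleDist_add_one h4 he ha hb x

-- The reflection `x i ↦ s - x i` exchanges the points far from `s e_i` with the others and respects
-- `Q`, so exactly half of the points of `Q` are far.
open Classical in
theorem card_filter_far (i : ι) {s : ZMod (ℓ i)} (hs : s = 1 ∨ s = -1)
    (Q : (∀ i, ZMod (ℓ i)) → Prop) (hQ : ∀ x t, Q (Function.update x i t) ↔ Q x) :
    2 * (Finset.univ.filter fun x => Far (Pi.single i s) x ∧ Q x).card =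
      (Finset.univ.filter fun x => Q x).card := by
  have hc : (Pi.single i s : ∀ i, ZMod (ℓ i)) ∈ steps ℓ := ⟨i, s, hs, rfl⟩
  have hfar : ∀ x : ∀ i, ZMod (ℓ i), Far (Pi.single i s) (Function.update x i (s - x i)) ↔
      ¬ Far (Pi.single i s) x := by
    intro x
    rw [far_single_iff, far_single_iff, Function.update_self, sub_sub_cancel_left, cycleNorm_neg,
      ← cycleNorm_neg (s - x i), neg_sub]
    have := cycleNorm_add_sign (by linarith [h4 i]) (he i) (x i) (s := -s)
      (by rcases hs with rfl | rfl <;> simp)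
    rw [← sub_eq_add_neg] at this
    omega
  have hinv : ∀ x : ∀ i, ZMod (ℓ i), Function.update (Function.update x i (s - x i)) i
      (s - Function.update x i (s - x i) i) = x := by
    intro x
    simp
  have hbij : (Finset.univ.filter fun x => Far (Pi.single i s) x ∧ Q x).card =
      (Finset.univ.filter fun x => ¬ Far (Pi.single i s) x ∧ Q x).card := by
    refine Finset.card_nbij' (fun x => Function.update x i (s - x i))
      (fun x => Function.update x i (s - x i)) ?_ ?_ (fun x _ => hinv x) fun x _ => hinv x
    · intro x hx
      simp only [Finset.coe_filter, Finset.mem_univ, true_and, Set.mem_ofPred_eq, hQ, hfar,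
        not_not] at hx ⊢
      exact hx
    · intro x hx
      simp only [Finset.coe_filter, Finset.mem_univ, true_and, Set.mem_ofPred_eq, hQ, hfar] at hx ⊢
      exact hx
  rw [two_mul]
  nth_rewrite 2 [hbij]
  rw [← Finset.card_filter_add_card_filter_not (s := Finset.univ.filter fun x => Q x)
    (p := fun x => Far (Pi.single i s) x), Finset.filter_filter, Finset.filter_filter]
  simp only [and_comm]

open Classical in
theorem card_far_of_ne {i j : ι} (hij : i ≠ j) {s : ZMod (ℓ i)} {t : ZMod (ℓ j)}
    (hs : s = 1 ∨ s = -1) (ht : t = 1 ∨ t = -1) :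
    4 * (Finset.univ.filter fun x => Far (Pi.single i s) x ∧ Far (Pi.single j t) x).card =
      Fintype.card (∀ i, ZMod (ℓ i)) := by
  have h1 := card_filter_far h4 he i hs (fun x => Far (Pi.single j t) x) fun x r => by
    rw [far_single_iff, far_single_iff, Function.update_of_ne hij.symm]
  have h2 := card_filter_far h4 he j ht (fun _ => True) fun _ _ => Iff.rfl
  simp only [and_true, Finset.filter_true, Finset.card_univ] at h2
  omega

-- Being farther from both neighbours of `0` in direction `i` means `x i = 0`, and the `ℓ i` fibres
-- of this coordinate are translates of each other.
open Classical in
theorem card_far_opposite (i : ι) :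
    ℓ i * (Finset.univ.filter fun x : ∀ i, ZMod (ℓ i) =>
      Far (Pi.single i 1) x ∧ Far (Pi.single i (-1)) x).card =
      Fintype.card (∀ i, ZMod (ℓ i)) := by
  have hz : ∀ x : ∀ i, ZMod (ℓ i),
      Far (Pi.single i 1) x ∧ Far (Pi.single i (-1)) x ↔ x i = 0 := by
    intro x
    rw [far_single_iff, far_single_iff, sub_neg_eq_add]
    constructor
    · intro h
      by_contra hx
      obtain ⟨s, rfl | rfl, hs⟩ := exists_cycleNorm_add_lt (by linarith [h4 i]) (he i) hx
      · omega
      · rw [← sub_eq_add_neg] at hs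
        omega
    · intro h
      rw [h]
      simp [cycleNorm_one (N := ℓ i) (by linarith [h4 i])]
  simp only [hz]
  have hfib : ∀ t : ZMod (ℓ i), (Finset.univ.filter fun x : ∀ i, ZMod (ℓ i) => x i = t).card =
      (Finset.univ.filter fun x : ∀ i, ZMod (ℓ i) => x i = 0).card := by
    intro t
    refine Finset.card_nbij' (fun x => x - Pi.single i t) (fun x => x + Pi.single i t) ?_ ?_
      (fun x _ => by simp) fun x _ => by simp
    · intro x hx
      simp only [Finset.coe_filter, Finset.mem_univ, true_and, Set.mem_ofPred_eq] at hx ⊢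
      simp [hx]
    · intro x hx
      simp only [Finset.coe_filter, Finset.mem_univ, true_and, Set.mem_ofPred_eq] at hx ⊢
      simp [hx]
  have h := Finset.card_eq_sum_card_fiberwise (f := fun x : ∀ i, ZMod (ℓ i) => x i)
    (s := Finset.univ) (t := Finset.univ) fun _ _ => Finset.mem_coe.2 (Finset.mem_univ _)
  rw [← Finset.card_univ, h, Finset.sum_congr rfl fun t _ => hfib t, Finset.sum_const,
    Finset.card_univ, ZMod.card, smul_eq_mul]

omit [Fintype ι] [∀ i, NeZero (ℓ i)] h4 he in
theorem steps_cases {a b : ∀ i, ZMod (ℓ i)} (ha : a ∈ steps ℓ) (hb : b ∈ steps ℓ) (hab : a ≠ b) :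
    (∃ (i j : ι) (s : ZMod (ℓ i)) (t : ZMod (ℓ j)), i ≠ j ∧ (s = 1 ∨ s = -1) ∧
      (t = 1 ∨ t = -1) ∧ a = Pi.single i s ∧ b = Pi.single j t) ∨
    ∃ (i : ι) (s : ZMod (ℓ i)), (s = 1 ∨ s = -1) ∧ a = Pi.single i s ∧ b = Pi.single i (-s) := by
  obtain ⟨i, s, hs, rfl⟩ := ha
  obtain ⟨j, t, ht, rfl⟩ := hb
  by_cases hij : i = j
  · subst hij
    refine Or.inr ⟨i, s, hs, rfl, ?_⟩
    rcases hs with rfl | rfl <;> rcases ht with rfl | rfl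
    · exact absurd rfl hab
    · rfl
    · simp
    · exact absurd rfl hab
  · exact Or.inl ⟨i, j, s, t, hij, hs, ht, rfl, rfl⟩

open Classical in
theorem card_far_straight {i : ι} {s : ZMod (ℓ i)} (hs : s = 1 ∨ s = -1) :
    ℓ i * (Finset.univ.filter fun x : ∀ i, ZMod (ℓ i) =>
      Far (Pi.single i s) x ∧ Far (Pi.single i (-s)) x).card =
      Fintype.card (∀ i, ZMod (ℓ i)) := by
  rcases hs with rfl | rfl
  · exact card_far_opposite h4 he i
  · rw [neg_neg, ← card_far_opposite h4 he i]
    simp only [and_comm]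

-- The far points form exactly a quarter of the torus for perpendicular steps, and a fraction `1 / ℓ
-- i ≤ 1 / 4` for opposite ones.
open Classical in
theorem four_mul_card_far_le {a b : ∀ i, ZMod (ℓ i)} (ha : a ∈ steps ℓ) (hb : b ∈ steps ℓ)
    (hab : a ≠ b) :
    4 * (Finset.univ.filter fun x => Far a x ∧ Far b x).card ≤
      Fintype.card (∀ i, ZMod (ℓ i)) := by
  rcases steps_cases ha hb hab with ⟨i, j, s, t, hij, hs, ht, rfl, rfl⟩ | ⟨i, s, hs, rfl, rfl⟩
  · exact (card_far_of_ne h4 he hij hs ht).le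
  · rw [← card_far_straight h4 he hs]
    exact Nat.mul_le_mul_right _ (h4 i)

/-- Among all pairs of distinct steps, the total distance to `{0, a, b}` is the largest for
perpendicular `a`, `b`. -/
theorem sum_tripleDist_le {i j : ι} (hij : i ≠ j) {a b : ∀ i, ZMod (ℓ i)} (ha : a ∈ steps ℓ)
    (hb : b ∈ steps ℓ) (hab : a ≠ b) :
    ∑ x, tripleDist a b x ≤ ∑ x : ∀ i, ZMod (ℓ i), tripleDist (Pi.single i 1) (Pi.single j 1) x := by
  classical
  have h1 := sum_tripleDist h4 he ha hb
  have h2 := sum_tripleDist h4 he (a := Pi.single i 1) (b := Pi.single j 1)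
    ⟨i, 1, Or.inl rfl, rfl⟩ ⟨j, 1, Or.inl rfl, rfl⟩
  have h3 := four_mul_card_far_le h4 he ha hb hab
  have h5 := card_far_of_ne h4 he hij (s := 1) (t := 1) (Or.inl rfl) (Or.inl rfl)
  omega

theorem four_mul_card_far_eq {i j : ι} (hij : i ≠ j) {a b : ∀ i, ZMod (ℓ i)} (ha : a ∈ steps ℓ)
    (hb : b ∈ steps ℓ)
    (heq : ∑ x, tripleDist a b x =
      ∑ x : ∀ i, ZMod (ℓ i), tripleDist (Pi.single i 1) (Pi.single j 1) x) {k : ι} {s : ZMod (ℓ k)}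
    (hs : s = 1 ∨ s = -1) (hak : a = Pi.single k s) (hbk : b = Pi.single k (-s)) : ℓ k = 4 := by
  classical
  have h1 := sum_tripleDist h4 he ha hb
  have h2 := sum_tripleDist h4 he (a := Pi.single i 1) (b := Pi.single j 1)
    ⟨i, 1, Or.inl rfl, rfl⟩ ⟨j, 1, Or.inl rfl, rfl⟩
  have h3 := card_far_straight h4 he hs
  have h5 := card_far_of_ne h4 he hij (s := 1) (t := 1) (Or.inl rfl) (Or.inl rfl)
  subst hak hbk
  have h6 : (Finset.univ.filter fun x : ∀ i, ZMod (ℓ i) =>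
      Far (Pi.single k s) x ∧ Far (Pi.single k (-s)) x).card =
      (Finset.univ.filter fun x : ∀ i, ZMod (ℓ i) =>
        Far (Pi.single i 1) x ∧ Far (Pi.single j 1) x).card := by omega
  have hpos : 0 < Fintype.card (∀ i, ZMod (ℓ i)) := Fintype.card_pos
  rw [← h6, ← h3] at h5
  exact (Nat.eq_of_mul_eq_mul_right (by
    refine Nat.pos_of_ne_zero fun h => ?_
    rw [h] at h3
    omega) h5).symm

end Even

end Torus

/-! ### Rigidity of homomorphisms that preserve the distances to a corner -/

namespace Torus

open ZMod

variable {ι : Type*} [DecidableEq ι] {ℓ : ι → ℕ}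

theorem step_apply_cases {c : ∀ i, ZMod (ℓ i)} (hc : c ∈ steps ℓ) (i : ι) :
    (c i = 0 ∨ c = Pi.single i 1 ∨ c = Pi.single i (-1)) := by
  obtain ⟨j, s, hs, rfl⟩ := hc
  by_cases h : i = j
  · subst h
    rcases hs with rfl | rfl <;> simp
  · left
    rw [Pi.single_eq_of_ne h]

/-- Comparing `i`-th coordinates, any exotic coincidence of two paths of length two would make one
of `1, 2, 3, 4` vanish modulo `ℓ i`. Only coordinate squares remain. Length four fails, since there
`e_i + e_i = -e_i - e_i`. -/
theorem eq_add_of_common_neighbor {i : ι} (h6 : 6 ≤ ℓ i) {f g g' : ∀ i, ZMod (ℓ i)}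
    (hf : f ∈ steps ℓ) (hg : g ∈ steps ℓ) (hg' : g' ∈ steps ℓ) (hne : f ≠ Pi.single i 1)
    (h : Pi.single i 1 + g = f + g') (h0 : Pi.single i 1 + g ≠ 0) : g = f ∧ f i = 0 := by
  have c2 : (2 : ZMod (ℓ i)) ≠ 0 := by
    exact_mod_cast natCast_ne_zero_of_lt (N := ℓ i) (k := 2) (by norm_num) (by omega)
  have c3 : (3 : ZMod (ℓ i)) ≠ 0 := by
    exact_mod_cast natCast_ne_zero_of_lt (N := ℓ i) (k := 3) (by norm_num) (by omega)
  have c4 : (4 : ZMod (ℓ i)) ≠ 0 := by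
    exact_mod_cast natCast_ne_zero_of_lt (N := ℓ i) (k := 4) (by norm_num) (by omega)
  have c1 : (1 : ZMod (ℓ i)) ≠ 0 := by
    exact_mod_cast natCast_ne_zero_of_lt (N := ℓ i) (k := 1) (by norm_num) (by omega)
  have hi := congrFun h i
  rw [Pi.add_apply, Pi.add_apply, Pi.single_eq_same] at hi
  have hgneg : g ≠ Pi.single i (-1) := by
    rintro rfl
    rw [← Pi.single_add] at h0
    simp at h0
  rcases step_apply_cases hg i with hg0 | rfl | rfl
  · rw [hg0, add_zero] at hi
    rcases step_apply_cases hf i with hf0 | rfl | rfl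
    · rw [hf0, zero_add] at hi
      rcases step_apply_cases hg' i with h' | rfl | rfl
      · rw [h'] at hi
        exact absurd hi c1
      · exact ⟨by rw [add_comm] at h; exact add_right_cancel h, hf0⟩
      · rw [Pi.single_eq_same] at hi
        exact absurd (by linear_combination hi) c2
    · exact absurd rfl hne
    · rw [Pi.single_eq_same] at hi
      rcases step_apply_cases hg' i with h' | rfl | rfl
      · rw [h'] at hi
        exact absurd (by linear_combination hi) c2
      · rw [Pi.single_eq_same] at hi
        exact absurd (by linear_combination hi) c1
      · rw [Pi.single_eq_same] at hi
        exact absurd (by linear_combination hi) c3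
  · rw [Pi.single_eq_same] at hi
    rcases step_apply_cases hf i with hf0 | rfl | rfl
    · rw [hf0] at hi
      rcases step_apply_cases hg' i with h' | rfl | rfl
      · rw [h'] at hi
        exact absurd (by linear_combination hi) c2
      · rw [Pi.single_eq_same] at hi
        exact absurd (by linear_combination hi) c1
      · rw [Pi.single_eq_same] at hi
        exact absurd (by linear_combination hi) c3
    · exact absurd rfl hne
    · rw [Pi.single_eq_same] at hi
      rcases step_apply_cases hg' i with h' | rfl | rfl
      · rw [h'] at hi
        exact absurd (by linear_combination hi) c3
      · rw [Pi.single_eq_same] at hi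
        exact absurd (by linear_combination hi) c2
      · rw [Pi.single_eq_same] at hi
        exact absurd (by linear_combination hi) c4
  · exact absurd rfl hgneg

variable [Fintype ι]

/-- A homomorphism of the toroidal grid fixing `0` that preserves norms, and that maps the points
far from both `a` and `b` to the points far from the unit vectors `i` and `j`, and no others. -/
structure CornerHom (ℓ : ι → ℕ) (a b : ∀ i, ZMod (ℓ i)) (i j : ι) where
  toFun : (∀ i, ZMod (ℓ i)) → ∀ i, ZMod (ℓ i)
  map_step : ∀ x, ∀ c ∈ steps ℓ, toFun (x + c) - toFun x ∈ steps ℓ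
  map_zero : toFun 0 = 0
  norm_map : ∀ x, norm (toFun x) = norm x
  far_iff : ∀ x, Far (Pi.single i 1) (toFun x) ∧ Far (Pi.single j 1) (toFun x) ↔ Far a x ∧ Far b x

namespace CornerHom

variable {a b : ∀ i, ZMod (ℓ i)} {i j : ι} (φ : CornerHom ℓ a b i j)

-- In the square `x`, `x + y`, `x + y + c`, `x + c` the first two vertices are far and the last two
-- are not. Since `φ` respects this distinction, neither diagonal collapses, and
-- `eq_add_of_common_neighbor` makes the image a coordinate square in which the edge `e_i` is
-- carried along.
include φ in
theorem transport (h6 : 6 ≤ ℓ i) {x y c : ∀ i, ZMod (ℓ i)} (hy : y ∈ steps ℓ) (hc : c ∈ steps ℓ)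
    (hx : Far a x ∧ Far b x) (hxy : Far a (x + y) ∧ Far b (x + y))
    (hxc : ¬ (Far a (x + c) ∧ Far b (x + c)))
    (hxyc : ¬ (Far a (x + y + c) ∧ Far b (x + y + c)))
    (h : φ.toFun (x + c) = φ.toFun x + Pi.single i 1) :
    φ.toFun (x + y + c) = φ.toFun (x + y) + Pi.single i 1 ∧
      φ.toFun (x + y) i = φ.toFun x i := by
  have hf := φ.map_step x y hy
  have hg := φ.map_step (x + c) y hy
  have hg' := φ.map_step (x + y) c hc
  rw [show x + c + y = x + y + c by abel] at hg
  have key := eq_add_of_common_neighbor h6 hf hg hg' (fun h' => ?_) (by rw [h]; abel) (fun h' => ?_)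
  · refine ⟨?_, ?_⟩
    · have := key.1
      rw [h] at this
      have h2 : φ.toFun (x + y + c) = (φ.toFun (x + y + c) - (φ.toFun x + Pi.single i 1)) +
          φ.toFun x + Pi.single i 1 := by abel
      rw [h2, this]
      abel
    · have := key.2
      rw [Pi.sub_apply, sub_eq_zero] at this
      exact this
  · have : φ.toFun (x + y) = φ.toFun (x + c) := by rw [h, ← h']; abel
    refine hxc ((φ.far_iff _).1 ?_)
    rw [← this]
    exact (φ.far_iff _).2 hxy
  · have : φ.toFun (x + y + c) = φ.toFun x := by
      rw [h] at h'
      have h2 : φ.toFun (x + y + c) = Pi.single i 1 +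
          (φ.toFun (x + y + c) - (φ.toFun x + Pi.single i 1)) + φ.toFun x := by abel
      rw [h2, h', zero_add]
    refine hxyc ((φ.far_iff _).1 ?_)
    rw [this]
    exact (φ.far_iff _).2 hx

-- Induction on the norm of `w`, walking inside `R` towards `0`. The translate `R + x₀` consists of
-- far points and `R + x₀ + c` of others, so `transport` applies at every step, and the `i`-th
-- coordinate of the image never changes.
include φ in
theorem transport_region (h6 : 6 ≤ ℓ i) (R : Set (∀ i, ZMod (ℓ i))) (x₀ : ∀ i, ZMod (ℓ i))
    {c : ∀ i, ZMod (ℓ i)} (hc : c ∈ steps ℓ)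
    (hR : ∀ w ∈ R, w ≠ 0 → ∃ y ∈ steps ℓ, w + y ∈ R ∧ norm (w + y) < norm w)
    (hfar : ∀ w ∈ R, Far a (w + x₀) ∧ Far b (w + x₀))
    (hnear : ∀ w ∈ R, ¬ (Far a (w + x₀ + c) ∧ Far b (w + x₀ + c)))
    (h0 : φ.toFun (x₀ + c) = φ.toFun x₀ + Pi.single i 1) :
    ∀ w ∈ R, φ.toFun (w + x₀ + c) = φ.toFun (w + x₀) + Pi.single i 1 ∧
      φ.toFun (w + x₀) i = φ.toFun x₀ i := by
  intro w
  induction hn : norm w using Nat.strong_induction_on generalizing w with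
  | _ n ih =>
    intro hw
    by_cases hw0 : w = 0
    · rw [hw0, zero_add]
      exact ⟨h0, rfl⟩
    · obtain ⟨y, hy, hyR, hlt⟩ := hR w hw hw0
      have h1 := ih _ (hn ▸ hlt) (w + y) rfl hyR
      have h2 : w + x₀ = w + y + x₀ + -y := by abel
      have h3 := φ.transport h6 (x := w + y + x₀) (neg_mem_steps hy) hc (hfar _ hyR)
        (by rw [← h2]; exact hfar _ hw) (hnear _ hyR) (by rw [← h2]; exact hnear _ hw) h1.1
      rw [← h2] at h3
      exact ⟨h3.1, h3.2.trans h1.2⟩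

end CornerHom

end Torus

namespace ZMod

theorem cycleNorm_natCast_mul_sign {N k : ℕ} (hk : k ≤ N / 2) {s : ZMod N}
    (hs : s = 1 ∨ s = -1) : cycleNorm (-((k : ZMod N) * s)) = k := by
  rcases hs with rfl | rfl <;> simp [cycleNorm_natCast hk]

end ZMod

namespace Torus

open ZMod

variable {ι : Type*} [DecidableEq ι] {ℓ : ι → ℕ} [Fintype ι] [∀ i, NeZero (ℓ i)]

section Even

variable (h4 : ∀ i, 4 ≤ ℓ i) (he : ∀ i, Even (ℓ i))
include h4 he

/-- Any nonzero coordinate can be moved closer to `0`. In coordinate `q` the hypothesis forces that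
move to be `+t`, and its result is again farther from `t` than from `0`. -/
theorem exists_step_toward_zero {p q : ι} {t : ZMod (ℓ q)} (ht : t = 1 ∨ t = -1)
    {w : ∀ i, ZMod (ℓ i)} (hp : w p = 0) (hq : cycleNorm (w q - t) = cycleNorm (w q) + 1)
    (hw : w ≠ 0) : ∃ y ∈ steps ℓ, (w + y) p = 0 ∧
      cycleNorm ((w + y) q - t) = cycleNorm ((w + y) q) + 1 ∧ norm (w + y) < norm w := by
  obtain ⟨l, hl⟩ := Function.ne_iff.1 hw
  obtain ⟨r, hr, h⟩ := exists_cycleNorm_add_lt (by linarith [h4 l]) (he l) hl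
  have hlp : p ≠ l := by
    rintro rfl
    exact hl hp
  refine ⟨Pi.single l r, ⟨l, r, hr, rfl⟩, ?_, ?_, ?_⟩
  · rw [Pi.add_apply, hp, Pi.single_eq_of_ne hlp, add_zero]
  · by_cases hlq : q = l
    · subst hlq
      rw [Pi.add_apply, Pi.single_eq_same]
      have hrt : r = t := by
        by_contra hne
        have : r = -t := by
          rcases hr with rfl | rfl <;> rcases ht with rfl | rfl <;> simp_all
        rw [this, ← sub_eq_add_neg] at h
        omega
      rw [hrt] at h ⊢
      rw [add_sub_cancel_right]
      exact h.symm
    · rwa [Pi.add_apply, Pi.single_eq_of_ne hlq, add_zero]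
  · have := norm_add_single w l r
    omega

namespace CornerHom

variable {a b : ∀ i, ZMod (ℓ i)} {i j : ι} (φ : CornerHom ℓ a b i j)

-- The image keeps the norm of `z`, two below the diameter, but its vanishing `i`-th coordinate puts
-- it at least `ℓ i / 2 ≥ 3` below.
omit h4 he in
include φ in
theorem false_of_norm_eq (h6 : 6 ≤ ℓ i) {z : ∀ i, ZMod (ℓ i)} (h0 : φ.toFun z i = 0)
    (hz : norm z + 2 = ∑ k, ℓ k / 2) : False := by
  have h1 := norm_le_of_apply_eq_zero h0
  rw [φ.norm_map] at h1
  omega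

-- The hyperplane `w p = 0` is far from both steps, and adding `a` leaves the far region. Transport
-- carries the vanishing `i`-th coordinate to the farthest point of the hyperplane, whose norm is `ℓ
-- p / 2 = 2` below the diameter.
include φ in
theorem not_both_of_straight (h6 : 6 ≤ ℓ i) {p : ι} {s : ZMod (ℓ p)} (hs : s = 1 ∨ s = -1)
    (hp : ℓ p = 4) (ha : a = Pi.single p s) (hb : b = Pi.single p (-s))
    (hφ : φ.toFun a = Pi.single i 1) : False := by
  have hN : 2 ≤ ℓ p := by omega
  have hs1 : cycleNorm s = 1 := by
    rcases hs with rfl | rfl <;> simp [cycleNorm_one hN]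
  have key := φ.transport_region h6 {w | w p = 0} 0 (c := a) (ha ▸ ⟨p, s, hs, rfl⟩) ?_ ?_ ?_
    (by rw [zero_add, φ.map_zero, zero_add, hφ]) (fun k => if k = p then 0 else ((ℓ k / 2 : ℕ) : _))
    (if_pos rfl)
  · refine φ.false_of_norm_eq h6 (key.2.trans (by rw [φ.map_zero]; rfl)) ?_
    rw [add_zero, norm, ← Finset.add_sum_erase _ _ (Finset.mem_univ p),
      ← Finset.add_sum_erase _ (fun k => ℓ k / 2) (Finset.mem_univ p), if_pos rfl, cycleNorm_zero,
      Finset.sum_congr rfl fun k hk => by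
        rw [if_neg (Finset.ne_of_mem_erase hk), cycleNorm_natCast le_rfl], hp]
    omega
  · intro w hw hw0
    obtain ⟨l, hl⟩ := Function.ne_iff.1 hw0
    obtain ⟨r, hr, h⟩ := exists_cycleNorm_add_lt (by linarith [h4 l]) (he l) hl
    have hlp : p ≠ l := by
      rintro rfl
      exact hl hw
    refine ⟨Pi.single l r, ⟨l, r, hr, rfl⟩, ?_, ?_⟩
    · change (w + _) p = 0
      rw [Pi.add_apply, Pi.single_eq_of_ne hlp, add_zero]
      exact hw
    · have := norm_add_single w l r
      omega
  · intro w hw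
    rw [ha, hb, far_single_iff, far_single_iff, add_zero, show w p = 0 from hw]
    simp [hs1]
  · intro w hw h
    rw [ha, far_single_iff, add_zero, Pi.add_apply, Pi.single_eq_same, show w p = 0 from hw] at h
    simp [hs1] at h

-- Two transports are chained. Along the multiples `-k a` before the antipode, the edge in direction
-- `b` shows that the image keeps `i`-th coordinate `0`. The step onto the antipode must then map to
-- `e_i`, and this new edge, in direction `-a`, is transported through the other coordinates to a
-- point two below the diameter.
include φ in
theorem not_both_of_perpendicular (h6 : 6 ≤ ℓ i) {p q : ι} (hpq : p ≠ q) {s : ZMod (ℓ p)}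
    {t : ZMod (ℓ q)} (hs : s = 1 ∨ s = -1) (ht : t = 1 ∨ t = -1) (ha : a = Pi.single p s)
    (hb : b = Pi.single q t) (hφa : φ.toFun a = Pi.single i 1)
    (hφb : φ.toFun b = Pi.single i 1) : False := by
  have ht1 : cycleNorm t = 1 := by
    rcases ht with rfl | rfl <;> simp [cycleNorm_one (N := ℓ q) (by linarith [h4 q])]
  have has : a ∈ steps ℓ := ha ▸ ⟨p, s, hs, rfl⟩
  have hbs : b ∈ steps ℓ := hb ▸ ⟨q, t, ht, rfl⟩
  have hp4 := h4 p
  -- `h` is the last multiple before the antipode, hence the last one that is still far from `a`.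
  obtain ⟨h, hh⟩ : ∃ h, ℓ p / 2 = h + 1 := ⟨ℓ p / 2 - 1, by omega⟩
  have hcn : ∀ k ≤ h + 1, cycleNorm (-((k : ZMod (ℓ p)) * s)) = k := fun k hk =>
    cycleNorm_natCast_mul_sign (by omega) hs
  have hsucc : ∀ k : ℕ, -((k : ZMod (ℓ p)) * s) - s = -(((k + 1 : ℕ) : ZMod (ℓ p)) * s) := by
    intro k
    push_cast
    ring
  -- transport along the multiples of `a`
  have key₁ := φ.transport_region h6
    {w | ∃ k : ℕ, k ≤ h ∧ w = Pi.single p (-((k : ZMod (ℓ p)) * s))} 0 hbs ?_ ?_ ?_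
    (by rw [zero_add, φ.map_zero, zero_add, hφb]) _ ⟨h, le_rfl, rfl⟩
  · replace key₁ := key₁.2
    rw [φ.map_zero, Pi.zero_apply, add_zero] at key₁
    set x₀ : ∀ i, ZMod (ℓ i) := Pi.single p (-((h : ZMod (ℓ p)) * s)) with hx₀
    have hX : x₀ + -a = Pi.single p (-(((h + 1 : ℕ) : ZMod (ℓ p)) * s)) := by
      rw [hx₀, ha, ← Pi.single_neg, ← Pi.single_add, ← sub_eq_add_neg, hsucc]
    -- the antipode of `0` in direction `p`
    have hstart : φ.toFun (x₀ + -a) = φ.toFun x₀ + Pi.single i 1 := by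
      have h1 : norm (φ.toFun (x₀ + -a)) = h + 1 := by
        -- The antipode has norm `h + 1` but distance only `h` from `a`, reached the other way
        -- round. So its image has norm `h + 1` and distance at most `h` from `e_i = φ a`.
        rw [φ.norm_map, hX, norm_single, hcn _ le_rfl]
      have h2 : norm (x₀ + -a - a) = h := by
        have hflip : ∀ k l : ℕ, k + l = ℓ p → (k : ZMod (ℓ p)) = -(l : ZMod (ℓ p)) := by
          intro k l hkl
          rw [eq_neg_iff_add_eq_zero, ← Nat.cast_add, hkl, natCast_self]
        rw [hX, ha, ← Pi.single_sub, norm_single, hsucc,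
          hflip (h + 1 + 1) h (by obtain ⟨m, hm⟩ := he p; omega), neg_mul, neg_neg,
          ← cycleNorm_neg, hcn _ (by omega)]
      have h3 : norm (φ.toFun (x₀ + -a) - Pi.single i 1) ≤ h := by
        rw [← hφa, ← h2]
        exact norm_sub_le_of_hom h4 he φ.map_step _ _
      have hg := φ.map_step x₀ (-a) (neg_mem_steps has)
      have h5 := norm_sub_single (φ.toFun (x₀ + -a)) i 1
      have h7 : φ.toFun (x₀ + -a) i = (φ.toFun (x₀ + -a) - φ.toFun x₀) i := by
        rw [Pi.sub_apply, key₁, sub_zero]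
      -- Subtracting `e_i` must decrease the norm of the image. Its `i`-th coordinate equals that of
      -- the step; if this is `0` or `-1`, the norm would grow.
      rcases step_apply_cases hg i with h8 | h8 | h8
      · rw [h7, h8] at h5
        simp only [cycleNorm_zero, zero_sub, cycleNorm_neg,
          cycleNorm_one (N := ℓ i) (by omega)] at h5
        omega
      · rw [← h8]
        abel
      · rw [h7, h8, Pi.single_eq_same, cycleNorm_neg, cycleNorm_one (by omega),
          show (-1 - 1 : ZMod (ℓ i)) = -((2 : ℕ) : ZMod (ℓ i)) by push_cast; ring, cycleNorm_neg,
          cycleNorm_natCast (by omega)] at h5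
        omega
    -- transport towards the farthest point
    have hR : ∀ w : ∀ i, ZMod (ℓ i), w p = 0 → (w + x₀) p = -((h : ZMod (ℓ p)) * s) ∧
        (w + x₀) q = w q := by
      intro w hw
      rw [Pi.add_apply, Pi.add_apply, hw, hx₀, Pi.single_eq_same, Pi.single_eq_of_ne hpq.symm]
      simp
    have hq4 := h4 q
    obtain ⟨g, hg⟩ : ∃ g, ℓ q / 2 = g + 1 := ⟨ℓ q / 2 - 1, by omega⟩
    have hcq : ∀ k ≤ g + 1, cycleNorm (-((k : ZMod (ℓ q)) * t)) = k := fun k hk =>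
      cycleNorm_natCast_mul_sign (by omega) ht
    -- Antipodal in all coordinates except `p` and `q`. In `q` it is one short of the antipode, as
    -- is `x₀` in `p`, so `w₀ + x₀` has norm two below the diameter.
    let w₀ : ∀ i, ZMod (ℓ i) := Function.update
      (fun k => if k = p then 0 else ((ℓ k / 2 : ℕ) : ZMod (ℓ k))) q (-((g : ZMod (ℓ q)) * t))
    have hw₀p : w₀ p = 0 := by
      simp only [w₀]
      rw [Function.update_of_ne hpq, if_pos rfl]
    have hw₀q : w₀ q = -((g : ZMod (ℓ q)) * t) := Function.update_self ..
    have key₂ := φ.transport_region h6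
      {w | w p = 0 ∧ cycleNorm (w q - t) = cycleNorm (w q) + 1} x₀ (neg_mem_steps has) ?_ ?_ ?_
      hstart w₀ ⟨hw₀p, ?_⟩
    · refine φ.false_of_norm_eq h6 (key₂.2.trans key₁) ?_
      have hsum : ∀ k, cycleNorm ((w₀ + x₀) k) + ((if k = p then 1 else 0) +
          if k = q then 1 else 0) = ℓ k / 2 := by
        intro k
        by_cases hkp : k = p
        · subst hkp
          rw [(hR w₀ hw₀p).1, if_pos rfl, if_neg hpq, hcn _ (by omega), hh]
        · by_cases hkq : k = q
          · subst hkq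
            rw [(hR w₀ hw₀p).2, hw₀q, if_neg hkp, if_pos rfl, hcq _ (by omega), hg]
          · rw [if_neg hkp, if_neg hkq, Pi.add_apply, hx₀, Pi.single_eq_of_ne hkp, add_zero,
              add_zero]
            simp only [w₀]
            rw [Function.update_of_ne hkq, if_neg hkp, cycleNorm_natCast le_rfl, add_zero]
      rw [← Finset.sum_congr rfl fun k _ => hsum k, Finset.sum_add_distrib,
        Finset.sum_add_distrib]
      simp [norm]
    · rintro w ⟨hw1, hw2⟩ hw0
      obtain ⟨y, hy, h1, h2, h3⟩ := exists_step_toward_zero h4 he ht hw1 hw2 hw0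
      exact ⟨y, hy, ⟨h1, h2⟩, h3⟩
    · rintro w ⟨hw1, hw2⟩
      rw [ha, hb, far_single_iff, far_single_iff, (hR w hw1).1, (hR w hw1).2, hsucc,
        hcn _ le_rfl, hcn _ (by omega)]
      exact ⟨rfl, hw2⟩
    · rintro w ⟨hw1, -⟩ ⟨h1, -⟩
      rw [ha, far_single_iff, Pi.add_apply, (hR w hw1).1, ← Pi.single_neg, Pi.single_eq_same,
        ← sub_eq_add_neg, hsucc, hcn _ le_rfl] at h1
      have := cycleNorm_le (-(((h + 1 : ℕ) : ZMod (ℓ p)) * s) - s)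
      omega
    · rw [hw₀q, hcq _ (by omega), show -((g : ZMod (ℓ q)) * t) - t =
        -(((g + 1 : ℕ) : ZMod (ℓ q)) * t) by push_cast; ring, hcq _ le_rfl]
  · rintro w ⟨k, hk, rfl⟩ hw
    rcases k with _ | k
    · simp at hw
    · refine ⟨Pi.single p s, ⟨p, s, hs, rfl⟩, ⟨k, by omega, ?_⟩, ?_⟩
      · rw [← Pi.single_add, ← hsucc, sub_add_cancel]
      · rw [← Pi.single_add, ← hsucc, sub_add_cancel, norm_single, hsucc, norm_single,
          hcn _ (by omega), hcn _ (by omega)]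
        omega
  · rintro w ⟨k, hk, rfl⟩
    rw [ha, hb, far_single_iff, far_single_iff, add_zero, Pi.single_eq_same,
      Pi.single_eq_of_ne hpq.symm, hsucc, hcn _ (by omega), hcn _ (by omega)]
    simp [ht1]
  · rintro w ⟨k, hk, rfl⟩ ⟨-, h1⟩
    rw [hb, far_single_iff, add_zero, Pi.add_apply, Pi.single_eq_of_ne hpq.symm, Pi.single_eq_same]
      at h1
    simp [ht1] at h1

end CornerHom

/-- A homomorphism that maps two distinct neighbours of `0` to unit vectors does not increase the
total distance to the corner `{0, e_i, e_j}`. -/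
theorem sum_tripleDist_map_le {i j : ι} (hij : i ≠ j) {φ : (∀ i, ZMod (ℓ i)) → ∀ i, ZMod (ℓ i)}
    (hφ : ∀ x, ∀ c ∈ steps ℓ, φ (x + c) - φ x ∈ steps ℓ) (h0 : φ 0 = 0)
    {a b : ∀ i, ZMod (ℓ i)} (ha : a ∈ steps ℓ) (hb : b ∈ steps ℓ) (hab : a ≠ b)
    (hφa : φ a = Pi.single i 1 ∨ φ a = Pi.single j 1)
    (hφb : φ b = Pi.single i 1 ∨ φ b = Pi.single j 1) :
    ∑ x, tripleDist (Pi.single i 1) (Pi.single j 1) (φ x) ≤ ∑ x, tripleDist a b x ∧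
    ∑ x, tripleDist a b x ≤
      ∑ x : ∀ i, ZMod (ℓ i), tripleDist (Pi.single i 1) (Pi.single j 1) x ∧
    ∀ x, tripleDist (Pi.single i 1) (Pi.single j 1) (φ x) ≤ tripleDist a b x := by
  have hpt : ∀ x, tripleDist (Pi.single i 1) (Pi.single j 1) (φ x) ≤ tripleDist a b x := by
    intro x
    have h1 := norm_sub_le_of_hom h4 he hφ x 0
    have h2 := norm_sub_le_of_hom h4 he hφ x a
    have h3 := norm_sub_le_of_hom h4 he hφ x b
    rw [h0, sub_zero, sub_zero] at h1
    unfold tripleDist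
    rcases hφa with h | h <;> rcases hφb with h' | h' <;> rw [h] at h2 <;> rw [h'] at h3 <;> omega
  exact ⟨Finset.sum_le_sum fun x _ => hpt x, sum_tripleDist_le h4 he hij ha hb hab, hpt⟩

/-- If the total distance is preserved, then the two neighbours are not both mapped to the unit
vector of a direction of length at least `6`. -/
theorem not_both_of_sum_tripleDist_eq {i j : ι} (hij : i ≠ j) (h6 : 6 ≤ ℓ i)
    {φ : (∀ i, ZMod (ℓ i)) → ∀ i, ZMod (ℓ i)}
    (hφ : ∀ x, ∀ c ∈ steps ℓ, φ (x + c) - φ x ∈ steps ℓ) (h0 : φ 0 = 0)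
    {a b : ∀ i, ZMod (ℓ i)} (ha : a ∈ steps ℓ) (hb : b ∈ steps ℓ) (hab : a ≠ b)
    (hφa : φ a = Pi.single i 1) (hφb : φ b = Pi.single i 1) :
    ∑ x, tripleDist (Pi.single i 1) (Pi.single j 1) (φ x) <
      ∑ x : ∀ i, ZMod (ℓ i), tripleDist (Pi.single i 1) (Pi.single j 1) x := by
  classical
  obtain ⟨h1, h2, hpt⟩ := sum_tripleDist_map_le h4 he hij hφ h0 ha hb hab (Or.inl hφa) (Or.inl hφb)
  refine lt_of_le_of_ne (h1.trans h2) fun heq => ?_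
  -- Equality of the sums turns the pointwise inequality `hpt` into equality at every point.
  have h12 := le_antisymm h1 (heq ▸ h2)
  have hpt' := (Finset.sum_eq_sum_iff_of_le fun x _ => hpt x).1 h12
  have hei : (Pi.single i 1 : ∀ i, ZMod (ℓ i)) ∈ steps ℓ := ⟨i, 1, Or.inl rfl, rfl⟩
  have hej : (Pi.single j 1 : ∀ i, ZMod (ℓ i)) ∈ steps ℓ := ⟨j, 1, Or.inl rfl, rfl⟩
  have hA := tripleDist_add_one h4 he ha hb
  have hB := tripleDist_add_one h4 he hei hej
  -- Equal corner distances allow the norms to differ by at most one, and parity excludes one.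
  have hnorm : ∀ x, norm (φ x) = norm x := by
    intro x
    have e1 := hA x
    have e2 := hB (φ x)
    have e3 := norm_mod_two_of_hom h4 he hφ h0 x
    have e4 := hpt' x (Finset.mem_univ x)
    split_ifs at e1 e2 <;> omega
  let Φ : CornerHom ℓ a b i j :=
    { toFun := φ
      map_step := hφ
      map_zero := h0
      norm_map := hnorm
      far_iff := fun x => by
        have e1 := hA x
        have e2 := hB (φ x)
        have e4 := hpt' x (Finset.mem_univ x)
        rw [e4, e1, hnorm x] at e2
        split_ifs at e2 with h h' h'
        · exact iff_of_true h' h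
        · omega
        · omega
        · exact iff_of_false h' h }
  rcases steps_cases ha hb hab with ⟨p, q, s, t, hpq, hs, ht, rfl, rfl⟩ | ⟨p, s, hs, hap, hbp⟩
  · exact Φ.not_both_of_perpendicular h4 he h6 hpq hs ht rfl rfl hφa hφb
  · exact Φ.not_both_of_straight h4 he h6 hs
      (four_mul_card_far_eq h4 he hij ha hb (h12 ▸ heq) hs hap hbp) hap hbp hφa

end Even

end Torus

/-! ### Kernels obtained by splitting the part of one vertex -/

namespace SimpleGraph

variable {V : Type*} [Fintype V] (H : SimpleGraph V)

-- Distributing each edge factor over its two ends turns a product over edges into one local at the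
-- vertices, where the choice of halves can be summed out.
open Classical in
theorem prod_edgeFinset_eq_prod_neighbor (F : V → V → ℝ) :
    ∏ e ∈ H.edgeFinset, Sym2.lift ⟨fun u v => F u v * F v u, fun _ _ => mul_comm _ _⟩ e =
      ∏ v, ∏ w ∈ H.neighborFinset v, F v w := by
  have h1 : ∏ v, ∏ w ∈ H.neighborFinset v, F v w =
      ∏ p ∈ Finset.univ.filter fun p : V × V => H.Adj p.1 p.2, F p.1 p.2 := by
    rw [Finset.prod_filter, Fintype.prod_prod_type]
    refine Finset.prod_congr rfl fun v _ => ?_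
    rw [← Finset.prod_filter]
    refine Finset.prod_congr ?_ fun _ _ => rfl
    ext w
    simp
  rw [h1, ← Finset.prod_fiberwise_of_maps_to (t := H.edgeFinset) (g := fun p : V × V => s(p.1, p.2))]
  · refine Finset.prod_congr rfl fun e he => ?_
    induction e with
    | _ u v =>
      have hadj : H.Adj u v := mem_edgeFinset.1 he
      have : Finset.filter (fun p : V × V => s(p.1, p.2) = s(u, v))
          (Finset.univ.filter fun p : V × V => H.Adj p.1 p.2) = {(u, v), (v, u)} := by
        ext ⟨a, b⟩
        simp only [Finset.mem_filter, Finset.mem_univ, true_and, Sym2.eq_iff, Finset.mem_insert,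
          Finset.mem_singleton, Prod.mk.injEq]
        constructor
        · exact fun h => h.2
        · rintro (⟨rfl, rfl⟩ | ⟨rfl, rfl⟩)
          · exact ⟨hadj, Or.inl ⟨rfl, rfl⟩⟩
          · exact ⟨hadj.symm, Or.inr ⟨rfl, rfl⟩⟩
      rw [this, Finset.prod_pair (fun h => hadj.ne (congrArg Prod.fst h))]
      rfl
  · intro p hp
    exact mem_edgeFinset.2 (Finset.mem_filter.1 hp).2

/-- The sign of a Boolean. -/
def boolSign (b : Bool) : ℝ := if b then 1 else -1

variable {A : Type*} (G : SimpleGraph A) (o : A) (p : A → ℕ)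

open Classical in
/-- The half of the splitting factor that belongs to the first vertex. -/
def splitFactor (f : A → ℝ) (b b' : A × Bool) : ℝ :=
  1 + boolSign b.2 * (if b.1 = o then 1 else 0) * f b'.1

open Classical in
/-- The matrix supported on the edges of `G`, with vertex weights `τ ^ p`, in which the vertex `o`
is split into two vertices whose weights to the vertex `u` are multiplied by `1 ± f u`. -/
def splitMatrix (τ : ℝ) (f : A → ℝ) (b b' : A × Bool) : ℝ :=
  (if G.Adj b.1 b'.1 then 1 / 2 else 0) *
    ((τ ^ p b.1 * splitFactor o f b b') * (τ ^ p b'.1 * splitFactor o f b' b))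

theorem splitMatrix_comm (τ : ℝ) (f : A → ℝ) (b b' : A × Bool) :
    splitMatrix G o p τ f b b' = splitMatrix G o p τ f b' b := by
  classical
  unfold splitMatrix
  rw [mul_comm (τ ^ p b.1 * _)]
  congr 1
  exact if_congr (G.adj_comm _ _) rfl rfl

/-- Because `f o = 0`, the two half-factors are never both different from one. Their product is thus
at most `2`, which the entry `1 / 2` of the matrix compensates. -/
theorem splitFactor_mul {f : A → ℝ} (hf : f o = 0) (b b' : A × Bool) :
    splitFactor o f b b' = 1 ∨ splitFactor o f b' b = 1 := by
  unfold splitFactor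
  by_cases h : b.1 = o
  · right
    simp [h, hf]
  · left
    simp [h]

theorem splitFactor_mem {f : A → ℝ} (hf : ∀ u, |f u| ≤ 1) (b b' : A × Bool) :
    splitFactor o f b b' ∈ Set.Icc (0 : ℝ) 2 := by
  unfold splitFactor
  have h := abs_le.1 (hf b'.1)
  have hs : boolSign b.2 = 1 ∨ boolSign b.2 = -1 := by
    rcases Bool.eq_false_or_eq_true b.2 with hb | hb <;> simp [boolSign, hb]
  rcases hs with hs | hs <;> rw [hs] <;> split_ifs <;> constructor <;> linarith

theorem splitMatrix_mem {τ : ℝ} (hτ0 : 0 ≤ τ) (hτ1 : τ ≤ 1) {f : A → ℝ} (hf : ∀ u, |f u| ≤ 1)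
    (hfo : f o = 0) (b b' : A × Bool) : splitMatrix G o p τ f b b' ∈ Set.Icc (0 : ℝ) 1 := by
  have h1 := splitFactor_mem o hf b b'
  have h2 := splitFactor_mem o hf b' b
  have h3 : splitFactor o f b b' * splitFactor o f b' b ≤ 2 := by
    rcases splitFactor_mul o hfo b b' with h | h <;> rw [h]
    · rw [one_mul]; exact h2.2
    · rw [mul_one]; exact h1.2
  have h4 : 0 ≤ splitFactor o f b b' * splitFactor o f b' b := mul_nonneg h1.1 h2.1
  have h5 : τ ^ p b.1 * τ ^ p b'.1 ≤ 1 :=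
    mul_le_one₀ (pow_le_one₀ hτ0 hτ1) (by positivity) (pow_le_one₀ hτ0 hτ1)
  have h6 : 0 ≤ τ ^ p b.1 * τ ^ p b'.1 := by positivity
  have h7 : (τ ^ p b.1 * splitFactor o f b b') * (τ ^ p b'.1 * splitFactor o f b' b) =
      (τ ^ p b.1 * τ ^ p b'.1) * (splitFactor o f b b' * splitFactor o f b' b) := by ring
  have h8 := mul_le_mul h5 h3 h4 zero_le_one
  have h9 := mul_nonneg h6 h4
  unfold splitMatrix
  rw [h7]
  split_ifs <;> constructor <;> linarith

/-- At most one half-factor involves `f`, so the matrix is affine in `f`. -/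
theorem splitMatrix_add_neg (τ : ℝ) {f : A → ℝ} (hfo : f o = 0) (b b' : A × Bool) :
    splitMatrix G o p τ f b b' + splitMatrix G o p τ (-f) b b' =
      2 * splitMatrix G o p τ 0 b b' := by
  unfold splitMatrix splitFactor
  by_cases h : b.1 = o <;> by_cases h' : b'.1 = o <;>
    simp only [h, h', hfo, if_true, if_false, Pi.neg_apply, Pi.zero_apply] <;> ring

/-- The signs of the two halves cancel independently in the two factors. -/
theorem sum_splitMatrix (τ : ℝ) (f : A → ℝ) (b b' : A × Bool) :
    ∑ s, ∑ s', splitMatrix G o p τ f (b.1, s) (b'.1, s') = 4 * splitMatrix G o p τ 0 b b' := by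
  simp only [splitMatrix, splitFactor, boolSign, Fintype.sum_bool, if_true, Bool.false_eq_true,
    if_false, Pi.zero_apply]
  ring

open Classical in
/-- The relative weight of a map `φ : V → A` after splitting. -/
def splitWeight (f : A → ℝ) (φ : V → A) : ℝ :=
  ∏ v, (1 / 2 * ∑ b, ∏ w ∈ H.neighborFinset v, splitFactor o f (φ v, b) (φ w, true))

-- Group the maps into `A × Bool` by their first components `φ`; only homomorphisms survive. The
-- factors at `v` see only the half chosen at `v`, so the sum over the halves is a product over
-- vertices, and regularity collects the powers of `τ`.
open Classical in
theorem partitionFunction_splitMatrix [Fintype A] {d : ℕ} (hd : ∀ v, (H.neighborFinset v).card = d)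
    (τ : ℝ) (f : A → ℝ) :
    H.partitionFunction (splitMatrix G o p τ f) (splitMatrix_comm G o p τ f) =
      (1 / 2) ^ H.edgeFinset.card * 2 ^ Fintype.card V *
        ∑ φ : V → A with (∀ u v, H.Adj u v → G.Adj (φ u) (φ v)),
          τ ^ (d * ∑ v, p (φ v)) * H.splitWeight o f φ := by
  have hprod : ∀ ψ : V → A × Bool,
      ∏ e ∈ H.edgeFinset,
        Sym2.lift ⟨splitMatrix G o p τ f, splitMatrix_comm G o p τ f⟩ (e.map ψ) =
      if ∀ u v, H.Adj u v → G.Adj (ψ u).1 (ψ v).1 then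
        (1 / 2) ^ H.edgeFinset.card * (τ ^ (d * ∑ v, p (ψ v).1) *
          ∏ v, ∏ w ∈ H.neighborFinset v, splitFactor o f (ψ v) (ψ w)) else 0 := by
    intro ψ
    split_ifs with h
    · have h1 : ∀ e ∈ H.edgeFinset,
          Sym2.lift ⟨splitMatrix G o p τ f, splitMatrix_comm G o p τ f⟩ (e.map ψ) =
          1 / 2 * Sym2.lift ⟨fun u v => (τ ^ p (ψ u).1 * splitFactor o f (ψ u) (ψ v)) *
            (τ ^ p (ψ v).1 * splitFactor o f (ψ v) (ψ u)), fun _ _ => mul_comm _ _⟩ e := by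
        intro e he
        induction e with
        | _ u v =>
          change splitMatrix G o p τ f (ψ u) (ψ v) = _
          rw [splitMatrix, if_pos (h u v (mem_edgeFinset.1 he))]
          rfl
      rw [Finset.prod_congr rfl h1, Finset.prod_mul_distrib, Finset.prod_const,
        H.prod_edgeFinset_eq_prod_neighbor fun u v => τ ^ p (ψ u).1 * splitFactor o f (ψ u) (ψ v)]
      congr 1
      simp only [Finset.prod_mul_distrib, Finset.prod_const, hd]
      congr 1
      rw [Finset.mul_sum, ← Finset.prod_pow_eq_pow_sum]
      exact Finset.prod_congr rfl fun v _ => by rw [← pow_mul, mul_comm]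
    · push Not at h
      obtain ⟨u, v, huv, hG⟩ := h
      refine Finset.prod_eq_zero (i := s(u, v)) (mem_edgeFinset.2 huv) ?_
      change splitMatrix G o p τ f (ψ u) (ψ v) = 0
      rw [splitMatrix, if_neg hG, zero_mul]
  have hsum : ∀ φ : V → A, ∑ g : V → Bool, ∏ v, ∏ w ∈ H.neighborFinset v,
      splitFactor o f (φ v, g v) (φ w, g w) = 2 ^ Fintype.card V * H.splitWeight o f φ := by
    intro φ
    -- `splitFactor` ignores the Boolean of its second argument, so `g w` may be replaced by `true`.
    have h1 : ∀ g : V → Bool, ∏ v, ∏ w ∈ H.neighborFinset v,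
        splitFactor o f (φ v, g v) (φ w, g w) = ∏ v, ∏ w ∈ H.neighborFinset v,
        splitFactor o f (φ v, g v) (φ w, true) := fun _ => rfl
    simp only [h1]
    rw [splitWeight, Finset.prod_mul_distrib, Finset.prod_const, Finset.card_univ, ← mul_assoc,
      ← mul_pow, mul_one_div_cancel two_ne_zero, one_pow, one_mul, Finset.prod_univ_sum,
      Fintype.piFinset_univ]
  unfold partitionFunction
  simp only [hprod]
  rw [← (Equiv.arrowProdEquivProdArrow V (fun _ => A) fun _ => Bool).symm.sum_comp,
    Fintype.sum_prod_type, Finset.mul_sum, Finset.sum_filter]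
  refine Finset.sum_congr rfl fun φ _ => ?_
  by_cases h : ∀ u v, H.Adj u v → G.Adj (φ u) (φ v)
  · rw [if_pos h]
    refine Eq.trans (b := ∑ g : V → Bool, (1 / 2) ^ H.edgeFinset.card * (τ ^ (d * ∑ v, p (φ v)) *
      ∏ v, ∏ w ∈ H.neighborFinset v, splitFactor o f (φ v, g v) (φ w, g w)))
      (Finset.sum_congr rfl fun g _ => if_pos h) ?_
    rw [← Finset.mul_sum, ← Finset.mul_sum, hsum]
    ring
  · rw [if_neg h]
    exact Finset.sum_eq_zero fun g _ => if_neg h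

theorem splitWeight_zero (φ : V → A) : H.splitWeight o 0 φ = 1 := by
  classical
  simp [splitWeight, splitFactor]

theorem splitWeight_neg (f : A → ℝ) (φ : V → A) :
    H.splitWeight o (-f) φ = H.splitWeight o f φ := by
  classical
  simp only [splitWeight, splitFactor, Fintype.sum_bool, boolSign, if_true, Bool.false_eq_true,
    if_false, Pi.neg_apply]
  refine Finset.prod_congr rfl fun v _ => ?_
  rw [add_comm]
  simp only [mul_neg, neg_mul, neg_neg, one_mul]

omit [Fintype V] in
theorem vertex_splitWeight_of_ne {f : A → ℝ} {φ : V → A} {v : V} (hv : φ v ≠ o) (s : Finset V) :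
    1 / 2 * ∑ b, ∏ w ∈ s, splitFactor o f (φ v, b) (φ w, true) = 1 := by
  simp [splitFactor, hv]

omit [Fintype V] in
theorem vertex_splitWeight_of_eq {f : A → ℝ} {φ : V → A} {v : V} (hv : φ v = o) (s : Finset V) :
    1 / 2 * ∑ b, ∏ w ∈ s, splitFactor o f (φ v, b) (φ w, true) =
      1 / 2 * (∏ w ∈ s, (1 + f (φ w)) + ∏ w ∈ s, (1 - f (φ w))) := by
  simp [splitFactor, hv, boolSign, sub_eq_add_neg]

/-- If each vertex over `o` has at most one neighbour mapped into the support of `f`, its factor is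
the average of `1 + x` and `1 - x`, which is `1`. -/
theorem exists_of_splitWeight_ne_one {f : A → ℝ} {φ : V → A} (h : H.splitWeight o f φ ≠ 1) :
    ∃ v, φ v = o ∧ ∃ w₁ w₂, H.Adj v w₁ ∧ H.Adj v w₂ ∧ w₁ ≠ w₂ ∧ f (φ w₁) ≠ 0 ∧ f (φ w₂) ≠ 0 := by
  classical
  by_contra! hcon
  refine h (Finset.prod_eq_one fun v _ => ?_)
  by_cases hv : φ v = o
  · rw [vertex_splitWeight_of_eq o hv]
    by_cases hex : ∃ w, H.Adj v w ∧ f (φ w) ≠ 0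
    · obtain ⟨w, hw, hf⟩ := hex
      have h0 : ∀ w' ∈ H.neighborFinset v, w' ≠ w → f (φ w') = 0 := fun w' hw' hne =>
        hcon v hv w w' hw ((mem_neighborFinset _ _ _).1 hw') hne.symm hf
      rw [Finset.prod_eq_single w (fun w' hw' hne => by rw [h0 w' hw' hne, add_zero])
          fun hn => absurd ((mem_neighborFinset _ _ _).2 hw) hn,
        Finset.prod_eq_single w (fun w' hw' hne => by rw [h0 w' hw' hne, sub_zero])
          fun hn => absurd ((mem_neighborFinset _ _ _).2 hw) hn]
      ring
    · push Not at hex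
      rw [Finset.prod_eq_one fun w hw => by
          rw [hex w ((mem_neighborFinset _ _ _).1 hw), add_zero],
        Finset.prod_eq_one fun w hw => by
          rw [hex w ((mem_neighborFinset _ _ _).1 hw), sub_zero]]
      norm_num
  · exact vertex_splitWeight_of_ne o hv _

/-- The only nontrivial factor is `((1 + x)(1 + y) + (1 - x)(1 - y)) / 2 = 1 + x y`. -/
theorem splitWeight_of_unique {f : A → ℝ} {φ : V → A} {v w₁ w₂ : V} (hv : φ v = o)
    (huniq : ∀ v', φ v' = o → v' = v) (h₁ : H.Adj v w₁) (h₂ : H.Adj v w₂) (hne : w₁ ≠ w₂)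
    (h0 : ∀ w, H.Adj v w → f (φ w) ≠ 0 → w = w₁ ∨ w = w₂) :
    H.splitWeight o f φ = 1 + f (φ w₁) * f (φ w₂) := by
  classical
  unfold splitWeight
  rw [Finset.prod_eq_single v (fun v' _ hv' => vertex_splitWeight_of_ne o (mt (huniq v') hv') _)
    fun hn => absurd (Finset.mem_univ _) hn, vertex_splitWeight_of_eq o hv]
  have hsub : ({w₁, w₂} : Finset V) ⊆ H.neighborFinset v := by
    intro w hw
    rw [Finset.mem_insert, Finset.mem_singleton] at hw
    rcases hw with rfl | rfl <;> rwa [mem_neighborFinset]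
  have hz : ∀ w ∈ H.neighborFinset v, w ∉ ({w₁, w₂} : Finset V) → f (φ w) = 0 := by
    intro w hw hw'
    by_contra hf
    refine hw' ?_
    rw [Finset.mem_insert, Finset.mem_singleton]
    exact h0 w ((mem_neighborFinset _ _ _).1 hw) hf
  rw [← Finset.prod_subset hsub fun w hw hw' => by rw [hz w hw hw', add_zero],
    ← Finset.prod_subset hsub fun w hw hw' => by rw [hz w hw hw', sub_zero],
    Finset.prod_pair hne, Finset.prod_pair hne]
  ring

end SimpleGraph

/-- After division by `τ ^ e` the sum is continuous in `τ`, and at `τ = 0` only the terms of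
exponent `e` remain. -/
theorem exists_sum_pow_neg {S : Type*} (s : Finset S) (E : S → ℕ) (κ : S → ℝ) (e : ℕ)
    (hE : ∀ φ ∈ s, κ φ ≠ 0 → e ≤ E φ) (hneg : ∑ φ ∈ s with E φ = e, κ φ < 0) :
    ∃ τ : ℝ, 0 < τ ∧ τ ≤ 1 ∧ ∑ φ ∈ s, τ ^ E φ * κ φ < 0 := by
  classical
  let g : ℝ → ℝ := fun τ => ∑ φ ∈ s, τ ^ (E φ - e) * κ φ
  have hg : Continuous g := by fun_prop
  have hg0 : g 0 < 0 := by
    refine lt_of_eq_of_lt ?_ hneg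
    rw [Finset.sum_filter]
    refine Finset.sum_congr rfl fun φ hφ => ?_
    by_cases hκ : κ φ = 0
    · simp [hκ]
    · have := hE φ hφ hκ
      split_ifs with h
      · simp [h]
      · rw [zero_pow (by omega), zero_mul]
  have hev : ∀ᶠ τ in nhdsWithin 0 (Set.Ioi (0 : ℝ)), g τ < 0 :=
    ((hg.tendsto 0).eventually (gt_mem_nhds hg0)).filter_mono nhdsWithin_le_nhds
  have hev' : ∀ᶠ τ in nhdsWithin 0 (Set.Ioi (0 : ℝ)), τ ∈ Set.Ioc (0 : ℝ) 1 :=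
    Ioc_mem_nhdsGT one_pos
  obtain ⟨τ, hτ, hτ0, hτ1⟩ := (hev.and hev').exists
  refine ⟨τ, hτ0, hτ1, ?_⟩
  have : ∑ φ ∈ s, τ ^ E φ * κ φ = τ ^ e * g τ := by
    rw [Finset.mul_sum]
    refine Finset.sum_congr rfl fun φ hφ => ?_
    by_cases hκ : κ φ = 0
    · simp [hκ]
    · rw [← mul_assoc, ← pow_add, Nat.add_sub_cancel' (hE φ hφ hκ)]
  rw [this]
  exact mul_neg_of_pos_of_neg (pow_pos hτ0 _) hτ

namespace SimpleGraph

variable {V : Type*} [Fintype V] {H : SimpleGraph V}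

open Classical in
/-- If splitting the vertex `o` decreases the leading term of the partition function, then `H` is
neither step Sidorenko nor weakly norming. -/
theorem not_stepSidorenko_and_not_isWeaklyNorming {A : Type*} [Fintype A] {G : SimpleGraph A}
    {o : A} {p : A → ℕ} {d : ℕ} (hd : ∀ v, (H.neighborFinset v).card = d)
    (hne : H.edgeSet.Nonempty) {f : A → ℝ} (hf : ∀ u, |f u| ≤ 1) (hfo : f o = 0) (e : ℕ)
    (hE : ∀ φ : V → A, (∀ u v, H.Adj u v → G.Adj (φ u) (φ v)) → H.splitWeight o f φ ≠ 1 →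
      e ≤ d * ∑ v, p (φ v))
    (hneg : ∑ φ ∈ (Finset.univ.filter fun φ : V → A => ∀ u v, H.Adj u v → G.Adj (φ u) (φ v)) with
      d * ∑ v, p (φ v) = e, (H.splitWeight o f φ - 1) < 0) :
    ¬ H.StepSidorenko ∧ ¬ H.IsWeaklyNorming := by
  obtain ⟨τ, hτ0, hτ1, hlt⟩ := exists_sum_pow_neg
    (Finset.univ.filter fun φ : V → A => ∀ u v, H.Adj u v → G.Adj (φ u) (φ v))
    (fun φ => d * ∑ v, p (φ v)) (fun φ => H.splitWeight o f φ - 1) e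
    (fun φ hφ h => hE φ (Finset.mem_filter.1 hφ).2 (sub_ne_zero.1 h)) hneg
  have hA : Nonempty A := ⟨o⟩
  have hZ : H.partitionFunction (splitMatrix G o p τ f) (splitMatrix_comm G o p τ f) <
      H.partitionFunction (splitMatrix G o p τ 0) (splitMatrix_comm G o p τ 0) := by
    rw [H.partitionFunction_splitMatrix G o p hd, H.partitionFunction_splitMatrix G o p hd]
    refine mul_lt_mul_of_pos_left ?_ (by positivity)
    rw [← sub_neg, ← Finset.sum_sub_distrib]
    simp only [splitWeight_zero]
    simpa only [mul_sub] using hlt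
  have hmem := fun (f : A → ℝ) (hf : ∀ u : A, |f u| ≤ 1) (hfo : f o = 0) =>
    splitMatrix_mem G o p hτ0.le hτ1 hf hfo
  constructor
  · intro h
    exact absurd (h.partitionFunction_le (splitMatrix_comm G o p τ f) (splitMatrix_comm G o p τ 0)
      (hmem f hf hfo) (sum_splitMatrix G o p τ f)) (not_le.2 hZ)
  · intro h
    refine absurd (h.partitionFunction_le hne (splitMatrix_comm G o p τ f)
      (splitMatrix_comm G o p τ (-f)) (splitMatrix_comm G o p τ 0) (hmem f hf hfo)
      (hmem (-f) (by simpa using hf) (by simp [hfo])) (splitMatrix_add_neg G o p τ hfo) ?_)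
      (not_le.2 hZ)
    rw [H.partitionFunction_splitMatrix G o p hd, H.partitionFunction_splitMatrix G o p hd]
    simp only [splitWeight_neg]

end SimpleGraph

/-! ### Toroidal grids with a long even cycle -/

section Potential

variable {V : Type*} [Fintype V] [DecidableEq V] (T : V → ℕ) (s : Finset V)

/-- Vertex weights that are decreasing in `T` outside the set `s` and dominant on `s`. -/
def potential (u : V) : ℕ :=
  (∑ x, T x - T u) + if u ∈ s then Fintype.card V * ∑ x, T x + 1 else 0

theorem sum_potential (φ : V → V) :
    ∑ v, potential T s (φ v) + ∑ v, T (φ v) = Fintype.card V * ∑ x, T x +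
      (Fintype.card V * ∑ x, T x + 1) * (Finset.univ.filter fun v => φ v ∈ s).card := by
  have h : ∀ v, potential T s (φ v) + T (φ v) =
      ∑ x, T x + if φ v ∈ s then Fintype.card V * ∑ x, T x + 1 else 0 := by
    intro v
    have := Finset.single_le_sum (f := T) (fun x _ => Nat.zero_le _) (Finset.mem_univ (φ v))
    unfold potential
    omega
  rw [← Finset.sum_add_distrib, Finset.sum_congr rfl fun v _ => h v, Finset.sum_add_distrib,
    Finset.sum_const, Finset.card_univ, smul_eq_mul, ← Finset.sum_filter, Finset.sum_const,
    smul_eq_mul, mul_comm (Finset.card _)]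

/-- The weight on `s` exceeds any possible total of `T`, so one additional vertex mapped into `s`
outweighs every gain in `T`. The number of hits decides first, and `∑ T` breaks ties. -/
theorem sum_potential_le {φ : V → V} (hs : s.card ≤ (Finset.univ.filter fun v => φ v ∈ s).card)
    (hT : (Finset.univ.filter fun v => φ v ∈ s).card = s.card → ∑ v, T (φ v) ≤ ∑ v, T v) :
    ∑ v, potential T s v ≤ ∑ v, potential T s (φ v) ∧
      (∑ v, potential T s (φ v) = ∑ v, potential T s v →
        (Finset.univ.filter fun v => φ v ∈ s).card = s.card ∧ ∑ v, T (φ v) = ∑ v, T v) := by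
  have h1 := sum_potential T s fun v => v
  have h2 := sum_potential T s φ
  rw [Finset.filter_univ_mem] at h1
  rcases hs.eq_or_lt with h | h
  · rw [← h] at h2
    have := hT h.symm
    exact ⟨by omega, fun _ => ⟨h.symm, by omega⟩⟩
  · have h3 := Nat.mul_le_mul_left (Fintype.card V * ∑ x, T x + 1) (Nat.succ_le_of_lt h)
    have h4 : ∑ v, T (φ v) ≤ Fintype.card V * ∑ x, T x := by
      rw [← smul_eq_mul, ← Finset.card_univ, ← Finset.sum_const]
      exact Finset.sum_le_sum fun v _ =>
        Finset.single_le_sum (f := T) (fun x _ => Nat.zero_le _) (Finset.mem_univ (φ v))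
    rw [Nat.succ_eq_add_one, mul_add_one] at h3
    exact ⟨by omega, fun _ => by omega⟩

end Potential

/-- With `η = 1 / (2 N)` the sum is at most `-η + N η² = -η / 2`. -/
theorem sum_neg_of_le_sq {S : Type*} [DecidableEq S] {s : Finset S} {g : S → ℝ} {N : ℕ}
    (hN : 0 < N) (hs : s.card ≤ N) {x : S} (hx : x ∈ s) (hgx : g x = -(1 / (2 * N)))
    (hg : ∀ y ∈ s, g y ≤ (1 / (2 * N)) ^ 2) : ∑ y ∈ s, g y < 0 := by
  rw [← Finset.add_sum_erase _ _ hx, hgx]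
  have h1 := Finset.sum_le_card_nsmul (s.erase x) g _ fun y hy => hg y (Finset.mem_of_mem_erase hy)
  have h2 : ((s.erase x).card : ℝ) ≤ N := by
    exact_mod_cast (Finset.card_le_card (Finset.erase_subset _ _)).trans hs
  have hN' : (0 : ℝ) < N := by exact_mod_cast hN
  rw [nsmul_eq_mul] at h1
  have h3 := mul_le_mul_of_nonneg_right h2 (sq_nonneg (1 / (2 * (N : ℝ))))
  have h4 : (N : ℝ) * (1 / (2 * N)) ^ 2 = (1 / (2 * N)) / 2 := by
    field_simp
  have h5 : 0 < 1 / (2 * (N : ℝ)) := by positivity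
  linarith

/-! ### The torus graph and the failure of both properties on long even grids -/

namespace Torus

variable {ι : Type*} [DecidableEq ι] {ℓ : ι → ℕ}

/-- The toroidal grid as a Cayley graph. -/
def graph (ℓ : ι → ℕ) : SimpleGraph (∀ i, ZMod (ℓ i)) where
  Adj x y := x ≠ y ∧ y - x ∈ steps ℓ
  symm := ⟨fun x y h => ⟨h.1.symm, by simpa using neg_mem_steps h.2⟩⟩
  loopless := ⟨fun _ h => h.1 rfl⟩

theorem ne_zero_of_mem_steps (h2 : ∀ i, 2 ≤ ℓ i) {c : ∀ i, ZMod (ℓ i)} (hc : c ∈ steps ℓ) :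
    c ≠ 0 := by
  obtain ⟨i, s, hs, rfl⟩ := hc
  have : Fact (1 < ℓ i) := ⟨h2 i⟩
  rw [Ne, Pi.single_eq_zero_iff]
  rcases hs with rfl | rfl <;> simp

theorem graph_adj (h2 : ∀ i, 2 ≤ ℓ i) {x y : ∀ i, ZMod (ℓ i)} :
    (graph ℓ).Adj x y ↔ y - x ∈ steps ℓ :=
  ⟨fun h => h.2, fun h => ⟨fun hxy => ne_zero_of_mem_steps h2 h (by rw [hxy, sub_self]), h⟩⟩

theorem graph_adj_add (h2 : ∀ i, 2 ≤ ℓ i) {x c : ∀ i, ZMod (ℓ i)} :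
    (graph ℓ).Adj x (x + c) ↔ c ∈ steps ℓ := by
  rw [graph_adj h2, add_sub_cancel_left]

variable [Fintype ι] [∀ i, NeZero (ℓ i)]

open Classical in
theorem card_neighborFinset_graph (h2 : ∀ i, 2 ≤ ℓ i) (x : ∀ i, ZMod (ℓ i)) :
    ((graph ℓ).neighborFinset x).card = (Finset.univ.filter fun c => c ∈ steps ℓ).card := by
  have : (graph ℓ).neighborFinset x =
      (Finset.univ.filter fun c => c ∈ steps ℓ).map (Equiv.addLeft x).toEmbedding := by
    ext y
    simp only [SimpleGraph.mem_neighborFinset, graph_adj h2, Finset.mem_map, Finset.mem_filter,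
      Finset.mem_univ, true_and, Equiv.coe_toEmbedding, Equiv.coe_addLeft]
    constructor
    · exact fun h => ⟨y - x, h, by abel⟩
    · rintro ⟨c, hc, rfl⟩
      rwa [add_sub_cancel_left]
  rw [this, Finset.card_map]

section Even

variable (h4 : ∀ i, 4 ≤ ℓ i) (he : ∀ i, Even (ℓ i))
include h4 he

/-- Translating the source by `v` reduces to homomorphisms fixing `0`, for which the rigidity
results are stated. -/
theorem corner_optimal {i j : ι} (hij : i ≠ j) (h6 : 6 ≤ ℓ i)
    {φ : (∀ i, ZMod (ℓ i)) → ∀ i, ZMod (ℓ i)}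
    (hφ : ∀ u v, (graph ℓ).Adj u v → (graph ℓ).Adj (φ u) (φ v)) {v w₁ w₂ : ∀ i, ZMod (ℓ i)}
    (hv : φ v = 0) (h₁ : (graph ℓ).Adj v w₁) (h₂ : (graph ℓ).Adj v w₂) (hne : w₁ ≠ w₂)
    (hw₁ : φ w₁ = Pi.single i 1 ∨ φ w₁ = Pi.single j 1)
    (hw₂ : φ w₂ = Pi.single i 1 ∨ φ w₂ = Pi.single j 1) :
    ∑ x, tripleDist (Pi.single i 1) (Pi.single j 1) (φ x) ≤
      ∑ x : ∀ i, ZMod (ℓ i), tripleDist (Pi.single i 1) (Pi.single j 1) x ∧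
    (∑ x, tripleDist (Pi.single i 1) (Pi.single j 1) (φ x) =
      ∑ x : ∀ i, ZMod (ℓ i), tripleDist (Pi.single i 1) (Pi.single j 1) x →
      ¬ (φ w₁ = Pi.single i 1 ∧ φ w₂ = Pi.single i 1)) := by
  have h2 : ∀ i, 2 ≤ ℓ i := fun i => by linarith [h4 i]
  have hψ : ∀ x, ∀ c ∈ steps ℓ, φ (v + (x + c)) - φ (v + x) ∈ steps ℓ := fun x c hc => by
    rw [← graph_adj h2, ← add_assoc]
    exact hφ _ _ ((graph_adj_add h2).2 hc)
  have hψ0 : φ (v + 0) = 0 := by rw [add_zero, hv]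
  have e₁ : φ (v + (w₁ - v)) = φ w₁ := by rw [add_sub_cancel]
  have e₂ : φ (v + (w₂ - v)) = φ w₂ := by rw [add_sub_cancel]
  have hsum := Equiv.sum_comp (Equiv.addLeft v)
    fun x => tripleDist (Pi.single i 1) (Pi.single j 1) (φ x)
  simp only [Equiv.coe_addLeft] at hsum
  rw [← hsum]
  have ha := (graph_adj h2).1 h₁
  have hb := (graph_adj h2).1 h₂
  have hab : w₁ - v ≠ w₂ - v := fun h => hne (sub_left_injective h)
  rw [← e₁] at hw₁
  rw [← e₂] at hw₂
  rw [← e₁, ← e₂]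
  refine ⟨?_, ?_⟩
  · obtain ⟨h5, h7, -⟩ := sum_tripleDist_map_le h4 he hij (φ := fun x => φ (v + x)) hψ hψ0 ha hb hab
      hw₁ hw₂
    exact h5.trans h7
  · exact fun heq h => (not_both_of_sum_tripleDist_eq h4 he hij h6 (φ := fun x => φ (v + x)) hψ hψ0
      ha hb hab h.1 h.2).ne heq

/-- A toroidal grid of even side lengths, one of which is at least `6`, is neither step Sidorenko
nor weakly norming. -/
theorem not_stepSidorenko_and_not_isWeaklyNorming {i j : ι} (hij : i ≠ j) (h6 : 6 ≤ ℓ i) :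
    ¬ (graph ℓ).StepSidorenko ∧ ¬ (graph ℓ).IsWeaklyNorming := by
  classical
  have h2 : ∀ i, 2 ≤ ℓ i := fun i => by linarith [h4 i]
  let N : ℕ := Nat.card ((∀ i, ZMod (ℓ i)) → ∀ i, ZMod (ℓ i))
  have hN : 0 < N := Nat.card_pos
  have hN' : (0 : ℝ) < N := by exact_mod_cast hN
  let a : ∀ i, ZMod (ℓ i) := Pi.single i 1
  let b : ∀ i, ZMod (ℓ i) := Pi.single j 1
  have ha : a ∈ steps ℓ := ⟨i, 1, Or.inl rfl, rfl⟩
  have hb : b ∈ steps ℓ := ⟨j, 1, Or.inl rfl, rfl⟩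
  have ha0 : a ≠ 0 := ne_zero_of_mem_steps h2 ha
  have hb0 : b ≠ 0 := ne_zero_of_mem_steps h2 hb
  have hab : a ≠ b := by
    intro h
    have h' := congrFun h i
    have : Fact (1 < ℓ i) := ⟨h2 i⟩
    simp [a, b, Pi.single_eq_of_ne hij] at h'
  -- `N` bounds the number of homomorphisms, so contributions of at most `η ^ 2` cannot offset the
  -- `-η` of the identity.
  let η : ℝ := 1 / (2 * N)
  have hη : 0 < η := by positivity
  have hη1 : η ≤ 1 := by
    have : (1 : ℝ) ≤ N := by exact_mod_cast hN
    rw [div_le_one (by positivity)]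
    linarith
  let f : (∀ i, ZMod (ℓ i)) → ℝ := fun u => if u = a then 1 else if u = b then -η else 0
  have hfa : f a = 1 := if_pos rfl
  have hfb : f b = -η := by simp [f, hab.symm]
  have hf0 : ∀ u, f u ≠ 0 → u = a ∨ u = b := by
    intro u hu
    by_contra! h
    exact hu (by simp [f, h.1, h.2])
  have hf1 : ∀ u, |f u| ≤ 1 := by
    intro u
    simp only [f]
    split_ifs
    · simp
    · rwa [abs_neg, abs_of_pos hη]
    · simp
  have hfo : f 0 = 0 := by simp [f, ha0.symm, hb0.symm]
  let s : Finset (∀ i, ZMod (ℓ i)) := {0, a, b}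
  have hs : s.card = 3 := Finset.card_eq_three.2 ⟨0, a, b, ha0.symm, hb0.symm, hab, rfl⟩
  let p := potential (tripleDist a b) s
  let d := (Finset.univ.filter fun c => c ∈ steps ℓ).card
  have hd0 : 0 < d := Finset.card_pos.2 ⟨a, Finset.mem_filter.2 ⟨Finset.mem_univ _, ha⟩⟩
  have main : ∀ φ : (∀ i, ZMod (ℓ i)) → ∀ i, ZMod (ℓ i),
      (∀ u v, (graph ℓ).Adj u v → (graph ℓ).Adj (φ u) (φ v)) →
      (graph ℓ).splitWeight 0 f φ ≠ 1 → ∑ v, p v ≤ ∑ v, p (φ v) ∧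
        (∑ v, p (φ v) = ∑ v, p v → (graph ℓ).splitWeight 0 f φ - 1 ≤ η ^ 2) := by
    intro φ hφ hK
    obtain ⟨v, hv, w₁, w₂, h₁, h₂, hne, hf₁, hf₂⟩ := SimpleGraph.exists_of_splitWeight_ne_one _ _ hK
    have hw₁ := hf0 _ hf₁
    have hw₂ := hf0 _ hf₂
    have hopt := corner_optimal h4 he hij h6 hφ hv h₁ h₂ hne hw₁ hw₂
    -- These three distinct vertices map into `s`, so `φ` hits `s` at least as often as the identity
    -- does. If the potentials agree, they are the only vertices mapped into `s`.
    have hsub : ({v, w₁, w₂} : Finset (∀ i, ZMod (ℓ i))) ⊆ Finset.univ.filter fun v => φ v ∈ s := by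
      intro w hw
      rw [Finset.mem_insert, Finset.mem_insert, Finset.mem_singleton] at hw
      rw [Finset.mem_filter, Finset.mem_insert, Finset.mem_insert, Finset.mem_singleton]
      refine ⟨Finset.mem_univ _, ?_⟩
      rcases hw with rfl | rfl | rfl
      · exact Or.inl hv
      · exact Or.inr hw₁
      · exact Or.inr hw₂
    have hcard : ({v, w₁, w₂} : Finset (∀ i, ZMod (ℓ i))).card = 3 :=
      Finset.card_eq_three.2 ⟨v, w₁, w₂, h₁.ne, h₂.ne, hne, rfl⟩
    obtain ⟨hle, heq⟩ := sum_potential_le (tripleDist a b) s (φ := φ)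
      (by rw [hs, ← hcard]; exact Finset.card_le_card hsub) fun _ => hopt.1
    refine ⟨hle, fun h => ?_⟩
    obtain ⟨hc, hT⟩ := heq h
    have hset := Finset.eq_of_subset_of_card_le hsub (by rw [hc, hs, hcard])
    have hspec : ∀ w, φ w = 0 ∨ φ w = a ∨ φ w = b → w = v ∨ w = w₁ ∨ w = w₂ := by
      intro w hw
      have : w ∈ ({v, w₁, w₂} : Finset (∀ i, ZMod (ℓ i))) := by
        rw [hset, Finset.mem_filter, Finset.mem_insert, Finset.mem_insert, Finset.mem_singleton]
        exact ⟨Finset.mem_univ _, hw⟩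
      simpa using this
    rw [SimpleGraph.splitWeight_of_unique _ _ hv ?_ h₁ h₂ hne ?_, add_sub_cancel_left]
    · have hnot := hopt.2 hT
      rcases hw₁ with e₁ | e₁ <;> rcases hw₂ with e₂ | e₂
      · exact absurd ⟨e₁, e₂⟩ hnot
      · rw [e₁, e₂, hfa, hfb]; nlinarith
      · rw [e₁, e₂, hfa, hfb]; nlinarith
      · rw [e₁, e₂, hfb]; nlinarith
    · intro v' hv'
      rcases hspec v' (Or.inl hv') with h | rfl | rfl
      · exact h
      · exact absurd (hv' ▸ hf₁) (not_not.2 hfo)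
      · exact absurd (hv' ▸ hf₂) (not_not.2 hfo)
    · intro w hw hfw
      rcases hspec w (Or.inr (hf0 _ hfw)) with rfl | h
      · exact absurd rfl hw.ne
      · exact h
  have hadj0 : ∀ {c : ∀ i, ZMod (ℓ i)}, c ∈ steps ℓ → (graph ℓ).Adj 0 c := fun hc => by
    rwa [graph_adj h2, sub_zero]
  refine SimpleGraph.not_stepSidorenko_and_not_isWeaklyNorming (G := graph ℓ) (o := 0) (p := p)
    (f := f) (d := d) (fun v => card_neighborFinset_graph h2 v) ⟨s(0, a), hadj0 ha⟩ hf1 hfo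
    (d * ∑ v, p v) (fun φ hφ hK => Nat.mul_le_mul_left _ (main φ hφ hK).1) ?_
  refine sum_neg_of_le_sq hN ((Finset.card_le_univ _).trans_eq Nat.card_eq_fintype_card.symm) (x := fun v => v) ?_ ?_ ?_
  · simp only [Finset.mem_filter]
    exact ⟨⟨@Finset.mem_univ _ (_) _, fun _ _ h => h⟩, trivial⟩
  · rw [SimpleGraph.splitWeight_of_unique _ _ (v := 0) rfl (fun _ h => h) (hadj0 ha) (hadj0 hb) hab
      fun w _ hw => hf0 w hw, hfa, hfb]
    ring
  · intro φ hφ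
    simp only [Finset.mem_filter] at hφ
    by_cases hK : (graph ℓ).splitWeight 0 f φ = 1
    · rw [hK, sub_self]
      positivity
    · exact (main φ hφ.1.2 hK).2 (Nat.eq_of_mul_eq_mul_left hd0 hφ.2)

end Even

end Torus

/-! ### Graphs that are not bipartite -/

namespace SimpleGraph

variable {V : Type*} [Fintype V] {H : SimpleGraph V}

/-- A map to `Bool` with nonzero product along the edges would be a proper 2-colouring. -/
theorem homDensity_kernel_eq_zero (hH : ¬ H.IsBipartite) (L : UniformLabelling Bool) :
    H.homDensity (L.kernel (fun b b' => if b = b' then 0 else 1) fun b b' => by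
      simp only [eq_comm]) = 0 := by
  classical
  rw [homDensity_kernel, partitionFunction, Finset.sum_eq_zero, mul_zero]
  intro ψ _
  by_contra hne
  refine hH (Coloring.mk ψ fun {u v} huv h => hne ?_).colorable
  refine Finset.prod_eq_zero (i := s(u, v)) (mem_edgeFinset.2 huv) ?_
  exact if_pos h

theorem integral_kernel_ne (L : UniformLabelling Bool) :
    ∫ p : I × I, L.kernel (fun b b' => if b = b' then (0 : ℝ) else 1) (fun b b' => by
      simp only [eq_comm]) p.1 p.2 = 1 / 2 := by
  refine (L.integral_prod fun b b' => if b = b' then (0 : ℝ) else 1).trans ?_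
  norm_num [Fintype.sum_bool]

theorem isGraphon_kernel_ne (L : UniformLabelling Bool) :
    (L.kernel (fun b b' => if b = b' then (0 : ℝ) else 1) fun b b' => by
      simp only [eq_comm]).IsGraphon := by
  intro x y
  change (if L.toFun x = L.toFun y then (0 : ℝ) else 1) ∈ Set.Icc (0 : ℝ) 1
  split_ifs <;> simp

/-- The complete bipartite kernel has density `0` in a non-bipartite graph, whereas its average `1 /
2` has positive density. -/
theorem StepSidorenko.isBipartite (h : H.StepSidorenko) : H.IsBipartite := by
  by_contra hH
  obtain ⟨L⟩ := (inferInstance : Nonempty (UniformLabelling Bool))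
  have h1 := h _ (isGraphon_kernel_ne L) NonnullPartition.trivial
  rw [homDensity_kernel_eq_zero hH, homDensity_const (NonnullPartition.step_trivial _),
    integral_kernel_ne] at h1
  exact absurd h1 (not_le.2 (by positivity))

theorem IsWeaklyNorming.isBipartite (h : H.IsWeaklyNorming) : H.IsBipartite := by
  by_contra hH
  obtain ⟨L⟩ := (inferInstance : Nonempty (UniformLabelling Bool))
  by_cases hne : H.edgeSet.ncard = 0
  · refine hH ⟨Coloring.mk (fun _ => 0) fun {u v} huv => ?_⟩
    rw [Set.ncard_eq_zero] at hne
    exact absurd (show s(u, v) ∈ H.edgeSet from huv) (by simp [hne])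
  · have h1 := (h.1 _ (isGraphon_kernel_ne L)).1 (by
      rw [graphNorm, homDensity_kernel_eq_zero hH, Real.zero_rpow (by positivity)])
    have h2 := integral_kernel_ne L
    rw [integral_eq_zero_of_ae h1] at h2
    norm_num at h2

end SimpleGraph

/-! ### Toroidal grids -/

namespace SimpleGraph

theorem cycleGraph_adj_finEquiv {n : ℕ} [NeZero n] (hn : 3 ≤ n) (a b : Fin n) :
    (cycleGraph n).Adj a b ↔
      ZMod.finEquiv n b - ZMod.finEquiv n a = 1 ∨ ZMod.finEquiv n b - ZMod.finEquiv n a = -1 := by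
  obtain ⟨m, rfl⟩ : ∃ m, n = m + 2 := ⟨n - 2, by omega⟩
  rw [cycleGraph_adj, ← map_sub, or_comm, ← map_one (ZMod.finEquiv (m + 2)), ← map_neg,
    EmbeddingLike.apply_eq_iff_eq, EmbeddingLike.apply_eq_iff_eq, ← neg_sub b a, neg_eq_iff_eq_neg]

variable {k : ℕ} {ℓ : Fin k → ℕ}

/-- The toroidal grid is a Cayley graph. -/
def toroidalGridIso [∀ i, NeZero (ℓ i)] (h3 : ∀ i, 3 ≤ ℓ i) : toroidalGrid ℓ ≃g Torus.graph ℓ where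
  toEquiv := Equiv.piCongrRight fun i => (ZMod.finEquiv (ℓ i)).toEquiv
  map_rel_iff' := by
    intro u v
    rw [Torus.graph_adj fun i => by linarith [h3 i]]
    constructor
    · rintro ⟨i, s, hs, h⟩
      refine ⟨i, ?_, fun j hj => ?_⟩
      · rw [cycleGraph_adj_finEquiv (h3 i)]
        have := congrFun h i
        rw [Pi.single_eq_same] at this
        rw [← this] at hs
        exact hs
      · have := congrFun h j
        rw [Pi.single_eq_of_ne hj] at this
        exact ((ZMod.finEquiv (ℓ j)).injective (sub_eq_zero.1 this)).symm
    · rintro ⟨i, hi, h⟩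
      rw [cycleGraph_adj_finEquiv (h3 i)] at hi
      refine ⟨i, _, hi, funext fun j => ?_⟩
      by_cases hj : j = i
      · subst hj
        rw [Pi.single_eq_same]
        rfl
      · rw [Pi.single_eq_of_ne hj]
        change ZMod.finEquiv (ℓ j) (v j) - ZMod.finEquiv (ℓ j) (u j) = 0
        rw [h j hj, sub_self]

/-- Varying only coordinate `i` embeds the cycle of length `ℓ i` in the grid, and odd cycles are not
2-colourable. -/
theorem even_of_isBipartite_toroidalGrid (h3 : ∀ i, 3 ≤ ℓ i) (h : (toroidalGrid ℓ).IsBipartite)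
    (i : Fin k) : Even (ℓ i) := by
  by_contra hodd
  let x : ∀ i, Fin (ℓ i) := fun i => ⟨0, by linarith [h3 i]⟩
  let f : cycleGraph (ℓ i) →g toroidalGrid ℓ :=
    { toFun := Function.update x i
      map_rel' := fun {a b} hab => ⟨i, by simpa using hab, fun j hj => by
        rw [Function.update_of_ne hj, Function.update_of_ne hj]⟩ }
  have h1 : (cycleGraph (ℓ i)).Colorable 2 := Colorable.of_hom f h
  have h2 := chromaticNumber_cycleGraph_of_odd (ℓ i) (by linarith [h3 i]) (Nat.not_even_iff_odd.1 hodd)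
  have h4 := chromaticNumber_le_iff_colorable.2 h1
  rw [h2] at h4
  norm_cast at h4

/-- Either property makes all lengths even, hence at least `4`. A length other than `4` is then at
least `6`, and `k ≥ 2` supplies the second direction of the corner. -/
theorem toroidalGrid_eq_four (hk : 2 ≤ k) (h3 : ∀ i, 3 ≤ ℓ i)
    (h : (toroidalGrid ℓ).StepSidorenko ∨ (toroidalGrid ℓ).IsWeaklyNorming) (i : Fin k) :
    ℓ i = 4 := by
  have hE := even_of_isBipartite_toroidalGrid h3 (h.elim (·.isBipartite) (·.isBipartite))
  have : ∀ i, NeZero (ℓ i) := fun i => ⟨by have := h3 i; omega⟩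
  have h4 : ∀ i, 4 ≤ ℓ i := fun i => by
    obtain ⟨r, hr⟩ := hE i
    have := h3 i
    omega
  by_contra hi
  have h6 : 6 ≤ ℓ i := by
    obtain ⟨r, hr⟩ := hE i
    have := h3 i
    omega
  have : Nontrivial (Fin k) := Fin.nontrivial_iff_two_le.2 hk
  obtain ⟨j, hj⟩ := exists_ne i
  have := Torus.not_stepSidorenko_and_not_isWeaklyNorming h4 hE hj.symm h6
  rw [stepSidorenko_congr (toroidalGridIso h3), isWeaklyNorming_congr (toroidalGridIso h3)] at h
  exact h.elim this.1 this.2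

/-! ### Side length four -/

/-- An isomorphism of factors induces an isomorphism of Cartesian powers. -/
def cartesianPowerIso {ι V V' : Type*} {G : SimpleGraph V} {G' : SimpleGraph V'} (e : G ≃g G') :
    cartesianProduct (fun _ : ι => G) ≃g cartesianProduct (fun _ : ι => G') where
  toEquiv := Equiv.piCongrRight fun _ => e.toEquiv
  map_rel_iff' := by
    intro u v
    simp [cartesianProduct, e.map_adj_iff]

/-- A Cartesian power of Cartesian powers is a Cartesian power. -/
def cartesianPowerCurryIso {ι κ τ V : Type*} (G : SimpleGraph V) (e : ι × κ ≃ τ) :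
    cartesianProduct (fun _ : ι => cartesianProduct fun _ : κ => G) ≃g
      cartesianProduct (fun _ : τ => G) where
  toEquiv := (Equiv.curry ι κ V).symm.trans (Equiv.arrowCongr e (Equiv.refl V))
  map_rel_iff' := by
    intro u v
    constructor
    · rintro ⟨t, ht, h⟩
      refine ⟨(e.symm t).1, ⟨(e.symm t).2, ht, fun j hj => ?_⟩, fun i hi => funext fun j => ?_⟩
      · have := h (e ((e.symm t).1, j)) fun hh => hj (by rw [← hh]; simp)
        simpa using this
      · have := h (e (i, j)) fun hh => hi (by rw [← hh]; simp)
        simpa using this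
    · rintro ⟨i, ⟨j, hij, h⟩, h'⟩
      refine ⟨e (i, j), by simpa using hij, fun t ht => ?_⟩
      change u (e.symm t).1 (e.symm t).2 = v (e.symm t).1 (e.symm t).2
      by_cases hi : (e.symm t).1 = i
      · rw [hi]
        exact h _ fun hj => ht (e.symm_apply_eq.1 (Prod.ext hi hj))
      · rw [h' _ hi]

/-- The cycle of length four is the square. -/
def cycleGraphFourIso : cycleGraph 4 ≃g hypercube 2 where
  toFun := ![![false, false], ![false, true], ![true, true], ![true, false]]
  invFun b := if b 0 then if b 1 then 2 else 3 else if b 1 then 1 else 0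
  left_inv := by decide
  right_inv := by decide
  map_rel_iff' := by
    intro a b
    rw [hypercube, cartesianProduct, cycleGraph_adj]
    revert a b
    decide

/-- A power of the cycle of length four is a hypercube. -/
def toroidalGridFourIso (k : ℕ) : toroidalGrid (fun _ : Fin k => 4) ≃g hypercube (k * 2) :=
  (cartesianPowerIso cycleGraphFourIso).trans (cartesianPowerCurryIso ⊤ finProdFinEquiv)

theorem nonempty_iso_hypercube (h : ∀ i, ℓ i = 4) :
    Nonempty (toroidalGrid ℓ ≃g hypercube (k * 2)) := by
  obtain rfl : ℓ = fun _ => 4 := funext h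
  exact ⟨toroidalGridFourIso k⟩

theorem ne_zero_of_iso_hypercube (hk : 2 ≤ k) (h3 : ∀ i, 3 ≤ ℓ i) {d : ℕ}
    (φ : toroidalGrid ℓ ≃g hypercube d) : d ≠ 0 := by
  rintro rfl
  have h := φ.injective (Subsingleton.elim (φ fun i => ⟨0, by linarith [h3 i]⟩)
    (φ fun i => ⟨1, by linarith [h3 i]⟩))
  have := congrFun h ⟨0, by omega⟩
  simp at this

/-- Length four gives a hypercube, a hypercube has both properties, and either property forces
length four. -/
theorem toroidalGrid_tfae (hk : 2 ≤ k) (h3 : ∀ i, 3 ≤ ℓ i) :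
    ((toroidalGrid ℓ).StepSidorenko ↔ ∀ i, ℓ i = 4) ∧
      ((∀ i, ℓ i = 4) ↔ ∃ d : ℕ, Nonempty (toroidalGrid ℓ ≃g hypercube d)) ∧
      ((toroidalGrid ℓ).IsWeaklyNorming ↔ ∀ i, ℓ i = 4) := by
  have hcube : ∀ d, Nonempty (toroidalGrid ℓ ≃g hypercube d) →
      (toroidalGrid ℓ).StepSidorenko ∧ (toroidalGrid ℓ).IsWeaklyNorming := by
    rintro d ⟨φ⟩
    have hd := ne_zero_of_iso_hypercube hk h3 φ
    exact ⟨(stepSidorenko_congr φ).2 (hypercube_stepSidorenko hd),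
      (isWeaklyNorming_congr φ).2 (hypercube_isWeaklyNorming hd)⟩
  exact ⟨⟨fun h => toroidalGrid_eq_four hk h3 (Or.inl h),
      fun h => (hcube _ (nonempty_iso_hypercube h)).1⟩,
    ⟨fun h => ⟨_, nonempty_iso_hypercube h⟩,
      fun ⟨d, hd⟩ => toroidalGrid_eq_four hk h3 (Or.inl (hcube d hd).1)⟩,
    ⟨fun h => toroidalGrid_eq_four hk h3 (Or.inr h),
      fun h => (hcube _ (nonempty_iso_hypercube h)).2⟩⟩

end SimpleGraph

/-! ### Edge-transitivity, connectedness and bipartiteness -/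

namespace Torus

open SimpleGraph

variable {ι : Type*} [DecidableEq ι]

/-- The graph automorphism that permutes the coordinates around `x` and translates `x` to `y`. -/
def affineIso {n : ℕ} (hn : 2 ≤ n) (π : Equiv.Perm ι) (x y : ι → ZMod n) :
    graph (fun _ : ι => n) ≃g graph (fun _ : ι => n) where
  toEquiv := (Equiv.subRight x).trans ((Equiv.arrowCongr π (Equiv.refl _)).trans (Equiv.addRight y))
  map_rel_iff' := by
    intro u v
    rw [graph_adj fun _ => hn, graph_adj fun _ => hn]
    have h : ∀ (w : ι → ZMod n) (ρ : Equiv.Perm ι), w ∈ steps (fun _ : ι => n) →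
        w ∘ ρ.symm ∈ steps (fun _ : ι => n) := by
      rintro _ ρ ⟨i, s, hs, rfl⟩
      refine ⟨ρ i, s, hs, funext fun j => ?_⟩
      simp [Pi.single_apply, Equiv.symm_apply_eq]
    have e : ((Equiv.subRight x).trans ((Equiv.arrowCongr π (Equiv.refl _)).trans
        (Equiv.addRight y))) v - ((Equiv.subRight x).trans ((Equiv.arrowCongr π
        (Equiv.refl _)).trans (Equiv.addRight y))) u = (v - u) ∘ π.symm := by
      funext j
      simp
    rw [e]
    refine ⟨fun hw => ?_, h _ π⟩
    have := h _ π.symm hw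
    rwa [Equiv.symm_symm, Function.comp_assoc, Equiv.symm_comp_self, Function.comp_id] at this

theorem affineIso_self {n : ℕ} (hn : 2 ≤ n) (π : Equiv.Perm ι) (x y : ι → ZMod n) :
    affineIso hn π x y x = y := by
  funext j
  simp [affineIso]

theorem affineIso_add_single {n : ℕ} (hn : 2 ≤ n) (i j : ι) (x y : ι → ZMod n) :
    affineIso hn (Equiv.swap i j) x y (x + Pi.single i 1) = y + Pi.single j 1 := by
  funext k
  have : (Equiv.swap i j) k = i ↔ k = j := by
    rw [Equiv.swap_apply_eq_iff, Equiv.swap_apply_left]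
  simp [affineIso, Pi.single_apply, this, add_comm]

theorem exists_edge_eq {n : ℕ} {e : Sym2 (ι → ZMod n)} (he : e ∈ (graph fun _ : ι => n).edgeSet) :
    ∃ x i, e = s(x, x + Pi.single i 1) := by
  induction e with
  | _ u v =>
    obtain ⟨-, i, s, hs, h⟩ := he
    change v - u = Pi.single i s at h
    rcases hs with rfl | rfl
    · exact ⟨u, i, by rw [← h, add_sub_cancel]⟩
    · refine ⟨v, i, ?_⟩
      rw [Pi.single_neg, sub_eq_iff_eq_add] at h
      rw [h, neg_add_eq_sub, sub_add_cancel, Sym2.eq_swap]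

/-- Orient both edges in positive direction, swap their coordinate directions, and translate one
base point to the other. -/
theorem isEdgeTransitive_graph {n : ℕ} (hn : 2 ≤ n) :
    (graph fun _ : ι => n).IsEdgeTransitive := by
  intro e he e' he'
  obtain ⟨x, i, rfl⟩ := exists_edge_eq he
  obtain ⟨y, j, rfl⟩ := exists_edge_eq he'
  refine ⟨affineIso hn (Equiv.swap i j) x y, ?_⟩
  rw [Sym2.map_mk]
  exact congrArg₂ (fun a b => s(a, b)) (affineIso_self hn _ x y) (affineIso_add_single hn i j x y)

variable [Fintype ι] {ℓ : ι → ℕ} [∀ i, NeZero (ℓ i)] (h4 : ∀ i, 4 ≤ ℓ i) (he : ∀ i, Even (ℓ i))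
include h4 he

theorem connected_graph : (graph ℓ).Connected := by
  have h2 : ∀ i, 2 ≤ ℓ i := fun i => by linarith [h4 i]
  have h : ∀ x, (graph ℓ).Reachable x 0 := by
    intro x
    induction hn : norm x using Nat.strong_induction_on generalizing x with
    | _ n ih =>
      by_cases hx : x = 0
      · rw [hx]
      · obtain ⟨c, hc, hlt⟩ := exists_norm_add_lt h4 he hx
        exact ((graph_adj_add h2).2 hc).reachable.trans (ih _ (by omega) _ rfl)
  have : Nonempty (∀ i, ZMod (ℓ i)) := ⟨0⟩
  exact ⟨fun x y => (h x).trans (h y).symm⟩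

theorem isBipartite_graph : (graph ℓ).IsBipartite := by
  have h2 : ∀ i, 2 ≤ ℓ i := fun i => by linarith [h4 i]
  refine (Coloring.mk (fun x => decide (norm x % 2 = 0)) fun {x y} hxy h => ?_).colorable
  rw [graph_adj h2] at hxy
  have h5 := norm_add_step h4 he x hxy
  rw [add_sub_cancel] at h5
  rw [decide_eq_decide] at h
  omega

end Torus

/-! ### Equal side lengths and the counterexample -/

namespace SimpleGraph

theorem toroidalGrid_const {k n : ℕ} (hk : 2 ≤ k) (hn : 3 ≤ n) (he : Even n) :
    (toroidalGrid fun _ : Fin k => n).Connected ∧ (toroidalGrid fun _ : Fin k => n).IsBipartite ∧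
      (toroidalGrid fun _ : Fin k => n).IsEdgeTransitive ∧
      ((toroidalGrid fun _ : Fin k => n).IsWeaklyNorming ↔ n = 4) := by
  have h3 : ∀ i : Fin k, 3 ≤ (fun _ : Fin k => n) i := fun _ => hn
  have h4 : 4 ≤ n := by
    obtain ⟨r, hr⟩ := he
    omega
  have : NeZero n := ⟨by omega⟩
  let φ := toroidalGridIso h3
  refine ⟨φ.connected_iff.2 (Torus.connected_graph (fun _ => h4) fun _ => he),
    (Torus.isBipartite_graph (fun _ => h4) fun _ => he).of_hom φ.toHom,
    isEdgeTransitive_congr φ.symm (Torus.isEdgeTransitive_graph (by omega)), ?_⟩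
  rw [(toroidalGrid_tfae hk h3).2.2]
  exact ⟨fun h => h ⟨0, by omega⟩, fun h _ => h⟩

/-- The witness is `C₆ □ C₆`, with its vertices renumbered by `Fin m`. -/
theorem exists_isEdgeTransitive_not_isWeaklyNorming :
    ∃ (m : ℕ) (H : SimpleGraph (Fin m)), H.edgeSet.Nonempty ∧ H.Connected ∧ H.IsBipartite ∧
      H.IsEdgeTransitive ∧ ¬ H.IsWeaklyNorming := by
  obtain ⟨h1, h2, h3, h4⟩ := toroidalGrid_const (k := 2) (n := 6) le_rfl (by norm_num) (by decide)
  let T := toroidalGrid fun _ : Fin 2 => 6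
  let e := Fintype.equivFin (Fin 2 → Fin 6)
  let φ : T ≃g T.map e.toEmbedding := Iso.map e T
  refine ⟨_, T.map e.toEmbedding, ?_, φ.connected_iff.1 h1, h2.of_hom φ.symm.toHom,
    isEdgeTransitive_congr φ h3, fun h => ?_⟩
  · refine ⟨_, φ.toHom.map_mem_edgeSet (e := s(fun _ => 0, ![1, 0])) ?_⟩
    refine ⟨0, ?_, ?_⟩
    · exact Or.inr rfl
    · decide
  · exact absurd (h4.1 ((isWeaklyNorming_congr φ).2 h)) (by norm_num)

end SimpleGraph

theorem mainTheorem1 :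
    (∀ (k : ℕ) (ℓ : Fin k → ℕ), 2 ≤ k → (∀ i, 3 ≤ ℓ i) →
      ((SimpleGraph.toroidalGrid ℓ).StepSidorenko ↔ ∀ i, ℓ i = 4) ∧
      ((∀ i, ℓ i = 4) ↔ ∃ d : ℕ, Nonempty (SimpleGraph.toroidalGrid ℓ ≃g SimpleGraph.hypercube d)) ∧
      ((SimpleGraph.toroidalGrid ℓ).IsWeaklyNorming ↔ ∀ i, ℓ i = 4)) ∧
    (∀ k n : ℕ, 2 ≤ k → 3 ≤ n → Even n →
      (SimpleGraph.toroidalGrid fun _ : Fin k => n).Connected ∧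
      (SimpleGraph.toroidalGrid fun _ : Fin k => n).IsBipartite ∧
      (SimpleGraph.toroidalGrid fun _ : Fin k => n).IsEdgeTransitive ∧
      ((SimpleGraph.toroidalGrid fun _ : Fin k => n).IsWeaklyNorming ↔ n = 4)) ∧
    (∃ (m : ℕ) (H : SimpleGraph (Fin m)), H.edgeSet.Nonempty ∧ H.Connected ∧ H.IsBipartite ∧
      H.IsEdgeTransitive ∧ ¬ H.IsWeaklyNorming) :=
  ⟨fun _ _ hk h3 => SimpleGraph.toroidalGrid_tfae hk h3,
    fun _ _ hk hn he => SimpleGraph.toroidalGrid_const hk hn he,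
    SimpleGraph.exists_isEdgeTransitive_not_isWeaklyNorming⟩

end
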